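/- Let $V\in L^\infty(\mathbb R^3,\mathbb C)$ have compact support, let $R>0$, and let $\rho\in C_0^\infty(\mathbb R^3)$ with $\operatorname{supp}\rho\subset B_R=\{|x|<R\}$ and $\rho V=V$ almost everywhere. Let $\Sigma=\{0<\arg\lambda<\pi/2\}$. For $\lambda\in\Sigma$ such that $\Delta^2+V-\lambda^4$, as an operator in $L^2(\mathbb R^3)$ with domain $H^4(\mathbb R^3)$, has a bounded inverse, put $R_V(\lambda)=(\Delta^2+V-\lambda^4)^{-1}$, and denote by $R_V(\lambda):L^2_{\rm comp}(\mathbb R^3)\to L^2_{\rm loc}(\mathbb R^3)$ also its meromorphic continuation to complex $\lambda$; here a family of operators is called meromorphic (analytic) if $\chi R_V(\lambda)\chi$ is a meromorphic (analytic) family of bounded operators on $L^2(\mathbb R^3)$ for every $\chi\in C_0^\infty(\mathbb R^3)$. Write $t_-=\max\{-t,0\}$. Then there is a constant $C>0$, depending only on $V$, $\rho$ and $R$, such that for all $A>0$ and all $0<\delta<\frac1{2R}$ there is $C_0>0$ for which the following holds with $$\Omega_\delta=\{\lambda\in\mathbb C:\ \operatorname{Im}\lambda\ge -A-\delta\log(1+|\lambda|),\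 \operatorname{Re}\lambda\ge -A-\delta\log(1+|\lambda|),\ |\lambda|\ge C_0\}.$$ The region $\Omega_\delta$ is resonance-free: for every $\lambda\in\Omega_\delta\cap\Sigma$ the inverse $(\Delta^2+V-\lambda^4)^{-1}$ exists as a bounded operator on $L^2(\mathbb R^3)$, the family $R_V$ continues analytically from $\Omega_\delta\cap\Sigma$ to $\Omega_\delta$, and no meromorphic continuation of $R_V$ to a set containing $\Omega_\delta$ has a pole in $\Omega_\delta$. Moreover, for every $\lambda\in\Omega_\delta$ and $j=0,1,2,3,4$, $$\|\rho R_V(\lambda)\rho\|_{L^2(B_R)\to H^j(B_R)}\le C|\lambda|^{j-2}\left(e^{2R(\operatorname{Re}\lambda)_-}+e^{2R(\operatorname{Im}\lambda)_-}\right).$$ -/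

import Mathlib

open MeasureTheory TopologicalSpace Set Filter Topology
open scoped ENNReal Distributions SchwartzMap Laplacian

noncomputable section

namespace Biharmonic

/-- The Euclidean space `ℝ³`. -/
abbrev E3 : Type := EuclideanSpace ℝ (Fin 3)

/-- The Hilbert space `L²(ℝ³, ℂ)`. -/
abbrev L2 : Type := Lp ℂ 2 (volume : Measure E3)

/-- The space `L^∞(ℝ³, ℂ)`. It acts on `L²(ℝ³, ℂ)` by pointwise multiplication, written `•`. -/
abbrev Linfty : Type := Lp ℂ ∞ (volume : Measure E3)

/-- The space `C₀^∞(ℝ³)` of smooth compactly supported complex functions. -/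
abbrev Cutoff : Type := 𝓓((⊤ : Opens E3), ℂ)

/-- A measurable function vanishes almost everywhere outside some compact set. -/
def HasCompactEssSupport (u : E3 → ℂ) : Prop :=
  ∃ K : Set E3, IsCompact K ∧ ∀ᵐ x, x ∉ K → u x = 0

/-- The space `L²_comp(ℝ³)`. -/
def L2comp : Submodule ℂ L2 where
  carrier := {f | HasCompactEssSupport f}
  zero_mem' := by
    exact ⟨∅, isCompact_empty, ae_of_all _ fun x _ => by simp⟩
  add_mem' := by
    rintro f g ⟨K, hK, hf⟩ ⟨L, hL, hg⟩
    refine ⟨K ∪ L, hK.union hL, ?_⟩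
    filter_upwards [hf, hg, Lp.coeFn_add f g] with x h1 h2 h3 hx
    rw [h3, Pi.add_apply, h1 fun h => hx (Or.inl h), h2 fun h => hx (Or.inr h), add_zero]
  smul_mem' := by
    rintro c f ⟨K, hK, hf⟩
    refine ⟨K, hK, ?_⟩
    filter_upwards [hf, Lp.coeFn_smul c f] with x h1 h2 hx
    rw [h2, Pi.smul_apply, h1 hx, smul_zero]

/-- A cutoff, as an element of `L^∞(ℝ³)`. -/
def cutoffLinfty (χ : Cutoff) : Linfty :=
  (χ.continuous.memLp_top_of_hasCompactSupport χ.hasCompactSupport volume).toLp χ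

/-- Multiplication by a cutoff, `f ↦ χ f`, as a map `L²(ℝ³) → L²_comp(ℝ³)`. -/
def cutoffMul (χ : Cutoff) (f : L2) : L2comp :=
  ⟨cutoffLinfty χ • f, by
    refine ⟨tsupport χ, χ.hasCompactSupport, ?_⟩
    filter_upwards [Lp.coeFn_lpSMul (r := 2) (cutoffLinfty χ) f,
      (χ.continuous.memLp_top_of_hasCompactSupport χ.hasCompactSupport volume).coeFn_toLp]
      with x h1 h2 hx
    have h3 : (cutoffLinfty χ : E3 → ℂ) x = χ x := h2
    rw [h1, Pi.smul_apply', h3, image_eq_zero_of_notMem_tsupport hx, zero_smul]⟩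

/-- Linear maps from `L²_comp(ℝ³)` to (classes of) measurable functions. The families considered
below take values in `L²_loc(ℝ³)`, as their truncations by cutoffs are bounded on `L²(ℝ³)`. -/
abbrev LocalOp : Type := L2comp →ₗ[ℂ] (E3 →ₘ[volume] ℂ)

/-- The truncation `χ T χ` of `T`, applied to `f ∈ L²(ℝ³)`. -/
def truncate (χ : Cutoff) (T : LocalOp) (f : L2) : E3 →ₘ[volume] ℂ :=
  (cutoffLinfty χ : E3 →ₘ[volume] ℂ) * T (cutoffMul χ f)

/-- `u` lies in `H⁴(ℝ³)` and `(Δ² + V - z) u = f`. The equation holds in the sense of (tempered)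
distributions, equivalently in `L²(ℝ³)`. -/
def SolvesH4 (V : Linfty) (z : ℂ) (u f : L2) : Prop :=
  TemperedDistribution.MemSobolev 4 2 (u : 𝓢'(E3, ℂ)) ∧
    Δ (Δ (u : 𝓢'(E3, ℂ))) + ((V • u : L2) : 𝓢'(E3, ℂ)) - z • (u : 𝓢'(E3, ℂ)) = (f : 𝓢'(E3, ℂ))

/-- `T` is the bounded two-sided inverse `(Δ² + V - z)⁻¹ : L²(ℝ³) → L²(ℝ³)`, where `Δ² + V`
has the domain `H⁴(ℝ³)`. -/
def IsResolventAt (V : Linfty) (z : ℂ) (T : L2 →L[ℂ] L2) : Prop :=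
  (∀ f : L2, SolvesH4 V z (T f) f) ∧ ∀ u f : L2, SolvesH4 V z u f → T f = u

/-- The open first quadrant `Σ = {0 < arg λ < π/2}`. -/
def firstQuadrant : Set ℂ := {lam | 0 < lam.re ∧ 0 < lam.im}

/-- `RV` is, on the set `D`, a meromorphic family of operators `L²_comp(ℝ³) → L²_loc(ℝ³)` whose
set of poles is `P`, and it continues `λ ↦ (Δ² + V - λ⁴)⁻¹` from the first quadrant: wherever this
inverse exists in `D ∩ Σ`, it agrees with `RV λ` on `L²_comp(ℝ³)`. Meromorphy is that of the
truncations `χ RV(λ) χ`, for all cutoffs `χ`, as bounded operators on `L²(ℝ³)`. The points of `P`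
are genuine poles (not removable) for some cutoff, and the values of `RV` on `P` play no role. -/
structure IsResolventFamily (V : Linfty) (D : Set ℂ) (RV : ℂ → LocalOp) (P : Set ℂ) : Prop where
  eq_resolvent : ∀ lam ∈ D ∩ firstQuadrant, ∀ T : L2 →L[ℂ] L2, IsResolventAt V (lam ^ 4) T →
    lam ∉ P ∧ ∀ f : L2comp, RV lam f = ((T f : L2) : E3 →ₘ[volume] ℂ)
  poles_subset : P ⊆ D
  poles_discrete : ∀ lam ∈ D, ∀ᶠ w in 𝓝[≠] lam, w ∉ P
  meromorphic : ∃ S : Cutoff → ℂ → (L2 →L[ℂ] L2),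
    (∀ χ, ∀ lam ∈ D \ P, AnalyticAt ℂ (S χ) lam ∧
      ∀ f : L2, ((S χ lam f : L2) : E3 →ₘ[volume] ℂ) = truncate χ (RV lam) f) ∧
    (∀ χ, ∀ lam ∈ P, MeromorphicAt (S χ) lam) ∧
    ∀ lam ∈ P, ∃ χ, meromorphicOrderAt (S χ) lam < 0

/-- The region `Ω_δ`. -/
def logRegion (A δ C₀ : ℝ) : Set ℂ :=
  {lam | -A - δ * Real.log (1 + ‖lam‖) ≤ lam.im ∧ -A - δ * Real.log (1 + ‖lam‖) ≤ lam.re ∧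
    C₀ ≤ ‖lam‖}

/-- The open ball `B_R` centred at the origin. -/
def ballR (R : ℝ) : Opens E3 := ⟨Metric.ball 0 R, Metric.isOpen_ball⟩

/-- `v` is the weak derivative `∂_{I 0} ⋯ ∂_{I (m-1)} u` on the open set `U`. -/
def HasWeakDeriv (U : Opens E3) {m : ℕ} (I : Fin m → Fin 3) (u v : E3 → ℂ) : Prop :=
  ∀ φ : 𝓓(U, ℂ),
    ∫ x in (U : Set E3), u x * iteratedFDeriv ℝ m φ x (fun k => EuclideanSpace.single (I k) 1) =
      (-1) ^ m * ∫ x in (U : Set E3), v x * φ x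

/-- `u` belongs to the Sobolev space `H^j(U)`. -/
def MemH (U : Opens E3) (j : ℕ) (u : E3 → ℂ) : Prop :=
  MemLp u 2 (volume.restrict (U : Set E3)) ∧
    ∀ m ≤ j, ∀ I : Fin m → Fin 3, ∃ v : E3 → ℂ,
      MemLp v 2 (volume.restrict (U : Set E3)) ∧ HasWeakDeriv U I u v

open Classical in
/-- The weak derivative in `L²(U)` of a given multi-index, `0` if there is none. It is unique up to
null sets. -/
def weakDeriv (U : Opens E3) {m : ℕ} (I : Fin m → Fin 3) (u : E3 → ℂ) : E3 → ℂ :=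
  if h : ∃ v : E3 → ℂ, MemLp v 2 (volume.restrict (U : Set E3)) ∧ HasWeakDeriv U I u v
  then h.choose else 0

open Classical in
/-- The norm of `H^j(U)`, equal to `∞` outside of `H^j(U)`:
`‖u‖² = ∑_{m ≤ j} ∑_{i₁, …, i_m} ‖∂_{i₁} ⋯ ∂_{i_m} u‖²_{L²(U)}`. -/
def normH (U : Opens E3) (j : ℕ) (u : E3 → ℂ) : ℝ≥0∞ :=
  if MemH U j u then
    (∑ m ∈ Finset.range (j + 1), ∑ I : Fin m → Fin 3,
      eLpNorm (weakDeriv U I u) 2 (volume.restrict (U : Set E3)) ^ 2) ^ (1 / 2 : ℝ)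
  else ∞

end Biharmonic

end

open MeasureTheory TopologicalSpace Set Filter Topology
open scoped ENNReal Distributions SchwartzMap Laplacian

noncomputable section

namespace Biharmonic

open FourierTransform LineDeriv

/-! For λ in the first quadrant, 1/(t⁴ - λ⁴) = (1/(t² - λ²) - 1/(t² + λ²))/(2λ²) shows that R₀ = (Δ²
- λ⁴)⁻¹ is convolution with (e^{iλ|x|} - e^{-λ|x|})/(8πλ²|x|), a kernel that makes sense for every λ
≠ 0. Between functions supported in B_r and B_s only its values at |x| < r + s matter, so it may be
multiplied by a bump function of |x|. With supp ρ ⊂ B_s and s < R, the bump is taken to be 1 up to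
2s and 0 from 2R on (`cutOp`).

The Fourier transform of the cut kernel is a sine transform. A direct estimate bounds it by a
constant times E/|λ|², where E = e^{2R(Re λ)_-} + e^{2R(Im λ)_-}; four integrations by parts give
decay of order four in ξ. Interpolating, the derivatives of order m ≤ 4 of the cut operator have
norm at most a constant times |λ|^{m-2} E on L², for |λ| ≥ 1 (`exists_pow_mul_cutSymbol_le`,
`exists_derivBound_cutOp`). On Ω_δ the condition 2Rδ < 1 gives E = O(|λ|). Hence V R₀ ρ, with R₀
replaced by the cut operator, has norm O(1/|λ|), which is at most 1/2 for |λ| ≥ C₀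
(`eventually_norm_perturbation_le`).

So 1 + V R₀ ρ is invertible by a Neumann series, and R_V = R₀ - R₀ ρ (1 + V R₀ ρ)⁻¹ V R₀
(`isResolventAt_perturb`). To continue this out of the first quadrant, where the full kernel may
grow exponentially, the outer factors R₀ are replaced by kernels cut at a growing radius n; the
truncations to balls stabilize in n, and their limit is the continuation
(`Stabilizes.exists_localOp`, `exists_isResolventFamily`). Any other continuation coincides with
this one by the identity theorem, because Ω_δ is connected (`isPreconnected_logRegion`,
`IsResolventFamily.eq_truncated_approxRes`).

In ρ R_V ρ every factor R₀ may be replaced by the one operator cut at 2R, so its bounds pass to ρ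
R_V ρ (`exists_normH_approxRes_le`). The inverse contributes only a factor 2, which is why C does
not depend on A and δ. -/

/-! ### Multiplication operators and Fourier multipliers on L² -/

/-- Multiplication by a function in `L^∞(ℝ³)`, as a bounded operator on `L²(ℝ³)`. -/
def mulOp (v : Linfty) : L2 →L[ℂ] L2 := (ContinuousLinearMap.lsmul ℂ ℂ).holderL volume ∞ 2 2 v

lemma coeFn_mulOp (v : Linfty) (f : L2) : mulOp v f =ᵐ[volume] fun x => v x * f x :=
  ContinuousLinearMap.coeFn_holder _ v f

lemma mulOp_apply (v : Linfty) (f : L2) : mulOp v f = v • f := by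
  refine Lp.ext ?_
  filter_upwards [coeFn_mulOp v f, Lp.coeFn_lpSMul (r := 2) v f] with x h1 h2
  rw [h1, h2]; rfl

lemma norm_mulOp_le (v : Linfty) : ‖mulOp v‖ ≤ ‖v‖ :=
  ContinuousLinearMap.opNorm_le_bound _ (norm_nonneg _) fun f => by
    rw [mulOp_apply]; exact Lp.norm_smul_le v f

lemma mulOp_congr_left {v w : Linfty} {f g : L2}
    (h : ∀ᵐ x, v x * f x = w x * g x) : mulOp v f = mulOp w g := by
  refine Lp.ext ?_
  filter_upwards [coeFn_mulOp v f, coeFn_mulOp w g, h] with x h1 h2 h3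
  rw [h1, h2, h3]

lemma mulOp_comm (v w : Linfty) : mulOp v * mulOp w = mulOp w * mulOp v := by
  ext1 f
  change mulOp v (mulOp w f) = mulOp w (mulOp v f)
  refine mulOp_congr_left ?_
  filter_upwards [coeFn_mulOp v f, coeFn_mulOp w f] with x h1 h2
  rw [h1, h2]; ring

lemma mulOp_mul_of_ae {u v w : Linfty} (h : ∀ᵐ x, v x * w x = u x) :
    mulOp v * mulOp w = mulOp u := by
  ext1 f
  change mulOp v (mulOp w f) = mulOp u f
  refine mulOp_congr_left ?_
  filter_upwards [coeFn_mulOp w f, h] with x h1 h2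
  rw [h1, ← h2]; ring

/-- Multiplication by a bounded function on `L²(ℝ³)`; zero if the function is not bounded. -/
def bddMul (σ : E3 → ℂ) : L2 →L[ℂ] L2 :=
  open Classical in if h : MemLp σ ∞ volume then mulOp (h.toLp σ) else 0

lemma coeFn_bddMul {σ : E3 → ℂ} (h : MemLp σ ∞ volume) (f : L2) :
    bddMul σ f =ᵐ[volume] fun x => σ x * f x := by
  rw [bddMul, dif_pos h]
  filter_upwards [coeFn_mulOp (h.toLp σ) f, h.coeFn_toLp] with x h1 h2
  rw [h1, h2]

lemma norm_bddMul_le {σ : E3 → ℂ} {B : ℝ} (hB : ∀ᵐ ξ, ‖σ ξ‖ ≤ B) (hB0 : 0 ≤ B) :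
    ‖bddMul σ‖ ≤ B := by
  by_cases h : MemLp σ ∞ volume
  · rw [bddMul, dif_pos h]
    refine (norm_mulOp_le _).trans ?_
    rw [Lp.norm_toLp]
    refine ENNReal.toReal_le_of_le_ofReal hB0 ?_
    rw [eLpNorm_exponent_top]
    exact eLpNormEssSup_le_of_ae_bound hB
  · rw [bddMul, dif_neg h, norm_zero]; exact hB0

/-- The Fourier multiplier with a bounded symbol, as a bounded operator on `L²(ℝ³)`. -/
def fourierMul (σ : E3 → ℂ) : L2 →L[ℂ] L2 :=
  ((Lp.fourierTransformₗᵢ E3 ℂ).symm : L2 →L[ℂ] L2) ∘L bddMul σ ∘L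
    ((Lp.fourierTransformₗᵢ E3 ℂ) : L2 →L[ℂ] L2)

lemma fourierMul_apply (σ : E3 → ℂ) (f : L2) : fourierMul σ f = 𝓕⁻ (bddMul σ (𝓕 f)) := rfl

lemma fourier_fourierMul (σ : E3 → ℂ) (f : L2) : 𝓕 (fourierMul σ f) = bddMul σ (𝓕 f) := by
  rw [fourierMul_apply, fourier_fourierInv_eq]

lemma norm_fourierMul_le {σ : E3 → ℂ} {B : ℝ} (hB : ∀ᵐ ξ, ‖σ ξ‖ ≤ B) (hB0 : 0 ≤ B) :
    ‖fourierMul σ‖ ≤ B := by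
  refine ContinuousLinearMap.opNorm_le_bound _ hB0 fun f => ?_
  change ‖(Lp.fourierTransformₗᵢ E3 ℂ).symm (bddMul σ (Lp.fourierTransformₗᵢ E3 ℂ f))‖ ≤ _
  rw [LinearIsometryEquiv.norm_map]
  refine ((bddMul σ).le_opNorm _).trans ?_
  rw [LinearIsometryEquiv.norm_map]
  exact mul_le_mul_of_nonneg_right (norm_bddMul_le hB hB0) (norm_nonneg _)

lemma fourierMul_congr {σ σ' : E3 → ℂ} (h : σ =ᵐ[volume] σ') : fourierMul σ = fourierMul σ' := by
  ext1 f
  rw [fourierMul_apply, fourierMul_apply]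
  congr 1
  by_cases h1 : MemLp σ ∞ volume
  · have h2 := (memLp_congr_ae h).1 h1
    refine Lp.ext ?_
    filter_upwards [coeFn_bddMul h1 (𝓕 f), coeFn_bddMul h2 (𝓕 f), h] with x a b c
    rw [a, b, c]
  -- For unbounded symbols both sides are the default value zero.
  · have h2 : ¬ MemLp σ' ∞ volume := fun h2 => h1 ((memLp_congr_ae h).2 h2)
    rw [bddMul, bddMul, dif_neg h1, dif_neg h2]

lemma fourierMul_add {σ σ' : E3 → ℂ} (h : MemLp σ ∞ volume) (h' : MemLp σ' ∞ volume) :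
    fourierMul (σ + σ') = fourierMul σ + fourierMul σ' := by
  ext1 f
  rw [add_apply, fourierMul_apply, fourierMul_apply, fourierMul_apply,
    ← fourierInv_add]
  congr 1
  refine Lp.ext ?_
  filter_upwards [coeFn_bddMul h (𝓕 f), coeFn_bddMul h' (𝓕 f), coeFn_bddMul (h.add h') (𝓕 f),
    Lp.coeFn_add (bddMul σ (𝓕 f)) (bddMul σ' (𝓕 f))] with x a b c d
  rw [c, d, Pi.add_apply, Pi.add_apply, a, b]; ring

lemma fourierMul_smul (c : ℂ) {σ : E3 → ℂ} (h : MemLp σ ∞ volume) :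
    fourierMul (c • σ) = c • fourierMul σ := by
  ext1 f
  rw [smul_apply, fourierMul_apply, fourierMul_apply, ← fourierInv_smul]
  congr 1
  refine Lp.ext ?_
  filter_upwards [coeFn_bddMul h (𝓕 f), coeFn_bddMul (h.const_smul c) (𝓕 f),
    Lp.coeFn_smul c (bddMul σ (𝓕 f))] with x a b d
  rw [b, d, Pi.smul_apply, Pi.smul_apply, a, smul_eq_mul, smul_eq_mul]; ring

/-! ### Translations and convolution operators -/

/-- Translation by `y` on `L²(ℝ³)`. -/
def translate (y : E3) : L2 →ₗᵢ[ℂ] L2 :=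
  Lp.compMeasurePreservingₗᵢ ℂ (fun x => x - y) (measurePreserving_sub_right volume y)

lemma coeFn_translate (y : E3) (f : L2) : translate y f =ᵐ[volume] fun x => f (x - y) :=
  Lp.coeFn_compMeasurePreserving f (measurePreserving_sub_right volume y)

lemma continuous_translate (f : L2) : Continuous fun y => translate y f := by
  let g : C(E3, C(E3, E3)) := (ContinuousMap.mk (fun p : E3 × E3 => p.2 - p.1)).curry
  exact (continuous_const (y := f)).compMeasurePreservingLp g.continuous
    (fun y => measurePreserving_sub_right volume y) (by simp)

/-- The character `ξ ↦ e^{-2πi⟨y, ξ⟩}`. -/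
def character (y ξ : E3) : ℂ := (Real.fourierChar (-inner ℝ y ξ) : ℂ)

lemma norm_character (y ξ : E3) : ‖character y ξ‖ = 1 := Circle.norm_coe _

lemma continuous_character : Continuous fun p : E3 × E3 => character p.1 p.2 := by
  unfold character
  exact continuous_subtype_val.comp (Real.continuous_fourierChar.comp (by fun_prop))

lemma memLp_character (y : E3) : MemLp (character y) ∞ volume :=
  memLp_top_of_bound (continuous_character.comp (by fun_prop : Continuous fun ξ => (y, ξ))
    ).aestronglyMeasurable 1 (ae_of_all _ fun ξ => (norm_character y ξ).le)

/-- Both sides are continuous in `f`, so it suffices to check Schwartz functions, where the Fourier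
transform is an honest integral. -/
lemma fourier_translate (y : E3) (f : L2) : 𝓕 (translate y f) = bddMul (character y) (𝓕 f) := by
  refine DenseRange.induction_on (p := fun f : L2 => 𝓕 (translate y f) = bddMul (character y) (𝓕 f))
    (SchwartzMap.denseRange_toLpCLM (F := ℂ) (E := E3) (p := 2) (μ := volume) ENNReal.ofNat_ne_top)
    f ?_ ?_
  · refine isClosed_eq ?_ ?_
    · exact (Lp.fourierTransformₗᵢ E3 ℂ).continuous.comp (translate y).continuous
    · exact (bddMul _).continuous.comp (Lp.fourierTransformₗᵢ E3 ℂ).continuous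
  · intro φ
    have h1 : translate y (φ.toLp 2) = (φ.compSubConstCLM ℂ y).toLp 2 := by
      refine Lp.ext ?_
      filter_upwards [coeFn_translate y (φ.toLp 2), (φ.compSubConstCLM ℂ y).coeFn_toLp 2,
        (measurePreserving_sub_right volume y).quasiMeasurePreserving.ae_eq_comp
          (φ.coeFn_toLp 2 volume)]
        with x a b c
      rw [a, b]; exact c
    change 𝓕 (translate y (φ.toLp 2)) = bddMul (character y) (𝓕 (φ.toLp 2))
    rw [h1, SchwartzMap.toLp_fourier_eq, SchwartzMap.toLp_fourier_eq]
    refine Lp.ext ?_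
    filter_upwards [coeFn_bddMul (memLp_character y) ((𝓕 φ).toLp 2),
      (𝓕 (φ.compSubConstCLM ℂ y)).coeFn_toLp 2, (𝓕 φ).coeFn_toLp 2] with ξ a b c
    rw [a, b, c]
    have := congrFun (VectorFourier.fourierIntegral_comp_add_right Real.fourierChar volume
      (innerₗ E3) (φ : E3 → ℂ) (-y)) ξ
    rw [SchwartzMap.fourier_coe, SchwartzMap.fourier_coe]
    simp only [innerₗ_apply_apply, inner_neg_left] at this
    exact this

lemma fourier_eq_integral_character (k : E3 → ℂ) (ξ : E3) :
    𝓕 k ξ = ∫ y, character y ξ * k y := rfl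

lemma memLp_top_fourier {k : E3 → ℂ} (hk : Integrable k) : MemLp (𝓕 k) ∞ volume :=
  memLp_top_of_bound (VectorFourier.fourierIntegral_continuous Real.continuous_fourierChar
    continuous_inner hk).aestronglyMeasurable (∫ y, ‖k y‖)
    (ae_of_all _ fun _ => VectorFourier.norm_fourierIntegral_le_integral_norm _ _ _ _ _)

/-- The Fourier multiplier with symbol `𝓕 k` is the convolution with `k`. -/
theorem fourierMul_fourier_apply {k : E3 → ℂ} (hk : Integrable k) (f : L2) :
    fourierMul (𝓕 k) f = ∫ y, k y • translate y f := by
  have hint : Integrable fun y => k y • translate y f :=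
    hk.smul_of_top_left (memLp_top_of_bound (continuous_translate f).aestronglyMeasurable ‖f‖
      (ae_of_all _ fun y => ((translate y).norm_map f).le))
  apply (Lp.fourierTransformₗᵢ E3 ℂ).injective
  have h1 : Lp.fourierTransformₗᵢ E3 ℂ (∫ y, k y • translate y f) =
      ∫ y, k y • bddMul (character y) (𝓕 f) := by
    have := ((Lp.fourierTransformₗᵢ E3 ℂ).toContinuousLinearEquiv :
      L2 →L[ℂ] L2).integral_comp_comm hint
    refine this.symm.trans (integral_congr_ae (ae_of_all _ fun y => ?_))
    change 𝓕 (k y • translate y f) = _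
    rw [fourier_smul, fourier_translate]
  have hint' : Integrable fun y => k y • bddMul (character y) (𝓕 f) := by
    have := ((Lp.fourierTransformₗᵢ E3 ℂ).toContinuousLinearEquiv :
      L2 →L[ℂ] L2).integrable_comp hint
    refine this.congr (ae_of_all _ fun y => ?_)
    change 𝓕 (k y • translate y f) = _
    rw [fourier_smul, fourier_translate]
  rw [h1]
  change 𝓕 (fourierMul (𝓕 k) f) = _
  rw [fourier_fourierMul]
  set F : L2 := 𝓕 f
  -- Pairing with `g` makes the Bochner integral scalar; Fubini then lets the integral in `y`
  -- produce 𝓕 k.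
  refine ext_inner_left ℂ fun g => ?_
  rw [← integral_inner hint', L2.inner_def]
  have hFg : Integrable fun ξ => F ξ * (starRingEnd ℂ) (g ξ) := by
    simpa only [RCLike.inner_apply] using L2.integrable_inner (𝕜 := ℂ) g F
  have h2 : ∀ y, inner ℂ g (k y • bddMul (character y) F) =
      ∫ ξ, k y * character y ξ * (F ξ * (starRingEnd ℂ) (g ξ)) := fun y => by
    rw [inner_smul_right, L2.inner_def, ← integral_const_mul]
    refine integral_congr_ae ?_
    filter_upwards [coeFn_bddMul (memLp_character y) F] with ξ a
    rw [a, RCLike.inner_apply]; ring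
  simp_rw [h2]
  rw [integral_integral_swap]
  · refine integral_congr_ae ?_
    filter_upwards [coeFn_bddMul (memLp_top_fourier hk) F] with ξ a
    rw [a, RCLike.inner_apply, fourier_eq_integral_character, integral_mul_const, mul_assoc]
    congr 1
    exact integral_congr_ae (ae_of_all _ fun y => mul_comm _ _)
  · have h3 := (hk.mul_prod hFg).bdd_mul
      (continuous_character.aestronglyMeasurable (μ := volume.prod volume)) (c := 1)
      (ae_of_all _ fun p => (norm_character p.1 p.2).le)
    refine h3.congr (ae_of_all _ fun p => ?_)
    simp only [Function.uncurry]; ring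

/-- `v` vanishes outside the ball of radius `r` around the origin. -/
def SuppIn (v : Linfty) (r : ℝ) : Prop := ∀ᵐ x, r ≤ ‖x‖ → v x = 0

/-- Convolution with a kernel vanishing on a ball does not connect nearby sets. -/
theorem mulOp_fourierMul_mulOp_eq_zero {k : E3 → ℂ} (hk : Integrable k) {r s : ℝ}
    (h0 : ∀ y, ‖y‖ < r + s → k y = 0) {v w : Linfty} (hv : SuppIn v r) (hw : SuppIn w s) :
    mulOp v * fourierMul (𝓕 k) * mulOp w = 0 := by
  ext1 f
  change mulOp v (fourierMul (𝓕 k) (mulOp w f)) = 0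
  have hint : Integrable fun y => k y • translate y (mulOp w f) :=
    hk.smul_of_top_left (memLp_top_of_bound (continuous_translate _).aestronglyMeasurable _
      (ae_of_all _ fun y => ((translate y).norm_map _).le))
  rw [fourierMul_fourier_apply hk, ← (mulOp v).integral_comp_comm hint]
  refine integral_eq_zero_of_ae (ae_of_all _ fun y => ?_)
  simp only [map_smul, Pi.zero_apply]
  by_cases hy : ‖y‖ < r + s
  · rw [h0 y hy, zero_smul]
  · have : mulOp v (translate y (mulOp w f)) = 0 := by
      refine (Lp.eq_zero_iff_ae_eq_zero).2 ?_
      have hq := (measurePreserving_sub_right (volume : Measure E3) y).quasiMeasurePreserving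
      filter_upwards [coeFn_mulOp v (translate y (mulOp w f)), coeFn_translate y (mulOp w f),
        hq.ae_eq_comp (coeFn_mulOp w f), hv, hq.ae hw] with x a b c d e
      rw [a, b]
      simp only [Function.comp_apply] at c
      rw [c, Pi.zero_apply]
      by_cases hx : r ≤ ‖x‖
      · rw [d hx, zero_mul]
      -- Here ‖x‖ < r and ‖y‖ ≥ r + s, so x - y lies outside the ball that carries `w`.
      · have : s ≤ ‖x - y‖ := by
          have := norm_sub_norm_le y x
          rw [norm_sub_rev] at this
          linarith
        rw [e this, zero_mul, mul_zero]
    rw [this, smul_zero]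

/-! ### The Fourier transform of radial functions -/

/-- In polar coordinates the Jacobian r² turns h(r)/r into r h(r). -/
lemma integrable_radial {h : ℝ → ℂ} (hint : IntegrableOn (fun r : ℝ => (r : ℂ) * h r) (Ioi 0)) :
    Integrable fun x : E3 => h ‖x‖ / (‖x‖ : ℂ) := by
  refine (integrable_fun_norm_addHaar (volume : Measure E3)
    (f := fun r : ℝ => h r / (r : ℂ))).2 ?_
  refine hint.congr_fun (fun r hr => ?_) measurableSet_Ioi
  have hr' : (r : ℂ) ≠ 0 := by exact_mod_cast (mem_Ioi.1 hr).ne'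
  simp only [finrank_euclideanSpace, Fintype.card_fin, Complex.real_smul]
  push_cast
  field_simp

/-- Splitting off the first coordinate, `ℝ³ ≃ ℝ × ℂ`. -/
def splitEquiv : E3 ≃ᵐ ℝ × ℂ :=
  (MeasurableEquiv.toLp 2 (Fin 3 → ℝ)).symm.trans
    ((MeasurableEquiv.piFinSuccAbove (fun _ : Fin 3 => ℝ) 0).trans
      ((MeasurableEquiv.refl ℝ).prodCongr Complex.measurableEquivPi.symm))

lemma measurePreserving_splitEquiv : MeasurePreserving splitEquiv volume volume := by
  refine (EuclideanSpace.volume_preserving_symm_measurableEquiv_toLp (Fin 3)).trans ?_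
  refine (volume_preserving_piFinSuccAbove (fun _ : Fin 3 => ℝ) 0).trans ?_
  exact (MeasurePreserving.id volume).prod Complex.volume_preserving_equiv_pi.symm

lemma splitEquiv_fst (x : E3) : (splitEquiv x).1 = x 0 := rfl

lemma norm_eq_splitEquiv (x : E3) :
    ‖x‖ = √((splitEquiv x).1 ^ 2 + ‖(splitEquiv x).2‖ ^ 2) := by
  have h1 : (splitEquiv x).2 = ⟨x 1, x 2⟩ := by
    change Complex.measurableEquivPi.symm _ = _
    rw [Complex.measurableEquivPi_symm_apply]
    apply Complex.ext <;> simp [Fin.removeNth]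
  rw [h1, splitEquiv_fst, EuclideanSpace.norm_eq, ← Complex.normSq_eq_norm_sq, Complex.normSq_mk,
    Fin.sum_univ_three]
  simp only [Real.norm_eq_abs, sq_abs]
  congr 1; ring

/-- Substitute r = √(z² + y²): since r dr = y dy, the planar Jacobian y absorbs the factor 1/r. This
is why kernels are written as a profile divided by |x|. The condition z ≠ 0 keeps the square root
differentiable. -/
lemma integral_radial_plane (h : ℝ → ℂ) {z : ℝ} (hz : z ≠ 0) :
    ∫ p : ℂ, h √(z ^ 2 + ‖p‖ ^ 2) / (√(z ^ 2 + ‖p‖ ^ 2) : ℂ) =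
      2 * Real.pi * ∫ r in Ioi |z|, h r := by
  rw [integral_fun_norm_addHaar (volume : Measure ℂ)
    (fun y : ℝ => h √(z ^ 2 + y ^ 2) / (√(z ^ 2 + y ^ 2) : ℂ))]
  have h1 : (volume : Measure ℂ).real (Metric.ball 0 1) = Real.pi := by
    rw [Measure.real, Complex.volume_ball]; simp
  have hpos : ∀ y : ℝ, 0 < z ^ 2 + y ^ 2 := fun y => by positivity
  have h2 : (fun y : ℝ => √(z ^ 2 + y ^ 2)) '' Ioi 0 = Ioi |z| := by
    ext r
    simp only [mem_image, mem_Ioi]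
    constructor
    · rintro ⟨y, hy, rfl⟩
      rw [← Real.sqrt_sq_eq_abs]
      exact Real.sqrt_lt_sqrt (sq_nonneg z) (by nlinarith)
    · intro hr
      have hr0 : 0 < r := (abs_nonneg z).trans_lt hr
      have h3 : 0 < r ^ 2 - z ^ 2 := by
        have := sq_lt_sq' (by linarith [neg_abs_le z, abs_nonneg z]) hr
        rw [sq_abs] at this; linarith
      refine ⟨√(r ^ 2 - z ^ 2), Real.sqrt_pos.2 h3, ?_⟩
      rw [Real.sq_sqrt h3.le, add_sub_cancel, Real.sqrt_sq hr0.le]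
  have h4 := integral_image_eq_integral_abs_deriv_smul (s := Ioi (0 : ℝ))
    (f := fun y : ℝ => √(z ^ 2 + y ^ 2)) (f' := fun y => y / √(z ^ 2 + y ^ 2)) measurableSet_Ioi
    (fun y _ => by
      have := ((hasDerivAt_pow 2 y).const_add (z ^ 2)).sqrt (hpos y).ne'
      refine (this.congr_deriv ?_).hasDerivWithinAt
      have := (Real.sqrt_pos.2 (hpos y)).ne'
      field_simp
      simp) (fun y hy w hw hyw => by
      have h5 := (Real.sqrt_inj (hpos y).le (hpos w).le).1 hyw
      have h6 : y ^ 2 = w ^ 2 := by linarith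
      exact (pow_left_inj₀ (le_of_lt hy) (le_of_lt hw) two_ne_zero).1 h6) h
  rw [h2] at h4
  rw [h4, h1]
  simp only [Complex.finrank_real_complex, nsmul_eq_mul, Complex.real_smul]
  push_cast
  rw [mul_assoc]
  congr 2
  refine setIntegral_congr_fun measurableSet_Ioi fun y hy => ?_
  have hy' : (0 : ℝ) < y := hy
  have : 0 < √(z ^ 2 + y ^ 2) := Real.sqrt_pos.2 (hpos y)
  simp only [abs_of_pos (div_pos hy' this)]
  have h7 : ((√(z ^ 2 + y ^ 2) : ℝ) : ℂ) ≠ 0 := by exact_mod_cast this.ne'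
  push_cast
  field_simp

lemma integral_exp_symm {a : ℝ} (ha : a ≠ 0) (r : ℝ) :
    ∫ z in (-r)..r, Complex.exp (-(a * z : ℝ) * Complex.I) = 2 * Real.sin (a * r) / a := by
  have ha' : (a : ℂ) ≠ 0 := by exact_mod_cast ha
  have h := integral_exp_mul_complex (a := -r) (b := r) (c := -(a : ℂ) * Complex.I)
    (by simp [ha'])
  have h2 : ∀ z : ℝ, Complex.exp (-(a * z : ℝ) * Complex.I) =
      Complex.exp (-(a : ℂ) * Complex.I * z) := fun z => by
    congr 1; push_cast; ring
  simp_rw [h2]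
  rw [h, Complex.ofReal_sin, Complex.sin]
  push_cast
  have e1 : -(a : ℂ) * Complex.I * r = -(a * r) * Complex.I := by ring
  have e2 : -(a : ℂ) * Complex.I * -r = a * r * Complex.I := by ring
  rw [e1, e2]
  field_simp
  linear_combination (Complex.exp (a * r * Complex.I) - Complex.exp (-(a * r * Complex.I))) *
    Complex.I_sq

/-- The reflection exchanging ξ with the vector of the same length on the first axis preserves
radial functions and commutes with the Fourier transform. -/
lemma fourier_norm_comp_eq (g : ℝ → ℂ) (ξ : E3) :
    𝓕 (fun x : E3 => g ‖x‖) ξ = 𝓕 (fun x : E3 => g ‖x‖) (EuclideanSpace.single 0 ‖ξ‖) := by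
  have h : ‖ξ‖ = ‖(EuclideanSpace.single 0 ‖ξ‖ : E3)‖ := by simp
  set A := Submodule.reflection (ℝ ∙ (ξ - EuclideanSpace.single 0 ‖ξ‖))ᗮ
  have h1 := Real.fourier_comp_linearIsometry A (fun x : E3 => g ‖x‖) ξ
  have h2 : (fun x : E3 => g ‖x‖) ∘ A = fun x : E3 => g ‖x‖ := by
    funext x
    simp
  rw [Submodule.reflection_sub h, h2] at h1
  exact h1

/-- Justifies Fubini for the slicing of ℝ³ by planes: for fixed r > 0 the slice in z is (-r, r), of
length 2r, whence the weight r in the hypothesis. -/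
lemma integrable_strip {h : ℝ → ℂ} (hm : Measurable h)
    (hint : IntegrableOn (fun r : ℝ => (r : ℂ) * h r) (Ioi 0)) :
    Integrable (fun p : ℝ × ℝ => (Ioi |p.1|).indicator h p.2)
      (volume.prod (volume.restrict (Ioi 0))) := by
  have hmeas : Measurable fun p : ℝ × ℝ => (Ioi |p.1|).indicator h p.2 := by
    have : (fun p : ℝ × ℝ => (Ioi |p.1|).indicator h p.2) =
        {p : ℝ × ℝ | |p.1| < p.2}.indicator fun p => h p.2 := by
      ext p; simp [indicator]
    rw [this]
    exact (hm.comp measurable_snd).indicator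
      (measurableSet_lt (by fun_prop) measurable_snd)
  have hslice : ∀ r : ℝ, (fun z : ℝ => (Ioi |z|).indicator h r) =
      (Ioo (-r) r).indicator fun _ => h r := fun r => by
    ext z; simp only [indicator, mem_Ioi, mem_Ioo, abs_lt]
  refine (integrable_prod_iff' hmeas.aestronglyMeasurable).2 ⟨ae_of_all _ fun r => ?_, ?_⟩
  · simp only [hslice]
    exact (integrable_indicator_iff measurableSet_Ioo).2 (integrableOn_const (by simp))
  · refine (hint.norm.const_mul 2).congr ?_
    filter_upwards [ae_restrict_mem measurableSet_Ioi] with r hr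
    have hr' : (0 : ℝ) < r := hr
    have h2 : ∀ z : ℝ, ‖(Ioi |z|).indicator h r‖ = (Ioo (-r) r).indicator (fun _ => ‖h r‖) z :=
      fun z => by
        rw [congrFun (hslice r) z, norm_indicator_eq_indicator_norm]
    simp_rw [h2]
    rw [integral_indicator measurableSet_Ioo, setIntegral_const, Measure.real, Real.volume_Ioo,
      ENNReal.toReal_ofReal (by linarith), norm_mul, Complex.norm_real, Real.norm_eq_abs,
      abs_of_pos hr', smul_eq_mul]
    ring

/-- The Fourier transform of a radial function on `ℝ³` is a sine transform. -/
theorem fourier_radial {h : ℝ → ℂ} (hm : Measurable h)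
    (hint : IntegrableOn (fun r : ℝ => (r : ℂ) * h r) (Ioi 0)) {ξ : E3} (hξ : ξ ≠ 0) :
    𝓕 (fun x : E3 => h ‖x‖ / (‖x‖ : ℂ)) ξ =
      2 / ‖ξ‖ * ∫ r in Ioi (0 : ℝ), h r * Real.sin (2 * Real.pi * ‖ξ‖ * r) := by
  have hξ' : 0 < ‖ξ‖ := norm_pos_iff.2 hξ
  set a : ℝ := 2 * Real.pi * ‖ξ‖ with ha
  have ha0 : a ≠ 0 := by positivity
  set e : ℝ → ℂ := fun z => Complex.exp (-(a * z : ℝ) * Complex.I) with he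
  have he1 : ∀ z, ‖e z‖ = 1 := fun z => by
    rw [he]; simp only [← Complex.ofReal_neg]; exact Complex.norm_exp_ofReal_mul_I _
  have hec : Continuous e := by rw [he]; fun_prop
  have hchar : ∀ x : E3, character x (EuclideanSpace.single 0 ‖ξ‖) = e (x 0) := fun x => by
    rw [character, Real.fourierChar_apply]
    simp only [he, ha]
    congr 1
    simp only [EuclideanSpace.inner_single_right]
    push_cast
    simp
    ring
  let G : ℝ × ℂ → ℂ := fun p => e p.1 *
    (h √(p.1 ^ 2 + ‖p.2‖ ^ 2) / (√(p.1 ^ 2 + ‖p.2‖ ^ 2) : ℂ))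
  have hG : ∀ x : E3, character x (EuclideanSpace.single 0 ‖ξ‖) * (h ‖x‖ / (‖x‖ : ℂ)) =
      G (splitEquiv x) := fun x => by
    simp only [G]
    rw [hchar, ← norm_eq_splitEquiv, splitEquiv_fst]
  have hGint : Integrable G (volume.prod volume) := by
    have h1 : Integrable (fun x : E3 => G (splitEquiv x)) := by
      simp_rw [← hG]
      refine (integrable_radial hint).bdd_mul (c := 1) ?_ (ae_of_all _ fun x =>
        (norm_character _ _).le)
      exact (continuous_character.comp (by fun_prop : Continuous fun x : E3 =>
        (x, (EuclideanSpace.single 0 ‖ξ‖ : E3)))).aestronglyMeasurable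
    exact (measurePreserving_splitEquiv.integrable_comp_emb
      splitEquiv.measurableEmbedding).1 h1
  rw [fourier_norm_comp_eq (fun r : ℝ => h r / (r : ℂ)) ξ, fourier_eq_integral_character]
  simp_rw [hG]
  rw [measurePreserving_splitEquiv.integral_comp splitEquiv.measurableEmbedding G,
    Measure.volume_eq_prod, integral_prod _ hGint]
  have hstep : ∀ᵐ z : ℝ, ∫ p : ℂ, G (z, p) =
      2 * Real.pi * ∫ r in Ioi (0 : ℝ), e z * (Ioi |z|).indicator h r := by
    -- The plane z = 0, excluded by the substitution, is null.
    filter_upwards [compl_mem_ae_iff.2 (measure_singleton (0 : ℝ))] with z hz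
    simp only [G]
    rw [integral_const_mul, integral_radial_plane h hz, integral_const_mul,
      setIntegral_indicator measurableSet_Ioi, Ioi_inter_Ioi, sup_eq_right.2 (abs_nonneg z)]
    ring
  rw [integral_congr_ae hstep, integral_const_mul, integral_integral_swap]
  · have hin : ∀ r ∈ Ioi (0 : ℝ), ∫ z : ℝ, e z * (Ioi |z|).indicator h r =
        2 / a * (h r * Real.sin (a * r)) := fun r hr => by
      have hr' : (0 : ℝ) < r := hr
      have h2 : ∀ z : ℝ, e z * (Ioi |z|).indicator h r =
          (Ioo (-r) r).indicator (fun z => e z * h r) z := fun z => by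
        simp only [indicator, mem_Ioi, mem_Ioo, abs_lt]; split_ifs <;> simp
      simp_rw [h2]
      rw [integral_indicator measurableSet_Ioo, integral_mul_const, ← integral_Ioc_eq_integral_Ioo,
        ← intervalIntegral.integral_of_le (by linarith), integral_exp_symm ha0]
      ring
    rw [setIntegral_congr_fun measurableSet_Ioi hin, integral_const_mul, ← mul_assoc]
    congr 1
    have h3 : (‖ξ‖ : ℂ) ≠ 0 := by exact_mod_cast hξ'.ne'
    have h4 : (Real.pi : ℂ) ≠ 0 := by exact_mod_cast Real.pi_ne_zero
    rw [ha]; push_cast; field_simp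
  · refine (integrable_strip hm hint).bdd_mul (c := 1) ?_ (ae_of_all _ fun p => (he1 p.1).le)
    exact (hec.comp continuous_fst).aestronglyMeasurable

/-! ### Bump functions, sine transforms and integration by parts -/

/-- A smooth function on `ℝ` equal to `1` up to `a` and to `0` from `b` on. -/
def bump (a b r : ℝ) : ℝ := Real.smoothTransition ((b - r) / (b - a))

lemma contDiff_bump (a b : ℝ) {n : ℕ∞} : ContDiff ℝ n (bump a b) :=
  Real.smoothTransition.contDiff.comp (by fun_prop)

lemma bump_eq_one {a b r : ℝ} (hab : a < b) (hr : r ≤ a) : bump a b r = 1 :=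
  Real.smoothTransition.one_of_one_le ((one_le_div (by linarith)).2 (by linarith))

lemma bump_eq_zero {a b r : ℝ} (hab : a < b) (hr : b ≤ r) : bump a b r = 0 :=
  Real.smoothTransition.zero_of_nonpos (div_nonpos_of_nonpos_of_nonneg (by linarith) (by linarith))

lemma abs_bump_le (a b r : ℝ) : |bump a b r| ≤ 1 := by
  rw [bump, abs_of_nonneg (Real.smoothTransition.nonneg _)]
  exact Real.smoothTransition.le_one _

lemma integrableOn_mul_of_bounded {h : ℝ → ℂ} (hm : Measurable h) {b D : ℝ}
    (hD : ∀ r, 0 < r → ‖h r‖ ≤ D) (hb : ∀ r, b ≤ r → h r = 0) :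
    IntegrableOn (fun r : ℝ => (r : ℂ) * h r) (Ioi 0) := by
  have h1 : IntegrableOn (fun r : ℝ => (r : ℂ) * h r) (Ioc 0 b) := by
    refine Measure.integrableOn_of_bounded (M := |b| * D) (by simp)
      (Complex.measurable_ofReal.mul hm).aestronglyMeasurable ?_
    filter_upwards [ae_restrict_mem measurableSet_Ioc] with r hr
    rw [norm_mul, Complex.norm_real, Real.norm_eq_abs, abs_of_pos hr.1]
    exact mul_le_mul (hr.2.trans (le_abs_self b)) (hD r hr.1) (norm_nonneg _) (abs_nonneg _)
  refine h1.of_forall_sdiff_eq_zero measurableSet_Ioi fun r hr => ?_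
  rw [hb r (not_lt.1 fun h => hr.2 ⟨hr.1, h.le⟩), mul_zero]

lemma setIntegral_Ioi_eq_intervalIntegral {h g : ℝ → ℂ} {b : ℝ} (hb0 : 0 ≤ b)
    (hb : ∀ r, b ≤ r → h r = 0) :
    ∫ r in Ioi (0 : ℝ), h r * g r = ∫ r in (0 : ℝ)..b, h r * g r := by
  rw [intervalIntegral.integral_of_le hb0]
  refine (setIntegral_eq_of_subset_of_forall_sdiff_eq_zero measurableSet_Ioi
    Ioc_subset_Ioi_self fun r hr => ?_)
  rw [hb r (not_lt.1 fun h => hr.2 ⟨hr.1, h.le⟩), zero_mul]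

/-- The bound |sin t| ≤ |t| produces a factor ‖ξ‖ which cancels the prefactor 2/‖ξ‖, so the estimate
is uniform down to ξ = 0. -/
lemma norm_sineTransform_le {h : ℝ → ℂ} {b D : ℝ} (hb0 : 0 ≤ b)
    (hD : ∀ r, 0 < r → ‖h r‖ ≤ D) (hb : ∀ r, b ≤ r → h r = 0) {ξ : E3} (hξ : ξ ≠ 0) :
    ‖2 / (‖ξ‖ : ℂ) * ∫ r in Ioi (0 : ℝ), h r * Real.sin (2 * Real.pi * ‖ξ‖ * r)‖ ≤
      4 * Real.pi * b ^ 2 * D := by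
  have hξ' : 0 < ‖ξ‖ := norm_pos_iff.2 hξ
  have hD0 : 0 ≤ D := (norm_nonneg _).trans (hD 1 one_pos)
  rw [setIntegral_Ioi_eq_intervalIntegral hb0 hb, norm_mul]
  have h1 : ‖∫ r in (0 : ℝ)..b, h r * Real.sin (2 * Real.pi * ‖ξ‖ * r)‖ ≤
      (D * (2 * Real.pi * ‖ξ‖ * b)) * |b - 0| := by
    refine intervalIntegral.norm_integral_le_of_norm_le_const fun r hr => ?_
    rw [uIoc_of_le hb0] at hr
    rw [norm_mul, Complex.norm_real, Real.norm_eq_abs]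
    have hr0 := hr.1
    have hsin : |Real.sin (2 * Real.pi * ‖ξ‖ * r)| ≤ 2 * Real.pi * ‖ξ‖ * b := by
      refine Real.abs_sin_le_abs.trans ?_
      rw [abs_of_nonneg (by positivity)]
      gcongr
      exact hr.2
    exact mul_le_mul (hD r hr.1) hsin (abs_nonneg _) hD0
  rw [sub_zero, abs_of_nonneg hb0] at h1
  have h2 : ‖(2 / (‖ξ‖ : ℂ))‖ = 2 / ‖ξ‖ := by simp
  rw [h2]
  calc 2 / ‖ξ‖ * _ ≤ 2 / ‖ξ‖ * ((D * (2 * Real.pi * ‖ξ‖ * b)) * b) := by gcongr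
    _ = 4 * Real.pi * b ^ 2 * D := by field_simp; ring

/-- Integrating by parts twice against a sine. -/
lemma integral_deriv2_mul_sin {g g' g'' : ℝ → ℂ} (h1 : ∀ r, HasDerivAt g (g' r) r)
    (h2 : ∀ r, HasDerivAt g' (g'' r) r) (hc : Continuous g'') {B : ℝ} (hB : g B = 0)
    (hB' : g' B = 0) (a : ℝ) :
    ∫ r in (0 : ℝ)..B, g'' r * Real.sin (a * r) =
      a * g 0 - a ^ 2 * ∫ r in (0 : ℝ)..B, g r * Real.sin (a * r) := by
  have hgc : Continuous g := continuous_iff_continuousAt.2 fun r => (h1 r).continuousAt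
  have hs : ∀ r : ℝ, HasDerivAt (fun r : ℝ => (Real.sin (a * r) : ℂ)) (a * Real.cos (a * r)) r :=
    fun r => by
      have := ((Real.hasDerivAt_sin (a * r)).comp r ((hasDerivAt_id r).const_mul a)).ofReal_comp
      refine this.congr_deriv ?_
      push_cast; ring
  have hcs : ∀ r : ℝ,
      HasDerivAt (fun r : ℝ => (Real.cos (a * r) : ℂ)) (-(a * Real.sin (a * r))) r :=
    fun r => by
      have := ((Real.hasDerivAt_cos (a * r)).comp r ((hasDerivAt_id r).const_mul a)).ofReal_comp
      refine this.congr_deriv ?_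
      push_cast; ring
  -- A single primitive encodes both integrations by parts; only its term with g(0) survives at the
  -- endpoints.
  have hF : ∀ r : ℝ, HasDerivAt
      (fun r : ℝ => g' r * Real.sin (a * r) - a * (g r * Real.cos (a * r)))
      (g'' r * Real.sin (a * r) + a ^ 2 * (g r * Real.sin (a * r))) r := fun r => by
    refine (((h2 r).mul (hs r)).sub (((h1 r).mul (hcs r)).const_mul (a : ℂ))).congr_deriv ?_
    ring
  have c1 : Continuous fun r : ℝ => g'' r * (Real.sin (a * r) : ℂ) := by fun_prop
  have c2 : Continuous fun r : ℝ => (a : ℂ) ^ 2 * (g r * (Real.sin (a * r) : ℂ)) := by fun_prop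
  have h3 := intervalIntegral.integral_eq_sub_of_hasDerivAt (a := 0) (b := B) (fun r _ => hF r)
    ((c1.add c2).intervalIntegrable _ _)
  rw [intervalIntegral.integral_add (c1.intervalIntegrable _ _) (c2.intervalIntegrable _ _),
    intervalIntegral.integral_const_mul, hB, hB'] at h3
  simp only [mul_zero, Real.sin_zero, Real.cos_zero, Complex.ofReal_zero, Complex.ofReal_one] at h3
  linear_combination h3

/-- The `j`-th derivative of `r ↦ e^{iλr} - e^{-λr}`. -/
def waveDeriv (lam : ℂ) (j : ℕ) (r : ℝ) : ℂ :=
  (Complex.I * lam) ^ j * Complex.exp (Complex.I * lam * r) -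
    (-lam) ^ j * Complex.exp (-lam * r)

lemma hasDerivAt_waveDeriv (lam : ℂ) (j : ℕ) (r : ℝ) :
    HasDerivAt (waveDeriv lam j) (waveDeriv lam (j + 1) r) r := by
  have h : ∀ c : ℂ, HasDerivAt (fun r : ℝ => c ^ j * Complex.exp (c * r))
      (c ^ (j + 1) * Complex.exp (c * r)) r := fun c => by
    have h1 : HasDerivAt (fun r : ℝ => c * (r : ℂ)) c r := by
      simpa using (Complex.ofRealCLM.hasDerivAt (x := r)).const_mul c
    refine ((h1.cexp).const_mul (c ^ j)).congr_deriv ?_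
    ring
  exact (h _).sub (h _)

lemma continuous_waveDeriv (lam : ℂ) (j : ℕ) : Continuous (waveDeriv lam j) :=
  continuous_iff_continuousAt.2 fun r => (hasDerivAt_waveDeriv lam j r).continuousAt

/-- The exponential weight `e^{b (Re λ)_-} + e^{b (Im λ)_-}`. -/
def expWeight (b : ℝ) (lam : ℂ) : ℝ :=
  Real.exp (b * max (-lam.re) 0) + Real.exp (b * max (-lam.im) 0)

lemma one_le_expWeight {b : ℝ} (hb : 0 ≤ b) (lam : ℂ) : 1 ≤ expWeight b lam := by
  have h1 : 1 ≤ Real.exp (b * max (-lam.re) 0) := Real.one_le_exp (by positivity)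
  have h2 := Real.exp_pos (b * max (-lam.im) 0)
  unfold expWeight; linarith

/-- The two exponentials have moduli e^{-r Im λ} and e^{-r Re λ}; on [0, b] they grow only through
the negative parts of Im λ and Re λ. -/
lemma norm_waveDeriv_le (lam : ℂ) (j : ℕ) {b r : ℝ} (hr0 : 0 ≤ r) (hrb : r ≤ b) :
    ‖waveDeriv lam j r‖ ≤ ‖lam‖ ^ j * expWeight b lam := by
  have hexp : ∀ t : ℝ, Real.exp (-t * r) ≤ Real.exp (b * max (-t) 0) := fun t => by
    refine Real.exp_le_exp.2 ?_
    calc -t * r ≤ max (-t) 0 * r := by gcongr; exact le_max_left _ _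
      _ ≤ max (-t) 0 * b := by gcongr
      _ = _ := mul_comm _ _
  have h1 : ‖Complex.exp (Complex.I * lam * r)‖ = Real.exp (-lam.im * r) := by
    rw [Complex.norm_exp]; congr 1; simp
  have h2 : ‖Complex.exp (-lam * r)‖ = Real.exp (-lam.re * r) := by
    rw [Complex.norm_exp]; congr 1; simp
  refine (norm_sub_le _ _).trans ?_
  rw [norm_mul, norm_mul, norm_pow, norm_pow, norm_neg, norm_mul, Complex.norm_I, one_mul, h1, h2,
    expWeight]
  have := pow_nonneg (norm_nonneg lam) j
  nlinarith [mul_le_mul_of_nonneg_left (hexp lam.re) this,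
    mul_le_mul_of_nonneg_left (hexp lam.im) this]

/-- The `j`-th derivative of the bump function. -/
def bumpDeriv (a b : ℝ) (j : ℕ) (r : ℝ) : ℂ := (iteratedDeriv j (bump a b) r : ℝ)

lemma hasDerivAt_bumpDeriv (a b : ℝ) (j : ℕ) (r : ℝ) :
    HasDerivAt (bumpDeriv a b j) (bumpDeriv a b (j + 1) r) r := by
  have h : Differentiable ℝ (iteratedDeriv j (bump a b)) :=
    (contDiff_bump a b (n := ⊤)).differentiable_iteratedDeriv j
      (by exact_mod_cast ENat.natCast_lt_top j)
  have := (h r).hasDerivAt.ofReal_comp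
  rwa [← iteratedDeriv_succ] at this

lemma continuous_bumpDeriv (a b : ℝ) (j : ℕ) : Continuous (bumpDeriv a b j) :=
  continuous_iff_continuousAt.2 fun r => (hasDerivAt_bumpDeriv a b j r).continuousAt

/-- The strict inequality makes the bump vanish in a neighbourhood of r. For this reason the
integrals below run up to b + 1 instead of b. -/
lemma bumpDeriv_eq_zero_of_gt {a b r : ℝ} (hab : a < b) (hr : b < r) (j : ℕ) :
    bumpDeriv a b j r = 0 := by
  have h : bump a b =ᶠ[𝓝 r] fun _ => 0 := by
    filter_upwards [lt_mem_nhds hr] with x hx using bump_eq_zero hab hx.le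
  rw [bumpDeriv, h.iteratedDeriv_eq]
  simp

lemma bumpDeriv_eq_of_lt {a b r : ℝ} (hab : a < b) (hr : r < a) (j : ℕ) :
    bumpDeriv a b j r = if j = 0 then 1 else 0 := by
  have h : bump a b =ᶠ[𝓝 r] fun _ => 1 := by
    filter_upwards [gt_mem_nhds hr] with x hx using bump_eq_one hab hx.le
  rw [bumpDeriv, h.iteratedDeriv_eq, iteratedDeriv_const]
  split_ifs <;> simp

lemma exists_bumpDeriv_bound (a b : ℝ) :
    ∃ D : ℝ, 0 < D ∧ ∀ j ≤ 4, ∀ r, 0 ≤ r → r ≤ b → ‖bumpDeriv a b j r‖ ≤ D := by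
  choose D hD using fun j => (isCompact_Icc (a := (0 : ℝ)) (b := b)).exists_bound_of_continuousOn
    (continuous_bumpDeriv a b j).continuousOn
  refine ⟨1 + ∑ j ∈ Finset.range 5, |D j|, by positivity, fun j hj r h0 hb => ?_⟩
  refine (hD j r ⟨h0, hb⟩).trans ((le_abs_self _).trans ?_)
  have := Finset.single_le_sum (f := fun j => |D j|) (fun i _ => abs_nonneg _)
    (Finset.mem_range.2 (by omega : j < 5))
  linarith

/-- The fourth derivative of `r ↦ ψ(r) (e^{iλr} - e^{-λr})` for a bump function `ψ`. -/
def cutWaveDeriv4 (a b : ℝ) (lam : ℂ) (r : ℝ) : ℂ :=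
  bumpDeriv a b 4 r * waveDeriv lam 0 r + 4 * (bumpDeriv a b 3 r * waveDeriv lam 1 r) +
    6 * (bumpDeriv a b 2 r * waveDeriv lam 2 r) + 4 * (bumpDeriv a b 1 r * waveDeriv lam 3 r) +
    bumpDeriv a b 0 r * waveDeriv lam 4 r

/-- Integrating by parts twice, two times over. Nothing survives at b + 1. Near 0 the bump is 1
because a > 0, so the profile vanishes there by cancellation of the exponentials, while its second
derivative is (iλ)² - λ² = -2λ². -/
lemma integral_cutWaveDeriv4_mul_sin {a b : ℝ} (ha : 0 < a) (hab : a < b) (lam : ℂ) (α : ℝ) :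
    ∫ r in (0 : ℝ)..(b + 1), cutWaveDeriv4 a b lam r * Real.sin (α * r) =
      -2 * lam ^ 2 * α + α ^ 4 * ∫ r in (0 : ℝ)..(b + 1),
        bumpDeriv a b 0 r * waveDeriv lam 0 r * Real.sin (α * r) := by
  have H : ∀ i j r, HasDerivAt (fun r => bumpDeriv a b i r * waveDeriv lam j r)
      (bumpDeriv a b (i + 1) r * waveDeriv lam j r + bumpDeriv a b i r * waveDeriv lam (j + 1) r)
      r := fun i j r => (hasDerivAt_bumpDeriv a b i r).mul (hasDerivAt_waveDeriv lam j r)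
  have hC : ∀ i j, Continuous fun r => bumpDeriv a b i r * waveDeriv lam j r := fun i j =>
    (continuous_bumpDeriv a b i).mul (continuous_waveDeriv lam j)
  have hB : ∀ i, bumpDeriv a b i (b + 1) = 0 := bumpDeriv_eq_zero_of_gt hab (by linarith)
  have e1 := integral_deriv2_mul_sin (B := b + 1) (a := α)
    (g := fun r => bumpDeriv a b 0 r * waveDeriv lam 0 r)
    (g' := fun r => bumpDeriv a b 1 r * waveDeriv lam 0 r + bumpDeriv a b 0 r * waveDeriv lam 1 r)
    (g'' := fun r => bumpDeriv a b 2 r * waveDeriv lam 0 r +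
      2 * (bumpDeriv a b 1 r * waveDeriv lam 1 r) + bumpDeriv a b 0 r * waveDeriv lam 2 r)
    (H 0 0) (fun r => ((H 1 0 r).add (H 0 1 r)).congr_deriv (by ring))
    (((hC 2 0).add ((hC 1 1).const_mul 2)).add (hC 0 2)) (by simp [hB]) (by simp [hB])
  have e2 := integral_deriv2_mul_sin (B := b + 1) (a := α)
    (g := fun r => bumpDeriv a b 2 r * waveDeriv lam 0 r +
      2 * (bumpDeriv a b 1 r * waveDeriv lam 1 r) + bumpDeriv a b 0 r * waveDeriv lam 2 r)
    (g' := fun r => bumpDeriv a b 3 r * waveDeriv lam 0 r +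
      3 * (bumpDeriv a b 2 r * waveDeriv lam 1 r) + 3 * (bumpDeriv a b 1 r * waveDeriv lam 2 r) +
      bumpDeriv a b 0 r * waveDeriv lam 3 r)
    (g'' := cutWaveDeriv4 a b lam)
    (fun r => (((H 2 0 r).add ((H 1 1 r).const_mul 2)).add (H 0 2 r)).congr_deriv (by ring))
    (fun r => ((((H 3 0 r).add ((H 2 1 r).const_mul 3)).add ((H 1 2 r).const_mul 3)).add
      (H 0 3 r)).congr_deriv (by rw [cutWaveDeriv4]; ring))
    (((((hC 4 0).add ((hC 3 1).const_mul 4)).add ((hC 2 2).const_mul 6)).add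
      ((hC 1 3).const_mul 4)).add (hC 0 4)) (by simp [hB]) (by simp [hB])
  have h0 : ∀ i, bumpDeriv a b i 0 = if i = 0 then 1 else 0 := bumpDeriv_eq_of_lt hab ha
  rw [e2, e1]
  simp only [h0]
  simp [waveDeriv]
  linear_combination lam ^ 2 * α * Complex.I_sq

/-- The binomial coefficients add up to 16, and |λ| ≥ 1 replaces every lower power of |λ| by the
fourth. -/
lemma norm_cutWaveDeriv4_le {a b D : ℝ} (hab : a < b) (hD0 : 0 ≤ D)
    (hD : ∀ j ≤ 4, ∀ r, 0 ≤ r → r ≤ b → ‖bumpDeriv a b j r‖ ≤ D) {lam : ℂ} (hlam : 1 ≤ ‖lam‖)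
    {r : ℝ} (hr : 0 < r) :
    ‖cutWaveDeriv4 a b lam r‖ ≤ 16 * D * (‖lam‖ ^ 4 * expWeight b lam) := by
  by_cases hrb : r ≤ b
  · have hE : 0 ≤ expWeight b lam := by unfold expWeight; positivity
    have key : ∀ i ≤ 4, ∀ j ≤ 4, ‖bumpDeriv a b i r * waveDeriv lam j r‖ ≤
        D * (‖lam‖ ^ 4 * expWeight b lam) := fun i hi j hj => by
      rw [norm_mul]
      refine mul_le_mul (hD i hi r hr.le hrb) ((norm_waveDeriv_le lam j hr.le hrb).trans ?_)
        (norm_nonneg _) hD0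
      exact mul_le_mul_of_nonneg_right (pow_le_pow_right₀ hlam hj) hE
    rw [cutWaveDeriv4]
    refine (norm_add_le_of_le (norm_add_le_of_le (norm_add_le_of_le (norm_add_le_of_le
      (key 4 le_rfl 0 (by omega)) ?_) ?_) ?_) (key 0 (by omega) 4 le_rfl)).trans_eq
      (b := D * (‖lam‖ ^ 4 * expWeight b lam) + 4 * (D * (‖lam‖ ^ 4 * expWeight b lam)) +
        6 * (D * (‖lam‖ ^ 4 * expWeight b lam)) + 4 * (D * (‖lam‖ ^ 4 * expWeight b lam)) +
        D * (‖lam‖ ^ 4 * expWeight b lam)) (by ring)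
    all_goals
      rw [norm_mul]
      simp only [Complex.norm_ofNat]
      refine mul_le_mul_of_nonneg_left ?_ (by norm_num)
      apply key <;> omega
  · have h0 : ∀ i, bumpDeriv a b i r = 0 := bumpDeriv_eq_zero_of_gt hab (not_le.1 hrb)
    have hE : 0 ≤ expWeight b lam := by unfold expWeight; positivity
    simp only [cutWaveDeriv4, h0, zero_mul, mul_zero, add_zero, norm_zero]
    positivity

/-! ### The cut kernel and the bounds on its symbol -/

/-- The constant `1 / (8πλ²)`. -/
def kernelCoeff (lam : ℂ) : ℂ := 1 / (8 * Real.pi * lam ^ 2)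

lemma norm_kernelCoeff (lam : ℂ) : ‖kernelCoeff lam‖ = 1 / (8 * Real.pi * ‖lam‖ ^ 2) := by
  simp [kernelCoeff, abs_of_pos Real.pi_pos]

/-- The function `r ↦ ψ(r) (e^{iλr} - e^{-λr}) / (8πλ²)`, with a bump function `ψ`. -/
def cutProfile (a b : ℝ) (lam : ℂ) (r : ℝ) : ℂ :=
  kernelCoeff lam * (bumpDeriv a b 0 r * waveDeriv lam 0 r)

/-- The convolution kernel `ψ(|x|) (e^{iλ|x|} - e^{-λ|x|}) / (8πλ²|x|)`. -/
def cutKernel (a b : ℝ) (lam : ℂ) (x : E3) : ℂ := cutProfile a b lam ‖x‖ / (‖x‖ : ℂ)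

/-- The Fourier transform of `cutKernel`. -/
def cutSymbol (a b : ℝ) (lam : ℂ) : E3 → ℂ := 𝓕 (cutKernel a b lam)

/-- The convolution operator with kernel `cutKernel`. -/
def cutOp (a b : ℝ) (lam : ℂ) : L2 →L[ℂ] L2 := fourierMul (cutSymbol a b lam)

lemma continuous_cutProfile (a b : ℝ) (lam : ℂ) : Continuous (cutProfile a b lam) :=
  ((continuous_bumpDeriv a b 0).mul (continuous_waveDeriv lam 0)).const_mul _

lemma cutProfile_eq_zero {a b : ℝ} (hab : a < b) (lam : ℂ) {r : ℝ} (hr : b + 1 ≤ r) :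
    cutProfile a b lam r = 0 := by
  rw [cutProfile, bumpDeriv_eq_zero_of_gt hab (by linarith), zero_mul, mul_zero]

lemma norm_bumpDeriv_zero_le (a b r : ℝ) : ‖bumpDeriv a b 0 r‖ ≤ 1 := by
  rw [bumpDeriv, iteratedDeriv_zero, Complex.norm_real]; exact abs_bump_le a b r

lemma norm_cutProfile_le {a b : ℝ} (hab : a < b) (lam : ℂ) {r : ℝ} (hr : 0 < r) :
    ‖cutProfile a b lam r‖ ≤ 1 / (8 * Real.pi * ‖lam‖ ^ 2) * expWeight b lam := by
  have hE : 0 ≤ expWeight b lam := by unfold expWeight; positivity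
  by_cases hrb : r ≤ b
  · rw [cutProfile, norm_mul, norm_kernelCoeff, norm_mul]
    refine mul_le_mul_of_nonneg_left ?_ (by positivity)
    refine (mul_le_mul (norm_bumpDeriv_zero_le a b r) (norm_waveDeriv_le lam 0 hr.le hrb)
      (norm_nonneg _) zero_le_one).trans_eq ?_
    rw [pow_zero, one_mul, one_mul]
  · rw [cutProfile, bumpDeriv_eq_zero_of_gt hab (not_le.1 hrb), zero_mul, mul_zero, norm_zero]
    positivity

lemma integrableOn_cutProfile {a b : ℝ} (hab : a < b) (lam : ℂ) :
    IntegrableOn (fun r : ℝ => (r : ℂ) * cutProfile a b lam r) (Ioi 0) :=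
  integrableOn_mul_of_bounded (continuous_cutProfile a b lam).measurable
    (fun _ hr => norm_cutProfile_le hab lam hr) (fun _ hr => cutProfile_eq_zero hab lam hr)

lemma integrable_cutKernel {a b : ℝ} (hab : a < b) (lam : ℂ) : Integrable (cutKernel a b lam) :=
  integrable_radial (integrableOn_cutProfile hab lam)

lemma cutSymbol_eq {a b : ℝ} (hab : a < b) (lam : ℂ) {ξ : E3} (hξ : ξ ≠ 0) :
    cutSymbol a b lam ξ = 2 / ‖ξ‖ *
      ∫ r in Ioi (0 : ℝ), cutProfile a b lam r * Real.sin (2 * Real.pi * ‖ξ‖ * r) :=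
  fourier_radial (continuous_cutProfile a b lam).measurable (integrableOn_cutProfile hab lam) hξ

lemma norm_cutSymbol_le {a b : ℝ} (ha : 0 < a) (hab : a < b) (lam : ℂ) {ξ : E3} (hξ : ξ ≠ 0) :
    ‖cutSymbol a b lam ξ‖ ≤ (b + 1) ^ 2 * (1 / ‖lam‖ ^ 2 * expWeight b lam) := by
  have hE : 0 ≤ expWeight b lam := by unfold expWeight; positivity
  rw [cutSymbol_eq hab lam hξ]
  refine (norm_sineTransform_le (b := b + 1) (by linarith)
    (fun r hr => norm_cutProfile_le hab lam hr) (fun r hr => cutProfile_eq_zero hab lam hr)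
    hξ).trans ?_
  calc 4 * Real.pi * (b + 1) ^ 2 * (1 / (8 * Real.pi * ‖lam‖ ^ 2) * expWeight b lam)
      = 1 / 2 * ((b + 1) ^ 2 * (1 / ‖lam‖ ^ 2 * expWeight b lam)) := by
        have := Real.pi_pos
        by_cases h : ‖lam‖ = 0
        · simp [h]
        · field_simp; ring
    _ ≤ _ := by
        have : 0 ≤ (b + 1) ^ 2 * (1 / ‖lam‖ ^ 2 * expWeight b lam) := by positivity
        linarith

/-- The boundary term -2λ²α, with α = 2π‖ξ‖, is normalized to the summand 1 by the coefficient
1/(8πλ²). In physical space, Δ² of the cut kernel is a Dirac mass plus a remainder given by the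
fourth derivative of the profile. -/
lemma pow_four_mul_cutSymbol {a b : ℝ} (ha : 0 < a) (hab : a < b) {lam : ℂ} (hlam : lam ≠ 0)
    {ξ : E3} (hξ : ξ ≠ 0) :
    ((2 * Real.pi * ‖ξ‖ : ℝ) : ℂ) ^ 4 * cutSymbol a b lam ξ = 1 + kernelCoeff lam *
      (2 / ‖ξ‖ * ∫ r in Ioi (0 : ℝ), cutWaveDeriv4 a b lam r *
        Real.sin (2 * Real.pi * ‖ξ‖ * r)) := by
  have hb : 0 ≤ b + 1 := by linarith
  have h4 : ∀ r, b + 1 ≤ r → cutWaveDeriv4 a b lam r = 0 := fun r hr => by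
    simp [cutWaveDeriv4, bumpDeriv_eq_zero_of_gt hab (by linarith : b < r)]
  rw [cutSymbol_eq hab lam hξ,
    setIntegral_Ioi_eq_intervalIntegral hb (fun r hr => cutProfile_eq_zero hab lam hr),
    setIntegral_Ioi_eq_intervalIntegral hb h4, integral_cutWaveDeriv4_mul_sin ha hab]
  simp only [cutProfile, mul_assoc (kernelCoeff lam), intervalIntegral.integral_const_mul]
  have h1 : (‖ξ‖ : ℂ) ≠ 0 := by exact_mod_cast norm_ne_zero_iff.2 hξ
  have h2 : (Real.pi : ℂ) ≠ 0 := by exact_mod_cast Real.pi_ne_zero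
  rw [kernelCoeff]
  push_cast
  field_simp
  ring

/-- The case m = 0 is the direct bound and m = 4 comes from the integrations by parts; the orders
between are interpolated. The constant depends on the bump only, not on λ. -/
lemma exists_pow_mul_cutSymbol_le {a b : ℝ} (ha : 0 < a) (hab : a < b) :
    ∃ C : ℝ, 0 < C ∧ ∀ lam : ℂ, 1 ≤ ‖lam‖ → ∀ ξ : E3, ξ ≠ 0 → ∀ m ≤ 4,
      (2 * Real.pi * ‖ξ‖) ^ m * ‖cutSymbol a b lam ξ‖ ≤
        ‖lam‖ ^ m * (C * (1 / ‖lam‖ ^ 2 * expWeight b lam)) := by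
  obtain ⟨D, hD0, hD⟩ := exists_bumpDeriv_bound a b
  refine ⟨(b + 1) ^ 2 + (1 + 8 * D * (b + 1) ^ 2), by positivity, fun lam hlam ξ hξ m hm => ?_⟩
  have hlam0 : 0 < ‖lam‖ := by linarith
  have hE := one_le_expWeight (by linarith : 0 ≤ b) lam
  set E := expWeight b lam
  set α := 2 * Real.pi * ‖ξ‖ with hα
  have hα0 : 0 ≤ α := by positivity
  have h0 := norm_cutSymbol_le ha hab lam hξ
  have h4 : α ^ 4 * ‖cutSymbol a b lam ξ‖ ≤
      ‖lam‖ ^ 4 * ((1 + 8 * D * (b + 1) ^ 2) * (1 / ‖lam‖ ^ 2 * E)) := by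
    have e1 := pow_four_mul_cutSymbol ha hab (norm_pos_iff.1 hlam0) hξ
    have e2 := norm_sineTransform_le (b := b + 1) (by linarith)
      (fun r hr => norm_cutWaveDeriv4_le hab hD0.le hD hlam hr)
      (fun r hr => by
        simp [cutWaveDeriv4, bumpDeriv_eq_zero_of_gt hab (by linarith : b < r)]) hξ
    have e3 : α ^ 4 * ‖cutSymbol a b lam ξ‖ = ‖(α : ℂ) ^ 4 * cutSymbol a b lam ξ‖ := by
      rw [norm_mul, norm_pow, Complex.norm_real, Real.norm_eq_abs, abs_of_nonneg hα0]
    rw [e3, e1]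
    refine (norm_add_le _ _).trans ?_
    rw [norm_one, norm_mul, norm_kernelCoeff]
    refine (add_le_add le_rfl (mul_le_mul_of_nonneg_left e2 (by positivity))).trans ?_
    have e4 : 1 / (8 * Real.pi * ‖lam‖ ^ 2) * (4 * Real.pi * (b + 1) ^ 2 *
        (16 * D * (‖lam‖ ^ 4 * E))) =
        ‖lam‖ ^ 4 * ((8 * D * (b + 1) ^ 2) * (1 / ‖lam‖ ^ 2 * E)) := by
      have := Real.pi_pos
      field_simp; ring
    -- The Dirac contribution 1 is absorbed because |λ|² E ≥ 1.
    have e5 : 1 ≤ ‖lam‖ ^ 4 * (1 * (1 / ‖lam‖ ^ 2 * E)) := by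
      have : ‖lam‖ ^ 4 * (1 * (1 / ‖lam‖ ^ 2 * E)) = ‖lam‖ ^ 2 * E := by field_simp
      rw [this]
      exact one_le_mul_of_one_le_of_one_le (one_le_pow₀ hlam) hE
    change 1 + 1 / (8 * Real.pi * ‖lam‖ ^ 2) * (4 * Real.pi * (b + 1) ^ 2 *
        (16 * D * (‖lam‖ ^ 4 * E))) ≤ _
    rw [e4]
    refine (add_le_add e5 le_rfl).trans_eq (by ring)
  -- Interpolation: t^m ≤ 1 + t⁴ for t = α/|λ| and m ≤ 4.
  have hq : α ^ m ≤ ‖lam‖ ^ m * (1 + α ^ 4 / ‖lam‖ ^ 4) := by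
    have h : (α / ‖lam‖) ^ m ≤ 1 + (α / ‖lam‖) ^ 4 := by
      have hx : 0 ≤ α / ‖lam‖ := by positivity
      rcases le_total (α / ‖lam‖) 1 with h1 | h1
      · linarith [pow_le_one₀ (n := m) hx h1, pow_nonneg hx 4]
      · linarith [pow_le_pow_right₀ h1 hm]
    rw [div_pow, div_pow, div_le_iff₀ (by positivity)] at h
    linarith
  calc α ^ m * ‖cutSymbol a b lam ξ‖
      ≤ ‖lam‖ ^ m * (1 + α ^ 4 / ‖lam‖ ^ 4) * ‖cutSymbol a b lam ξ‖ := by gcongr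
    _ = ‖lam‖ ^ m * (‖cutSymbol a b lam ξ‖ + α ^ 4 * ‖cutSymbol a b lam ξ‖ / ‖lam‖ ^ 4) := by ring
    _ ≤ ‖lam‖ ^ m * ((b + 1) ^ 2 * (1 / ‖lam‖ ^ 2 * E) +
          ‖lam‖ ^ 4 * ((1 + 8 * D * (b + 1) ^ 2) * (1 / ‖lam‖ ^ 2 * E)) / ‖lam‖ ^ 4) := by
        gcongr
    _ = _ := by field_simp

/-! ### The kernel of the free resolvent in the first quadrant -/

lemma measurable_waveDeriv (lam : ℂ) (j : ℕ) : Measurable (waveDeriv lam j) :=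
  (continuous_waveDeriv lam j).measurable

lemma integrableOn_mul_exp {c : ℂ} (hc : c.re < 0) :
    IntegrableOn (fun r : ℝ => (r : ℂ) * Complex.exp (c * r)) (Ioi 0) := by
  have h := integrableOn_rpow_mul_exp_neg_mul_rpow (p := 1) (s := 1) (b := -c.re) (by norm_num)
    one_pos (by linarith)
  refine (integrable_norm_iff (Continuous.aestronglyMeasurable (by fun_prop))).1 ?_
  refine h.congr_fun (fun r hr => ?_) measurableSet_Ioi
  have hr' : (0 : ℝ) < r := hr
  simp only [Real.rpow_one, neg_neg, norm_mul, Complex.norm_real, Real.norm_eq_abs, abs_of_pos hr',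
    Complex.norm_exp, Complex.re_mul_ofReal]

lemma integral_exp_mul_sin {μ : ℂ} (hμ : 0 < μ.re) (a : ℝ) :
    IntegrableOn (fun r : ℝ => Complex.exp (-μ * r) * Real.sin (a * r)) (Ioi 0) ∧
    ∫ r in Ioi (0 : ℝ), Complex.exp (-μ * r) * Real.sin (a * r) = a / (a ^ 2 + μ ^ 2) := by
  have h1 : (-μ - a * Complex.I).re < 0 := by simp [hμ]
  have h2 : (-μ + a * Complex.I).re < 0 := by simp [hμ]
  have i1 := integrableOn_exp_mul_complex_Ioi h1 0
  have i2 := integrableOn_exp_mul_complex_Ioi h2 0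
  have he : ∀ r : ℝ, Complex.exp (-μ * r) * Real.sin (a * r) =
      Complex.I / 2 * (Complex.exp ((-μ - a * Complex.I) * r) -
        Complex.exp ((-μ + a * Complex.I) * r)) := fun r => by
    rw [Complex.ofReal_sin, Complex.sin]
    have e1 : (-μ - a * Complex.I) * r = -μ * r + -((a * r : ℝ) * Complex.I) := by push_cast; ring
    have e2 : (-μ + a * Complex.I) * r = -μ * r + (a * r : ℝ) * Complex.I := by push_cast; ring
    rw [e1, e2, Complex.exp_add, Complex.exp_add, neg_mul]
    ring_nf
  simp_rw [he]
  refine ⟨(i1.sub i2).const_mul _, ?_⟩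
  rw [integral_const_mul, integral_sub i1 i2, integral_exp_mul_complex_Ioi h1,
    integral_exp_mul_complex_Ioi h2]
  have n1 : (-μ - a * Complex.I) ≠ 0 := fun h => by rw [h] at h1; simp at h1
  have n2 : (-μ + a * Complex.I) ≠ 0 := fun h => by rw [h] at h2; simp at h2
  have hprod : (a : ℂ) ^ 2 + μ ^ 2 = (-μ - a * Complex.I) * (-μ + a * Complex.I) := by
    linear_combination (a : ℂ) ^ 2 * Complex.I_sq
  rw [hprod]
  simp only [Complex.ofReal_zero, mul_zero, Complex.exp_zero]
  have key : ∀ X Y : ℂ, X ≠ 0 → Y ≠ 0 →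
      Complex.I / 2 * (-1 / X - -1 / Y) = Complex.I / 2 * (X - Y) / (X * Y) := fun X Y hX hY => by
    field_simp; ring
  rw [key _ _ n1 n2]
  congr 1
  linear_combination -(a : ℂ) * Complex.I_sq

/-- The function `r ↦ (e^{iλr} - e^{-λr}) / (8πλ²)`. -/
def fullProfile (lam : ℂ) (r : ℝ) : ℂ := kernelCoeff lam * waveDeriv lam 0 r

/-- The convolution kernel `(e^{iλ|x|} - e^{-λ|x|}) / (8πλ²|x|)`. -/
def fullKernel (lam : ℂ) (x : E3) : ℂ := fullProfile lam ‖x‖ / (‖x‖ : ℂ)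

/-- In the first quadrant both e^{iλr} and e^{-λr} decay exponentially. -/
lemma integrableOn_fullProfile {lam : ℂ} (hlam : lam ∈ firstQuadrant) :
    IntegrableOn (fun r : ℝ => (r : ℂ) * fullProfile lam r) (Ioi 0) := by
  have i1 := integrableOn_mul_exp (c := Complex.I * lam) (by simpa using hlam.2)
  have i2 := integrableOn_mul_exp (c := -lam) (by simpa using hlam.1)
  refine IntegrableOn.congr_fun ((i1.sub i2).const_mul (kernelCoeff lam)) (fun r _ => ?_)
    measurableSet_Ioi
  simp only [fullProfile, waveDeriv, Pi.sub_apply]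
  ring

lemma integrable_fullKernel {lam : ℂ} (hlam : lam ∈ firstQuadrant) :
    Integrable (fullKernel lam) := integrable_radial (integrableOn_fullProfile hlam)

/-- The symbol `1 / (|2πξ|⁴ - λ⁴)` of the free resolvent. -/
def resSymbol (lam : ℂ) (ξ : E3) : ℂ := 1 / (((2 * Real.pi * ‖ξ‖ : ℝ) : ℂ) ^ 4 - lam ^ 4)

/-- λ² has positive imaginary part, whereas a² is real. -/
lemma firstQuadrant_pow_four {lam : ℂ} (hlam : lam ∈ firstQuadrant) (a : ℝ) :
    (a : ℂ) ^ 2 - lam ^ 2 ≠ 0 ∧ (a : ℂ) ^ 2 + lam ^ 2 ≠ 0 := by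
  have him : (lam ^ 2).im = 2 * lam.re * lam.im := by rw [sq, Complex.mul_im]; ring
  have hpos : 0 < (lam ^ 2).im := by rw [him]; have := hlam.1; have := hlam.2; positivity
  have ha : ((a : ℂ) ^ 2).im = 0 := by rw [← Complex.ofReal_pow, Complex.ofReal_im]
  constructor <;> intro h <;> have := congrArg Complex.im h <;>
    simp only [Complex.sub_im, Complex.add_im, ha, Complex.zero_im] at this <;> linarith

/-- The Laplace transforms of the sine at -iλ and at λ give a/(a² - λ²) and a/(a² + λ²), the partial
fractions of the symbol. -/
lemma fourier_fullKernel {lam : ℂ} (hlam : lam ∈ firstQuadrant) {ξ : E3} (hξ : ξ ≠ 0) :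
    𝓕 (fullKernel lam) ξ = resSymbol lam ξ := by
  have hm : Measurable (fullProfile lam) := (measurable_waveDeriv lam 0).const_mul _
  refine (fourier_radial hm (integrableOn_fullProfile hlam) hξ).trans ?_
  set a : ℝ := 2 * Real.pi * ‖ξ‖ with ha
  obtain ⟨j1, e1⟩ := integral_exp_mul_sin (μ := -(Complex.I * lam)) (by simpa using hlam.2) a
  obtain ⟨j2, e2⟩ := integral_exp_mul_sin (μ := lam) hlam.1 a
  have h : ∀ r : ℝ, fullProfile lam r * Real.sin (a * r) = kernelCoeff lam *
      (Complex.exp (-(-(Complex.I * lam)) * r) * Real.sin (a * r) -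
        Complex.exp (-lam * r) * Real.sin (a * r)) := fun r => by
    simp only [fullProfile, waveDeriv, neg_neg]; ring
  simp_rw [h]
  rw [integral_const_mul, integral_sub j1 j2, e1, e2]
  obtain ⟨n1, n2⟩ := firstQuadrant_pow_four hlam a
  have h0 : lam ≠ 0 := fun h => by have := hlam.1; simp [h] at this
  have hI : (-(Complex.I * lam)) ^ 2 = -lam ^ 2 := by
    linear_combination lam ^ 2 * Complex.I_sq
  have h4 : (a : ℂ) ^ 4 - lam ^ 4 = ((a : ℂ) ^ 2 - lam ^ 2) * ((a : ℂ) ^ 2 + lam ^ 2) := by ring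
  rw [hI, ← sub_eq_add_neg, resSymbol, ← ha, h4, kernelCoeff]
  have h1 : (‖ξ‖ : ℂ) ≠ 0 := by exact_mod_cast norm_ne_zero_iff.2 hξ
  have h2 : (Real.pi : ℂ) ≠ 0 := by exact_mod_cast Real.pi_ne_zero
  have h3 : (a : ℂ) = 2 * Real.pi * ‖ξ‖ := by rw [ha]; push_cast; ring
  field_simp
  rw [h3]
  ring

/-- The free resolvent `(Δ² - λ⁴)⁻¹` for `λ` in the first quadrant. -/
def freeRes (lam : ℂ) : L2 →L[ℂ] L2 := fourierMul (resSymbol lam)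

lemma freeRes_eq {lam : ℂ} (hlam : lam ∈ firstQuadrant) :
    freeRes lam = fourierMul (𝓕 (fullKernel lam)) := by
  refine fourierMul_congr ?_
  filter_upwards [compl_mem_ae_iff.2 (measure_singleton (0 : E3))] with ξ hξ
  exact (fourier_fullKernel hlam hξ).symm

/-! ### Comparing convolution operators whose kernels agree near the origin -/

/-- Two operators have the same matrix elements between functions supported in balls whose radii
add up to at most `d`. -/
def AgreeUpTo (d : ℝ) (S T : L2 →L[ℂ] L2) : Prop :=
  ∀ (r s : ℝ) (v w : Linfty), r + s ≤ d → SuppIn v r → SuppIn w s →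
    mulOp v * S * mulOp w = mulOp v * T * mulOp w

lemma fourier_add_of_integrable {k l : E3 → ℂ} (hk : Integrable k) (hl : Integrable l) :
    𝓕 (k + l) = 𝓕 k + 𝓕 l := by
  have h : ∀ {g : E3 → ℂ}, Integrable g → ∀ ξ, Integrable fun y => character y ξ * g y :=
    fun hg ξ => hg.bdd_mul (c := 1) (continuous_character.comp
      (by fun_prop : Continuous fun y => (y, ξ))).aestronglyMeasurable
      (ae_of_all _ fun y => (norm_character y ξ).le)
  ext ξ
  rw [Pi.add_apply, fourier_eq_integral_character, fourier_eq_integral_character,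
    fourier_eq_integral_character, ← integral_add (h hk ξ) (h hl ξ)]
  refine integral_congr_ae (ae_of_all _ fun y => ?_)
  simp only [Pi.add_apply]; ring

lemma fourier_const_smul (c : ℂ) (k : E3 → ℂ) : 𝓕 (c • k) = c • 𝓕 k := by
  ext ξ
  rw [Pi.smul_apply, fourier_eq_integral_character, fourier_eq_integral_character, smul_eq_mul,
    ← integral_const_mul]
  refine integral_congr_ae (ae_of_all _ fun y => ?_)
  simp only [Pi.smul_apply, smul_eq_mul]; ring

lemma agreeUpTo_of_kernel {d : ℝ} {k l : E3 → ℂ} (hk : Integrable k) (hl : Integrable l)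
    (h : ∀ y, ‖y‖ < d → k y = l y) : AgreeUpTo d (fourierMul (𝓕 k)) (fourierMul (𝓕 l)) := by
  intro r s v w hd hv hw
  have h1 := mulOp_fourierMul_mulOp_eq_zero (hk.sub hl) (r := r) (s := s)
    (fun y hy => by rw [Pi.sub_apply, h y (by linarith), sub_self]) hv hw
  have h2 : 𝓕 k = 𝓕 (k - l) + 𝓕 l := by
    rw [← fourier_add_of_integrable (hk.sub hl) hl, sub_add_cancel]
  rw [h2, fourierMul_add (memLp_top_fourier (hk.sub hl)) (memLp_top_fourier hl), mul_add, add_mul,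
    h1, zero_add]

lemma cutKernel_eq_fullKernel {a b : ℝ} (hab : a < b) (lam : ℂ) {y : E3} (hy : ‖y‖ ≤ a) :
    cutKernel a b lam y = fullKernel lam y := by
  rw [cutKernel, fullKernel, cutProfile, fullProfile, bumpDeriv, iteratedDeriv_zero,
    bump_eq_one hab hy, Complex.ofReal_one, one_mul]

lemma agreeUpTo_cutOp_cutOp {a b a' b' d : ℝ} (hab : a < b) (hab' : a' < b') (hd : d ≤ a)
    (hd' : d ≤ a') (lam : ℂ) : AgreeUpTo d (cutOp a b lam) (cutOp a' b' lam) :=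
  agreeUpTo_of_kernel (integrable_cutKernel hab lam) (integrable_cutKernel hab' lam) fun y hy => by
    rw [cutKernel_eq_fullKernel hab lam (by linarith),
      cutKernel_eq_fullKernel hab' lam (by linarith)]

lemma agreeUpTo_freeRes_cutOp {a b d : ℝ} (hab : a < b) (hd : d ≤ a) {lam : ℂ}
    (hlam : lam ∈ firstQuadrant) : AgreeUpTo d (freeRes lam) (cutOp a b lam) := by
  rw [freeRes_eq hlam]
  exact agreeUpTo_of_kernel (integrable_fullKernel hlam) (integrable_cutKernel hab lam)
    fun y hy => (cutKernel_eq_fullKernel hab lam (by linarith)).symm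

/-! ### Analytic dependence of the cut operator on λ -/

/-- The function `ψ(r) u(r)`, for a bump function `ψ` and `u` continuous on `[0, b]`. -/
def modProfile (a : ℝ) {b : ℝ} (hb : 0 ≤ b) (u : C(Icc 0 b, ℂ)) (r : ℝ) : ℂ :=
  bumpDeriv a b 0 r * u (projIcc 0 b hb r)

/-- The kernel `ψ(|x|) u(|x|) / |x|`. -/
def modKernel (a : ℝ) {b : ℝ} (hb : 0 ≤ b) (u : C(Icc 0 b, ℂ)) (x : E3) : ℂ :=
  modProfile a hb u ‖x‖ / (‖x‖ : ℂ)

lemma measurable_modProfile {a b : ℝ} (hb : 0 ≤ b) (u : C(Icc 0 b, ℂ)) :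
    Measurable (modProfile a hb u) :=
  ((continuous_bumpDeriv a b 0).mul (u.continuous.comp continuous_projIcc)).measurable

lemma norm_modProfile_le {a b : ℝ} (hb : 0 ≤ b) (u : C(Icc 0 b, ℂ)) (r : ℝ) :
    ‖modProfile a hb u r‖ ≤ ‖u‖ := by
  rw [modProfile, norm_mul]
  refine (mul_le_mul (norm_bumpDeriv_zero_le a b r) (u.norm_coe_le_norm _) (norm_nonneg _)
    zero_le_one).trans_eq (one_mul _)

lemma modProfile_eq_zero {a b : ℝ} (hab : a < b) (hb : 0 ≤ b)
    (u : C(Icc 0 b, ℂ)) {r : ℝ} (hr : b + 1 ≤ r) :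
    modProfile a hb u r = 0 := by
  rw [modProfile, bumpDeriv_eq_zero_of_gt hab (by linarith), zero_mul]

lemma integrableOn_modProfile {a b : ℝ} (hab : a < b) (hb : 0 ≤ b)
    (u : C(Icc 0 b, ℂ)) :
    IntegrableOn (fun r : ℝ => (r : ℂ) * modProfile a hb u r) (Ioi 0) :=
  integrableOn_mul_of_bounded (measurable_modProfile hb u)
    (fun r _ => norm_modProfile_le hb u r) (fun _ hr => modProfile_eq_zero hab hb u hr)

lemma integrable_modKernel {a b : ℝ} (hab : a < b) (hb : 0 ≤ b)
    (u : C(Icc 0 b, ℂ)) : Integrable (modKernel a hb u) :=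
  integrable_radial (integrableOn_modProfile hab hb u)

/-- Convolution with `modKernel`, as a bounded linear map in the modulating function. -/
def modOp {a b : ℝ} (hab : a < b) (hb : 0 ≤ b) : C(Icc 0 b, ℂ) →L[ℂ] (L2 →L[ℂ] L2) :=
  LinearMap.mkContinuous
    { toFun := fun u => fourierMul (𝓕 (modKernel a hb u))
      map_add' := fun u v => by
        have : modKernel a hb (u + v) = modKernel a hb u + modKernel a hb v := by
          ext x; simp only [modKernel, modProfile, ContinuousMap.add_apply, Pi.add_apply]; ring
        rw [this, fourier_add_of_integrable (integrable_modKernel hab hb u)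
          (integrable_modKernel hab hb v), fourierMul_add
          (memLp_top_fourier (integrable_modKernel hab hb u))
          (memLp_top_fourier (integrable_modKernel hab hb v))]
      map_smul' := fun c u => by
        have : modKernel a hb (c • u) = c • modKernel a hb u := by
          ext x
          simp only [modKernel, modProfile, ContinuousMap.smul_apply, Pi.smul_apply, smul_eq_mul]
          ring
        rw [this, fourier_const_smul, fourierMul_smul _
          (memLp_top_fourier (integrable_modKernel hab hb u)), RingHom.id_apply] }
    (4 * Real.pi * (b + 1) ^ 2) fun u => by
      refine norm_fourierMul_le ?_ (by positivity)
      filter_upwards [compl_mem_ae_iff.2 (measure_singleton (0 : E3))] with ξ hξ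
      rw [show 𝓕 (modKernel a hb u) ξ = _ from fourier_radial (measurable_modProfile hb u)
        (integrableOn_modProfile hab hb u) hξ]
      exact norm_sineTransform_le (by linarith) (fun r _ => norm_modProfile_le hb u r)
        (fun r hr => modProfile_eq_zero hab hb u hr) hξ

lemma modOp_apply {a b : ℝ} (hab : a < b) (hb : 0 ≤ b)
    (u : C(Icc 0 b, ℂ)) : modOp hab hb u = fourierMul (𝓕 (modKernel a hb u)) := rfl

/-- The inclusion `[0, b] → ℂ`. -/
def inclIcc (b : ℝ) : C(Icc 0 b, ℂ) := ⟨fun r => ((r : ℝ) : ℂ), by fun_prop⟩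

lemma exp_smul_inclIcc_apply {b : ℝ} (c : ℂ) (r : Icc 0 b) :
    NormedSpace.exp (c • inclIcc b) r = Complex.exp (c * (r : ℝ)) := by
  have h := NormedSpace.map_exp (ContinuousMap.evalAlgHom ℂ ℂ r)
    (continuous_eval_const r) (c • inclIcc b)
  rw [← Complex.exp_eq_exp_ℂ] at h
  exact h

lemma cutOp_eq_modOp {a b : ℝ} (hab : a < b) (hb : 0 ≤ b) (lam : ℂ) :
    cutOp a b lam = kernelCoeff lam • modOp hab hb
    (NormedSpace.exp ((Complex.I * lam) • inclIcc b) - NormedSpace.exp ((-lam) • inclIcc b)) := by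
  rw [modOp_apply, ← fourierMul_smul _ (memLp_top_fourier (integrable_modKernel hab hb _)),
    ← fourier_const_smul, cutOp, cutSymbol]
  congr 2
  ext x
  simp only [cutKernel, cutProfile, Pi.smul_apply, modKernel, modProfile, smul_eq_mul,
    ContinuousMap.sub_apply, exp_smul_inclIcc_apply]
  -- Beyond b the projection to [0, b] changes the exponentials, but there the bump vanishes.
  by_cases hx : ‖x‖ ≤ b
  · rw [projIcc_of_mem hb ⟨norm_nonneg x, hx⟩]
    simp only [waveDeriv]; ring
  · rw [bumpDeriv_eq_zero_of_gt hab (not_le.1 hx)]; ring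

/-- Through `modOp` the dependence on λ is that of exponentials in the Banach algebra C([0, b]),
followed by a bounded linear map; no differentiation under an integral is needed. The only
singularity is the coefficient 1/(8πλ²). -/
lemma analyticAt_cutOp {a b : ℝ} (hab : a < b) (hb : 0 ≤ b) {lam : ℂ} (h0 : lam ≠ 0) :
    AnalyticAt ℂ (cutOp a b) lam := by
  have h1 : cutOp a b = fun lam => kernelCoeff lam • modOp hab hb
    (NormedSpace.exp ((Complex.I * lam) • inclIcc b) - NormedSpace.exp ((-lam) • inclIcc b)) :=
    funext (cutOp_eq_modOp hab hb)
  have hexp : ∀ c : ℂ → ℂ, AnalyticAt ℂ c lam →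
      AnalyticAt ℂ (fun lam => NormedSpace.exp (c lam • inclIcc b)) lam := fun c hc =>
    (NormedSpace.exp_analytic (𝕂 := ℂ) (c lam • inclIcc b)).comp_of_eq
      (hc.smul analyticAt_const) rfl
  rw [h1]
  have hk : AnalyticAt ℂ kernelCoeff lam := by
    refine AnalyticAt.div analyticAt_const (analyticAt_const.mul (analyticAt_id.pow 2)) ?_
    have : (Real.pi : ℂ) ≠ 0 := by exact_mod_cast Real.pi_ne_zero
    simp [this, h0]
  exact hk.smul (((modOp hab hb).analyticAt _).comp
    ((hexp _ (analyticAt_const.mul analyticAt_id)).sub (hexp _ analyticAt_id.neg)))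

/-! ### The free resolvent as the solution operator in H⁴ -/

lemma coe_add_L2 (f g : L2) : ((f + g : L2) : 𝓢'(E3, ℂ)) = (f : 𝓢'(E3, ℂ)) + (g : 𝓢'(E3, ℂ)) :=
  map_add (Lp.toTemperedDistributionCLM ℂ (volume : Measure E3) 2) f g

lemma coe_sub_L2 (f g : L2) : ((f - g : L2) : 𝓢'(E3, ℂ)) = (f : 𝓢'(E3, ℂ)) - (g : 𝓢'(E3, ℂ)) :=
  map_sub (Lp.toTemperedDistributionCLM ℂ (volume : Measure E3) 2) f g

/-- Multiplying an `L²` function by a function of temperate growth, in the sense of distributions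
and pointwise. -/
lemma smulLeftCLM_coe_eq_iff {p : E3 → ℂ} (hp : p.HasTemperateGrowth) (F G : L2) :
    TemperedDistribution.smulLeftCLM ℂ p (F : 𝓢'(E3, ℂ)) = (G : 𝓢'(E3, ℂ)) ↔
      ∀ᵐ ξ, p ξ * F ξ = G ξ := by
  have hF : ∀ g : 𝓢(E3, ℂ), TemperedDistribution.smulLeftCLM ℂ p (F : 𝓢'(E3, ℂ)) g =
      ∫ ξ, g ξ • (p ξ * F ξ) := fun g => by
    rw [TemperedDistribution.smulLeftCLM_apply_apply, Lp.toTemperedDistribution_apply]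
    refine integral_congr_ae (ae_of_all _ fun ξ => ?_)
    simp only [SchwartzMap.smulLeftCLM_apply_apply hp, smul_eq_mul]; ring
  have hloc : ∀ H : L2, LocallyIntegrable H := fun H =>
    (Lp.memLp H).locallyIntegrable (by norm_num)
  constructor
  · intro h
    have h1 : LocallyIntegrable fun ξ => p ξ * F ξ := by
      refine ((hloc F).locallyIntegrableOn univ).continuousOn_mul
        hp.1.continuous.continuousOn isOpen_univ.isLocallyClosed |> fun h => ?_
      exact locallyIntegrableOn_univ.1 h
    have h2 := ae_eq_zero_of_integral_contDiff_smul_eq_zero (h1.sub (hloc G)) fun g hg hgc => by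
      have hg₁ : HasCompactSupport (Complex.ofRealCLM ∘ g) := hgc.comp_left rfl
      have hg₂ : ContDiff ℝ (⊤ : ℕ∞) (Complex.ofRealCLM ∘ g) := by fun_prop
      have h3 := congrArg (fun T : 𝓢'(E3, ℂ) => T (hg₁.toSchwartzMap hg₂)) h
      simp only [hF, Lp.toTemperedDistribution_apply] at h3
      have hgc' : Continuous g := hg.continuous
      have i1 := h1.integrable_smul_left_of_hasCompactSupport hgc' hgc
      have i2 := (hloc G).integrable_smul_left_of_hasCompactSupport hgc' hgc
      simp only [Pi.sub_apply, smul_sub]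
      rw [integral_sub i1 i2, sub_eq_zero]
      exact h3
    filter_upwards [h2] with ξ hξ
    exact sub_eq_zero.1 hξ
  · intro h
    ext g
    rw [hF, Lp.toTemperedDistribution_apply]
    refine integral_congr_ae ?_
    filter_upwards [h] with ξ hξ
    rw [hξ]

lemma fourier_bilaplacian (u : 𝓢'(E3, ℂ)) : 𝓕 (Δ (Δ u)) = TemperedDistribution.smulLeftCLM ℂ
    (fun ξ : E3 => ((2 * Real.pi * ‖ξ‖ : ℝ) : ℂ) ^ 4) (𝓕 u) := by
  set p : E3 → ℂ := fun ξ => ((‖ξ‖ ^ 2 : ℝ) : ℂ) with hp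
  have hpt : p.HasTemperateGrowth := by rw [hp]; fun_prop
  have h : ∀ v : 𝓢'(E3, ℂ), 𝓕 (Δ v) =
      (-(2 * Real.pi) ^ 2 : ℂ) • TemperedDistribution.smulLeftCLM ℂ p (𝓕 v) := fun v => by
    rw [TemperedDistribution.laplacian_eq_fourierMultiplierCLM,
      TemperedDistribution.fourierMultiplierCLM_apply, ← Complex.coe_smul, fourier_smul,
      fourier_fourierInv_eq]
    congr 1
    push_cast
    rfl
  have hq : (fun ξ : E3 => ((2 * Real.pi * ‖ξ‖ : ℝ) : ℂ) ^ 4) =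
      (-(2 * Real.pi) ^ 2 * -(2 * Real.pi) ^ 2 : ℂ) • (p * p) := by
    ext ξ
    simp only [hp, Pi.smul_apply, Pi.mul_apply, smul_eq_mul]
    push_cast; ring
  rw [h, h, hq, TemperedDistribution.smulLeftCLM_smul (by fun_prop), map_smul, smul_smul,
    TemperedDistribution.smulLeftCLM_smulLeftCLM_apply hpt hpt]
  rfl

lemma hasTemperateGrowth_symbol :
    (fun ξ : E3 => ((2 * Real.pi * ‖ξ‖ : ℝ) : ℂ) ^ 4).HasTemperateGrowth := by
  have : (fun ξ : E3 => ((2 * Real.pi * ‖ξ‖ : ℝ) : ℂ) ^ 4) =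
      fun ξ : E3 => (((2 * Real.pi) ^ 4 * (‖ξ‖ ^ 2 * ‖ξ‖ ^ 2) : ℝ) : ℂ) := by
    ext ξ; push_cast; ring
  rw [this]; fun_prop

lemma resSymbol_denom_ne_zero {lam : ℂ} (hlam : lam ∈ firstQuadrant) (a : ℝ) :
    (a : ℂ) ^ 4 - lam ^ 4 ≠ 0 := by
  obtain ⟨n1, n2⟩ := firstQuadrant_pow_four hlam a
  rw [show (a : ℂ) ^ 4 - lam ^ 4 = ((a : ℂ) ^ 2 - lam ^ 2) * ((a : ℂ) ^ 2 + lam ^ 2) by ring]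
  exact mul_ne_zero n1 n2

lemma continuous_resSymbol {lam : ℂ} (hlam : lam ∈ firstQuadrant) : Continuous (resSymbol lam) :=
  Continuous.div (by fun_prop) (by fun_prop) fun ξ => resSymbol_denom_ne_zero hlam _

/-- The free resolvent gains four derivatives. -/
lemma exists_bound_mul_resSymbol {lam : ℂ} (hlam : lam ∈ firstQuadrant) :
    ∃ C : ℝ, ∀ ξ : E3, ‖(((1 + ‖ξ‖ ^ 2) ^ (4 / 2 : ℝ) : ℝ) : ℂ) * resSymbol lam ξ‖ ≤ C := by
  obtain ⟨C₁, hC₁⟩ := (isCompact_closedBall (0 : E3) (1 + ‖lam‖)).exists_bound_of_continuousOn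
    (f := fun ξ : E3 => ((((1 + ‖ξ‖ ^ 2) ^ (2 : ℕ) : ℝ) : ℂ) * resSymbol lam ξ))
    (Continuous.mul (by fun_prop) (continuous_resSymbol hlam)).continuousOn
  refine ⟨max C₁ 4, fun ξ => ?_⟩
  have e : (1 + ‖ξ‖ ^ 2) ^ (4 / 2 : ℝ) = (1 + ‖ξ‖ ^ 2) ^ (2 : ℕ) := by
    rw [← Real.rpow_natCast]; norm_num
  rw [e]
  by_cases hξ : ‖ξ‖ ≤ 1 + ‖lam‖
  · exact (hC₁ ξ (by simpa using hξ)).trans (le_max_left _ _)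
  -- For ‖ξ‖ > 1 + |λ| the weight is at most 4‖ξ‖⁴, and the denominator is at least 2‖ξ‖⁴ - |λ|⁴ ≥
  -- ‖ξ‖⁴.
  · refine le_trans ?_ (le_max_right _ _)
    have h0 := norm_nonneg lam
    have h1 : 1 + ‖lam‖ < ‖ξ‖ := not_le.1 hξ
    rw [norm_mul, resSymbol, norm_div, norm_one, Complex.norm_real, Real.norm_eq_abs,
      abs_of_nonneg (by positivity), mul_one_div]
    have h2 : (2 * Real.pi * ‖ξ‖) ^ 4 - ‖lam‖ ^ 4 ≤
        ‖((2 * Real.pi * ‖ξ‖ : ℝ) : ℂ) ^ 4 - lam ^ 4‖ := by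
      have := norm_sub_norm_le (((2 * Real.pi * ‖ξ‖ : ℝ) : ℂ) ^ 4) (lam ^ 4)
      rwa [norm_pow, norm_pow, Complex.norm_real, Real.norm_eq_abs,
        abs_of_nonneg (by positivity)] at this
    have h3 : 2 * ‖ξ‖ ^ 4 ≤ (2 * Real.pi * ‖ξ‖) ^ 4 := by
      have h5 : (2 : ℝ) ≤ (2 * Real.pi) ^ 4 := by
        have := Real.pi_gt_three
        have h6 : (2 : ℝ) ≤ 2 * Real.pi := by linarith
        exact h6.trans (le_self_pow₀ (by linarith) (by norm_num))
      rw [mul_pow _ ‖ξ‖]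
      gcongr
    have h4 : ‖lam‖ ^ 4 ≤ ‖ξ‖ ^ 4 := by gcongr; linarith
    have h5 : 1 ≤ ‖ξ‖ ^ 2 := by nlinarith
    rw [div_le_iff₀ (by nlinarith [pow_pos (by linarith : 0 < ‖ξ‖) 4])]
    nlinarith

/-- Solving `(Δ² - λ⁴) u = f` in `H⁴(ℝ³)`. -/
theorem free_solves_iff {lam : ℂ} (hlam : lam ∈ firstQuadrant) (u f : L2) :
    (TemperedDistribution.MemSobolev 4 2 (u : 𝓢'(E3, ℂ)) ∧
      Δ (Δ (u : 𝓢'(E3, ℂ))) - lam ^ 4 • (u : 𝓢'(E3, ℂ)) = (f : 𝓢'(E3, ℂ))) ↔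
    u = freeRes lam f := by
  set q : E3 → ℂ := fun ξ => ((2 * Real.pi * ‖ξ‖ : ℝ) : ℂ) ^ 4 with hqdef
  have hq : q.HasTemperateGrowth := hasTemperateGrowth_symbol
  obtain ⟨C, hC⟩ := exists_bound_mul_resSymbol hlam
  have hσ : MemLp (resSymbol lam) ∞ volume := by
    refine memLp_top_of_bound (continuous_resSymbol hlam).aestronglyMeasurable C
      (ae_of_all _ fun ξ => (le_trans ?_ (hC ξ)))
    rw [norm_mul, Complex.norm_real, Real.norm_eq_abs, abs_of_nonneg (by positivity)]
    exact le_mul_of_one_le_left (norm_nonneg _)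
      (Real.one_le_rpow (by nlinarith [sq_nonneg ‖ξ‖]) (by norm_num))
  have hu : u = freeRes lam f ↔ ∀ᵐ ξ, (q ξ - lam ^ 4) * (𝓕 u : L2) ξ = (𝓕 f : L2) ξ := by
    rw [← (Lp.fourierTransformₗᵢ E3 ℂ).injective.eq_iff]
    change 𝓕 u = 𝓕 (freeRes lam f) ↔ _
    rw [freeRes, fourier_fourierMul]
    constructor
    · intro h
      filter_upwards [coeFn_bddMul hσ (𝓕 f)] with ξ h1
      rw [h, h1, resSymbol]
      have := resSymbol_denom_ne_zero hlam (2 * Real.pi * ‖ξ‖)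
      field_simp
      rfl
    · intro h
      refine Lp.ext ?_
      filter_upwards [coeFn_bddMul hσ (𝓕 f), h] with ξ h1 h2
      rw [h1, ← h2, resSymbol]
      have := resSymbol_denom_ne_zero hlam (2 * Real.pi * ‖ξ‖)
      rw [one_div, inv_mul_cancel_left₀ this]
  have heq : Δ (Δ (u : 𝓢'(E3, ℂ))) - lam ^ 4 • (u : 𝓢'(E3, ℂ)) = (f : 𝓢'(E3, ℂ)) ↔
      ∀ᵐ ξ, (q ξ - lam ^ 4) * (𝓕 u : L2) ξ = (𝓕 f : L2) ξ := by
    have hq' : (fun ξ => q ξ - lam ^ 4).HasTemperateGrowth := by fun_prop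
    rw [← smulLeftCLM_coe_eq_iff hq', ← Lp.fourier_toTemperedDistribution_eq,
      ← Lp.fourier_toTemperedDistribution_eq,
      ← (fourierEquiv ℂ 𝓢'(E3, ℂ)).injective.eq_iff]
    change 𝓕 (Δ (Δ (u : 𝓢'(E3, ℂ))) - lam ^ 4 • (u : 𝓢'(E3, ℂ))) = 𝓕 (f : 𝓢'(E3, ℂ)) ↔ _
    rw [sub_eq_add_neg, FourierTransform.fourier_add, ← neg_smul, fourier_smul, fourier_bilaplacian]
    have : (fun ξ => q ξ - lam ^ 4) = q - fun _ => lam ^ 4 := rfl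
    rw [this, TemperedDistribution.smulLeftCLM_sub hq (by fun_prop), sub_apply,
      TemperedDistribution.smulLeftCLM_const, neg_smul, ← sub_eq_add_neg]
  rw [heq, hu]
  -- The equation alone forces H⁴ regularity: it expresses 𝓕 u through 𝓕 f by a symbol that stays
  -- bounded under the Sobolev weight.
  refine ⟨fun h => h.2, fun h => ⟨?_, h⟩⟩
  have hu' := hu.2 h
  rw [TemperedDistribution.memSobolev_iff_exists_smulLeftCLM_fourier]
  have hw : MemLp (fun ξ : E3 => (((1 + ‖ξ‖ ^ 2) ^ (4 / 2 : ℝ) : ℝ) : ℂ) * resSymbol lam ξ) ∞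
      volume := by
    refine memLp_top_of_bound (Continuous.aestronglyMeasurable ?_) C (ae_of_all _ hC)
    refine Continuous.mul (Complex.continuous_ofReal.comp ?_) (continuous_resSymbol hlam)
    exact Continuous.rpow_const (by fun_prop) fun ξ => Or.inr (by norm_num)
  refine ⟨bddMul (fun ξ : E3 => (((1 + ‖ξ‖ ^ 2) ^ (4 / 2 : ℝ) : ℝ) : ℂ) * resSymbol lam ξ)
    (𝓕 f : L2), ?_⟩
  rw [Lp.fourier_toTemperedDistribution_eq, smulLeftCLM_coe_eq_iff (by fun_prop)]
  filter_upwards [coeFn_bddMul hw (𝓕 f), coeFn_bddMul hσ (𝓕 f)] with ξ h1 h2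
  rw [h1, hu', freeRes, fourier_fourierMul, h2, mul_assoc]

/-- Moving V u to the right-hand side as a source gives the integral form of the equation, with
which the resolvent identity is proved. -/
lemma solvesH4_iff {V : Linfty} {lam : ℂ} (hlam : lam ∈ firstQuadrant) (u f : L2) :
    SolvesH4 V (lam ^ 4) u f ↔ u = freeRes lam (f - mulOp V u) := by
  rw [← free_solves_iff hlam, SolvesH4, coe_sub_L2, mulOp_apply]
  refine and_congr_right fun _ => ⟨fun h => ?_, fun h => ?_⟩
  · rw [← h]; abel
  · rw [eq_sub_iff_add_eq] at h
    rw [← h]; abel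

/-! ### Truncation to balls and limits of stabilizing operators -/

lemma coeFn_cutoffLinfty (χ : Cutoff) : cutoffLinfty χ =ᵐ[volume] χ :=
  (χ.continuous.memLp_top_of_hasCompactSupport χ.hasCompactSupport volume).coeFn_toLp

lemma suppIn_cutoffLinfty {χ : Cutoff} {r : ℝ} (h : tsupport χ ⊆ Metric.ball 0 r) :
    SuppIn (cutoffLinfty χ) r := by
  filter_upwards [coeFn_cutoffLinfty χ] with x hx hr
  rw [hx]
  refine image_eq_zero_of_notMem_tsupport fun h' => ?_
  have := mem_ball_zero_iff.1 (h h')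
  linarith

lemma exists_tsupport_subset_ball (χ : Cutoff) : ∃ m : ℕ, tsupport χ ⊆ Metric.ball 0 (m : ℝ) := by
  obtain ⟨r, hr⟩ := χ.hasCompactSupport.isBounded.subset_ball (0 : E3)
  obtain ⟨m, hm⟩ := exists_nat_ge r
  exact ⟨m, hr.trans (Metric.ball_subset_ball hm)⟩

/-- The indicator function of the ball of radius `t` around the origin. -/
def ballInd (t : ℝ) : Linfty :=
  (memLp_top_of_bound (μ := volume) (f := (Metric.ball (0 : E3) t).indicator fun _ => (1 : ℂ))
    (measurable_const.indicator measurableSet_ball).aestronglyMeasurable 1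
    (ae_of_all _ fun x => by
      by_cases h : x ∈ Metric.ball (0 : E3) t <;> simp [h])).toLp _

lemma coeFn_ballInd (t : ℝ) :
    ballInd t =ᵐ[volume] (Metric.ball (0 : E3) t).indicator fun _ => (1 : ℂ) := MemLp.coeFn_toLp _

lemma suppIn_ballInd (t : ℝ) : SuppIn (ballInd t) t := by
  filter_upwards [coeFn_ballInd t] with x hx hr
  rw [hx, indicator_of_notMem]
  simpa using hr

lemma mulOp_ballInd_of_suppIn {v : Linfty} {t : ℝ} (hv : SuppIn v t) :
    mulOp (ballInd t) * mulOp v = mulOp v := by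
  refine mulOp_mul_of_ae ?_
  filter_upwards [coeFn_ballInd t, hv] with x h1 h2
  rw [h1]
  by_cases hx : t ≤ ‖x‖
  · rw [h2 hx, mul_zero]
  · rw [indicator_of_mem (by simpa using hx), one_mul]

lemma exists_ballInd_apply_eq (f : L2comp) : ∃ m : ℕ, mulOp (ballInd m) (f : L2) = f := by
  obtain ⟨K, hK, h⟩ := f.2
  obtain ⟨r, hr⟩ := hK.isBounded.subset_ball (0 : E3)
  obtain ⟨m, hm⟩ := exists_nat_ge r
  refine ⟨m, Lp.ext ?_⟩
  filter_upwards [coeFn_mulOp (ballInd m) (f : L2), coeFn_ballInd m, h] with x h1 h2 h3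
  rw [h1, h2]
  by_cases hx : x ∈ Metric.ball (0 : E3) m
  · rw [indicator_of_mem hx, one_mul]
  · rw [h3 fun hk => hx (Metric.ball_subset_ball hm (hr hk)), mul_zero]

/-- The truncations of a sequence of operators to balls are eventually constant. -/
def Stabilizes (Q : ℕ → L2 →L[ℂ] L2) : Prop :=
  ∀ j m : ℕ, ∃ N, ∀ n ≥ N, mulOp (ballInd j) * Q n * mulOp (ballInd m) =
    mulOp (ballInd j) * Q N * mulOp (ballInd m)

lemma apply_eq_of_truncations_eq {S T : L2 →L[ℂ] L2} {t : ℝ} {w : Linfty} {f : L2}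
    (hf : mulOp w f = f)
    (h : mulOp (ballInd t) * S * mulOp w = mulOp (ballInd t) * T * mulOp w) :
    ∀ᵐ x, ‖x‖ < t → S f x = T f x := by
  have h1 : mulOp (ballInd t) (S f) = mulOp (ballInd t) (T f) := by
    have := congrArg (fun A : L2 →L[ℂ] L2 => A f) h
    change mulOp (ballInd t) (S (mulOp w f)) = mulOp (ballInd t) (T (mulOp w f)) at this
    rwa [hf] at this
  filter_upwards [coeFn_mulOp (ballInd t) (S f), coeFn_mulOp (ballInd t) (T f), coeFn_ballInd t]
    with x a b c hx
  rw [h1, b, c, indicator_of_mem (by simpa using hx), one_mul, one_mul] at a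
  exact a.symm

/-- Some ball carries `f`, and on each ball of integer radius the values freeze from some index on;
countably many such balls cover ℝ³. -/
lemma Stabilizes.ae_eventually_eq {Q : ℕ → L2 →L[ℂ] L2} (hQ : Stabilizes Q) (f : L2comp) :
    ∀ᵐ x, ∃ N, ∀ n ≥ N, (Q n f : L2) x = (Q N f : L2) x := by
  obtain ⟨m, hm⟩ := exists_ballInd_apply_eq f
  have h : ∀ j : ℕ, ∀ᵐ x, ‖x‖ < j → ∃ N, ∀ n ≥ N, (Q n f : L2) x = (Q N f : L2) x := fun j => by
    obtain ⟨N, hN⟩ := hQ j m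
    have h1 : ∀ᵐ x, ∀ n, n ≥ N → ‖x‖ < (j : ℝ) → (Q n f : L2) x = (Q N f : L2) x := by
      refine ae_all_iff.2 fun n => ?_
      by_cases hn : n ≥ N
      · filter_upwards [apply_eq_of_truncations_eq hm (hN n hn)] with x hx _ using hx
      · exact ae_of_all _ fun x h => absurd h hn
    filter_upwards [h1] with x hx hj
    exact ⟨N, fun n hn => hx n hn hj⟩
  filter_upwards [ae_all_iff.2 h] with x hx
  obtain ⟨j, hj⟩ := exists_nat_gt ‖x‖
  exact hx j hj

/-- A stabilizing sequence of operators has a limit. -/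
theorem Stabilizes.exists_localOp {Q : ℕ → L2 →L[ℂ] L2} (hQ : Stabilizes Q) :
    ∃ T : LocalOp, ∀ f : L2comp, ∀ᵐ x, ∀ᶠ n in atTop, T f x = (Q n f : L2) x := by
  -- At almost every point the sequence is eventually constant, so this limit is an actual value of
  -- `Q n f`; the default values of `limUnder` matter only on a null set.
  let L : L2comp → E3 → ℂ := fun f x => limUnder atTop fun n => (Q n f : L2) x
  have hL : ∀ f : L2comp, ∀ᵐ x, ∀ᶠ n in atTop, L f x = (Q n f : L2) x := fun f => by
    filter_upwards [hQ.ae_eventually_eq f] with x ⟨N, hN⟩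
    have h1 : Tendsto (fun n => (Q n f : L2) x) atTop (𝓝 ((Q N f : L2) x)) :=
      tendsto_const_nhds.congr' (by filter_upwards [eventually_ge_atTop N] with n hn
                                    using (hN n hn).symm)
    filter_upwards [eventually_ge_atTop N] with n hn
    rw [hN n hn]
    exact h1.limUnder_eq
  have hmeas : ∀ f : L2comp, AEStronglyMeasurable (L f) volume := fun f => by
    refine aestronglyMeasurable_of_tendsto_ae atTop
      (fun n => Lp.aestronglyMeasurable (Q n f : L2)) ?_
    filter_upwards [hL f] with x hx
    exact tendsto_const_nhds.congr' hx
  refine ⟨{ toFun := fun f => AEEqFun.mk (L f) (hmeas f), map_add' := fun f g => ?_,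
            map_smul' := fun c f => ?_ }, fun f => ?_⟩
  · rw [AEEqFun.mk_add_mk]
    refine AEEqFun.mk_eq_mk.2 ?_
    have h : ∀ᵐ x, ∀ n, (Q n (f + g : L2comp) : L2) x = (Q n f : L2) x + (Q n g : L2) x := by
      refine ae_all_iff.2 fun n => ?_
      rw [Submodule.coe_add, map_add]
      exact Lp.coeFn_add _ _
    filter_upwards [hL f, hL g, hL (f + g), h] with x h1 h2 h3 h4
    obtain ⟨n, e1, e2, e3⟩ := (h1.and (h2.and h3)).exists
    rw [Pi.add_apply, e1, e2, e3, h4]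
  · rw [RingHom.id_apply, AEEqFun.smul_mk]
    refine AEEqFun.mk_eq_mk.2 ?_
    have h : ∀ᵐ x, ∀ n, (Q n (c • f : L2comp) : L2) x = c • (Q n f : L2) x := by
      refine ae_all_iff.2 fun n => ?_
      rw [Submodule.coe_smul, map_smul]
      exact Lp.coeFn_smul _ _
    filter_upwards [hL f, hL (c • f), h] with x h1 h3 h4
    obtain ⟨n, e1, e3⟩ := (h1.and h3).exists
    rw [Pi.smul_apply, e1, e3, h4]
  · filter_upwards [hL f, AEEqFun.coeFn_mk (L f) (hmeas f)] with x h1 h2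
    filter_upwards [h1] with n h3
    exact h2.trans h3

/-- Passes from almost everywhere limits to operators: the truncations of the limit inherit the
analyticity known for the `S` here. -/
lemma truncate_eq_of_eventually {T : LocalOp} {Q : ℕ → L2 →L[ℂ] L2}
    (hT : ∀ f : L2comp, ∀ᵐ x, ∀ᶠ n in atTop, T f x = (Q n f : L2) x) {χ : Cutoff}
    {S : L2 →L[ℂ] L2}
    (hS : ∀ᶠ n in atTop, mulOp (cutoffLinfty χ) * Q n * mulOp (cutoffLinfty χ) = S) (f : L2) :
    ((S f : L2) : E3 →ₘ[volume] ℂ) = truncate χ T f := by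
  obtain ⟨N, hN⟩ := eventually_atTop.1 hS
  have hc : ((cutoffMul χ f : L2comp) : L2) = mulOp (cutoffLinfty χ) f :=
    (mulOp_apply _ _).symm
  refine AEEqFun.ext ?_
  have h : ∀ᵐ x, ∀ n, n ≥ N → (S f : L2) x =
      cutoffLinfty χ x * (Q n (cutoffMul χ f : L2) : L2) x := by
    refine ae_all_iff.2 fun n => ?_
    by_cases hn : n ≥ N
    · rw [← hN n hn]
      filter_upwards [coeFn_mulOp (cutoffLinfty χ) (Q n (cutoffMul χ f : L2))] with x hx _
      rw [← hx, hc]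
      rfl
    · exact ae_of_all _ fun x h => absurd h hn
  filter_upwards [h, hT (cutoffMul χ f), AEEqFun.coeFn_mul (cutoffLinfty χ : E3 →ₘ[volume] ℂ)
    (T (cutoffMul χ f))] with x h1 h2 h3
  obtain ⟨n, e1, e2⟩ := (h2.and (eventually_ge_atTop N)).exists
  rw [truncate, h3, Pi.mul_apply, e1]
  exact h1 n e2

lemma localOp_eq_of_eventually {T : LocalOp} {Q : ℕ → L2 →L[ℂ] L2}
    (hT : ∀ f : L2comp, ∀ᵐ x, ∀ᶠ n in atTop, T f x = (Q n f : L2) x) {S : L2 →L[ℂ] L2}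
    (hS : ∀ j m : ℕ, ∀ᶠ n in atTop, mulOp (ballInd j) * S * mulOp (ballInd m) =
      mulOp (ballInd j) * Q n * mulOp (ballInd m)) (f : L2comp) :
    T f = ((S f : L2) : E3 →ₘ[volume] ℂ) := by
  obtain ⟨m, hm⟩ := exists_ballInd_apply_eq f
  refine AEEqFun.ext ?_
  have h : ∀ j : ℕ, ∀ᵐ x, ‖x‖ < j → ∀ᶠ n in atTop, (S f : L2) x = (Q n f : L2) x := fun j => by
    obtain ⟨N, hN⟩ := eventually_atTop.1 (hS j m)
    have h1 : ∀ᵐ x, ∀ n, n ≥ N → ‖x‖ < (j : ℝ) → (S f : L2) x = (Q n f : L2) x := by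
      refine ae_all_iff.2 fun n => ?_
      by_cases hn : n ≥ N
      · filter_upwards [apply_eq_of_truncations_eq hm (hN n hn)] with x hx _ using hx
      · exact ae_of_all _ fun x h => absurd h hn
    filter_upwards [h1] with x hx hj
    filter_upwards [eventually_ge_atTop N] with n hn using hx n hn hj
  filter_upwards [ae_all_iff.2 h, hT f] with x hx h2
  obtain ⟨j, hj⟩ := exists_nat_gt ‖x‖
  obtain ⟨n, e1, e2⟩ := ((hx j hj).and h2).exists
  rw [e2, ← e1]

/-! ### The perturbed resolvent and its local approximations -/

/-- The operator `C - C ρ (1 + V C₀ ρ)⁻¹ V C`. -/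
def perturb (V r : Linfty) (C₀ C : L2 →L[ℂ] L2) : L2 →L[ℂ] L2 :=
  C - C * mulOp r * Ring.inverse (1 + mulOp V * C₀ * mulOp r) * (mulOp V * C)

lemma isUnit_one_add_of_norm_lt_one {x : L2 →L[ℂ] L2} (hx : ‖x‖ < 1) : IsUnit (1 + x) := by
  have := isUnit_one_sub_of_norm_lt_one (x := -x) (by rwa [norm_neg])
  rwa [sub_neg_eq_add] at this

/-- Writing g for the image, g = f - x g gives ‖g‖ ≤ ‖f‖ + ‖g‖/2. -/
lemma norm_inverse_one_add_apply_le {x : L2 →L[ℂ] L2} (hx : ‖x‖ ≤ 1 / 2) (f : L2) :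
    ‖Ring.inverse (1 + x) f‖ ≤ 2 * ‖f‖ := by
  have hu := isUnit_one_add_of_norm_lt_one (hx.trans_lt (by norm_num))
  set g := Ring.inverse (1 + x) f with hg
  have h1 : g + x g = f := by
    have := congrArg (fun A : L2 →L[ℂ] L2 => A f) (Ring.mul_inverse_cancel _ hu)
    exact this
  have h2 : ‖x g‖ ≤ 1 / 2 * ‖g‖ := (x.le_opNorm g).trans (by gcongr)
  have h3 : ‖g‖ ≤ ‖f‖ + ‖x g‖ := by
    rw [← h1]
    simpa using norm_sub_le (g + x g) (x g)
  linarith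

/-- The resolvent identity, for a potential which is a small perturbation. -/
theorem isResolventAt_perturb {V r : Linfty} (hVr : mulOp V * mulOp r = mulOp V) {lam : ℂ}
    (hlam : lam ∈ firstQuadrant) {C₀ : L2 →L[ℂ] L2}
    (hC₀ : mulOp V * freeRes lam * mulOp r = mulOp V * C₀ * mulOp r)
    (hx : ‖mulOp V * C₀ * mulOp r‖ < 1) :
    IsResolventAt V (lam ^ 4) (perturb V r C₀ (freeRes lam)) := by
  have hu := isUnit_one_add_of_norm_lt_one hx
  set G := Ring.inverse (1 + mulOp V * C₀ * mulOp r) with hG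
  have hrV : mulOp r * mulOp V = mulOp V := by rw [mulOp_comm, hVr]
  have hinv : (1 + mulOp V * C₀ * mulOp r) * G = 1 := Ring.mul_inverse_cancel _ hu
  have hinv' : G * (1 + mulOp V * C₀ * mulOp r) = 1 := Ring.inverse_mul_cancel _ hu
  rw [← hC₀] at hinv hinv'
  have hT : ∀ f, perturb V r C₀ (freeRes lam) f = freeRes lam f -
      freeRes lam (mulOp r (G (mulOp V (freeRes lam f)))) := fun f => rfl
  refine ⟨fun f => ?_, fun u f h => ?_⟩
  · rw [solvesH4_iff hlam]
    set g := G (mulOp V (freeRes lam f)) with hg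
    have e1 : g + mulOp V (freeRes lam (mulOp r g)) = mulOp V (freeRes lam f) :=
      congrArg (fun A : L2 →L[ℂ] L2 => A (mulOp V (freeRes lam f))) hinv
    -- By `e1`, g lies in the range of V, on which multiplication by `r` is the identity.
    have e2 : mulOp r g = g := by
      have h1 : g = mulOp V (freeRes lam f - freeRes lam (mulOp r g)) := by
        rw [map_sub, ← e1, add_sub_cancel_right]
      rw [h1]
      exact congrArg (fun A : L2 →L[ℂ] L2 => A _) hrV
    rw [e2] at e1
    rw [hT, ← hg, e2, map_sub (freeRes lam), map_sub (mulOp V), ← e1, add_sub_cancel_right]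
  · rw [solvesH4_iff hlam] at h
    rw [hT]
    set g := mulOp V u with hg
    have e2 : mulOp r g = g := congrArg (fun A : L2 →L[ℂ] L2 => A u) hrV
    have e1 : G (mulOp V (freeRes lam f)) = g := by
      have h1 : mulOp V (freeRes lam f) = g + mulOp V (freeRes lam (mulOp r g)) := by
        -- Applying V to u = R₀(f - V u) yields an equation for g = V u alone, which the inverse of
        -- 1 + V R₀ r solves.
        have h2 : g = mulOp V (freeRes lam (f - g)) := congrArg (mulOp V) h
        rw [map_sub, map_sub, eq_sub_iff_add_eq] at h2
        rw [e2, h2]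
      rw [h1]
      exact congrArg (fun A : L2 →L[ℂ] L2 => A g) hinv'
    rw [e1, e2, ← map_sub]
    exact h.symm

/-- The perturbed operators only depend on nearby matrix elements. -/
lemma perturb_agree {V r : Linfty} {C₀ C C' : L2 →L[ℂ] L2} {d s j m : ℝ} (h : AgreeUpTo d C C')
    (hV : SuppIn V s) (hr : SuppIn r s) {v w : Linfty} (hv : SuppIn v j) (hw : SuppIn w m)
    (h1 : j + m ≤ d) (h2 : j + s ≤ d) (h3 : s + m ≤ d) :
    mulOp v * perturb V r C₀ C * mulOp w = mulOp v * perturb V r C₀ C' * mulOp w := by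
  have e1 := h j m v w h1 hv hw
  have e2 := h j s v r h2 hv hr
  have e3 := h s m V w h3 hV hw
  -- After sandwiching, `C` enters only through the blocks v C w, v C r and V C w, each flanked by
  -- functions of bounded support.
  have key : ∀ C : L2 →L[ℂ] L2, mulOp v * perturb V r C₀ C * mulOp w = mulOp v * C * mulOp w -
      (mulOp v * C * mulOp r) * Ring.inverse (1 + mulOp V * C₀ * mulOp r) *
        (mulOp V * C * mulOp w) := fun C => by
    rw [perturb]; noncomm_ring
  rw [key, key, e1, e2, e3]

lemma suppIn_of_mul_eq {V : Linfty} {ρ : Cutoff} (hρV : ∀ᵐ x, ρ x * V x = V x) {s : ℝ}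
    (hs : tsupport ρ ⊆ Metric.ball 0 s) : SuppIn V s := by
  filter_upwards [hρV, coeFn_cutoffLinfty ρ, suppIn_cutoffLinfty hs] with x h1 h2 h3 h4
  rw [← h1, ← h2, h3 h4, zero_mul]

lemma mulOp_mul_cutoff {V : Linfty} {ρ : Cutoff} (hρV : ∀ᵐ x, ρ x * V x = V x) :
    mulOp V * mulOp (cutoffLinfty ρ) = mulOp V := by
  refine mulOp_mul_of_ae ?_
  filter_upwards [hρV, coeFn_cutoffLinfty ρ] with x h1 h2
  rw [h2, mul_comm, h1]

/-- The approximation of the perturbed resolvent which is exact on the ball of radius `n`. -/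
def approxRes (V : Linfty) (ρ : Cutoff) (a b : ℝ) (n : ℕ) (lam : ℂ) : L2 →L[ℂ] L2 :=
  perturb V (cutoffLinfty ρ) (cutOp a b lam) (cutOp n (n + 1) lam)

lemma approxRes_agree {V : Linfty} {ρ : Cutoff} (hρV : ∀ᵐ x, ρ x * V x = V x) {s : ℝ}
    (hs : tsupport ρ ⊆ Metric.ball 0 s) (a b : ℝ) {v w : Linfty} {j m : ℝ} (hv : SuppIn v j)
    (hw : SuppIn w m) {n n' : ℕ} (h1 : j + m ≤ n) (h2 : j + s ≤ n) (h3 : s + m ≤ n)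
    (hn : n ≤ n') (lam : ℂ) :
    mulOp v * approxRes V ρ a b n' lam * mulOp w = mulOp v * approxRes V ρ a b n lam * mulOp w :=
  perturb_agree (agreeUpTo_cutOp_cutOp (d := n) (by linarith) (by linarith)
    (by exact_mod_cast hn) le_rfl lam) (suppIn_of_mul_eq hρV hs) (suppIn_cutoffLinfty hs) hv hw
    h1 h2 h3

lemma stabilizes_approxRes {V : Linfty} {ρ : Cutoff} (hρV : ∀ᵐ x, ρ x * V x = V x) (a b : ℝ)
    (lam : ℂ) : Stabilizes fun n => approxRes V ρ a b n lam := by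
  intro j m
  obtain ⟨s, hs⟩ := exists_tsupport_subset_ball ρ
  refine ⟨j + m + s, fun n hn => ?_⟩
  refine approxRes_agree hρV hs a b (suppIn_ballInd j) (suppIn_ballInd m) ?_ ?_ ?_ hn lam <;>
  · push_cast
    linarith [Nat.cast_nonneg (α := ℝ) j, Nat.cast_nonneg (α := ℝ) m, Nat.cast_nonneg (α := ℝ) s]

/-- Ties the approximations to the true resolvent: in the first quadrant the full kernel is
available and coincides with the kernel cut at n at distances below n. -/
lemma freeRes_agree_approxRes {V : Linfty} {ρ : Cutoff} (hρV : ∀ᵐ x, ρ x * V x = V x) {s : ℝ}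
    (hs : tsupport ρ ⊆ Metric.ball 0 s) (a b : ℝ) {v w : Linfty} {j m : ℝ} (hv : SuppIn v j)
    (hw : SuppIn w m) {n : ℕ} (h1 : j + m ≤ n) (h2 : j + s ≤ n) (h3 : s + m ≤ n)
    {lam : ℂ} (hlam : lam ∈ firstQuadrant) :
    mulOp v * perturb V (cutoffLinfty ρ) (cutOp a b lam) (freeRes lam) * mulOp w =
      mulOp v * approxRes V ρ a b n lam * mulOp w :=
  perturb_agree (agreeUpTo_freeRes_cutOp (d := n) (by linarith) le_rfl hlam)
    (suppIn_of_mul_eq hρV hs) (suppIn_cutoffLinfty hs) hv hw h1 h2 h3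

lemma analyticAt_approxRes (V : Linfty) (ρ : Cutoff) {a b : ℝ} (hab : a < b) (hb : 0 ≤ b) (n : ℕ)
    {lam : ℂ} (h0 : lam ≠ 0) (hx : ‖mulOp V * cutOp a b lam * mulOp (cutoffLinfty ρ)‖ < 1) :
    AnalyticAt ℂ (approxRes V ρ a b n) lam := by
  have h1 : AnalyticAt ℂ (cutOp (n : ℝ) (n + 1)) lam :=
    analyticAt_cutOp (by linarith) (by positivity) h0
  have h2 : AnalyticAt ℂ (cutOp a b) lam := analyticAt_cutOp hab hb h0
  have h3 : AnalyticAt ℂ (fun lam => Ring.inverse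
      (1 + mulOp V * cutOp a b lam * mulOp (cutoffLinfty ρ))) lam := by
    obtain ⟨U, hU⟩ := isUnit_one_add_of_norm_lt_one hx
    have h4 := analyticAt_inverse (𝕜 := ℂ) U
    rw [hU] at h4
    exact h4.comp_of_eq (analyticAt_const.add ((analyticAt_const.mul h2).mul analyticAt_const)) rfl
  exact h1.sub (((h1.mul analyticAt_const).mul h3).mul (analyticAt_const.mul h1))

/-! ### The identity theorem and the geometry of the logarithmic region -/

/-- The order of F - G is infinite at one point, hence at every point of a preconnected set. The set
need not be open, which suits the closed region Ω_δ; punctured neighbourhoods are needed because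
values at poles are arbitrary. -/
lemma eventuallyEq_of_meromorphicOn {E : Type*} [NormedAddCommGroup E]
    [NormedSpace ℂ E] {F G : ℂ → E} {U : Set ℂ} (hU : IsPreconnected U)
    (hF : MeromorphicOn F U) (hG : ∀ z ∈ U, AnalyticAt ℂ G z) {z₀ : ℂ} (h₀ : z₀ ∈ U)
    (h : F =ᶠ[𝓝[≠] z₀] G) {z : ℂ} (hz : z ∈ U) : F =ᶠ[𝓝[≠] z] G := by
  have hm : MeromorphicOn (F - G) U := fun z hz => (hF z hz).sub (hG z hz).meromorphicAt
  have h1 : meromorphicOrderAt (F - G) z₀ = ⊤ := by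
    rw [meromorphicOrderAt_eq_top_iff]
    filter_upwards [h] with w hw
    simp [hw]
  have h2 : meromorphicOrderAt (F - G) z = ⊤ := by
    by_contra h3
    exact hm.meromorphicOrderAt_ne_top_of_isPreconnected hU hz h₀ h3 h1
  rw [meromorphicOrderAt_eq_top_iff] at h2
  filter_upwards [h2] with w hw
  exact sub_eq_zero.1 hw

lemma eventually_add_mul_log_lt (A : ℝ) {δ : ℝ} (hδ : 0 < δ) :
    ∀ᶠ t : ℝ in atTop, A + δ * Real.log (1 + t) < t / 2 := by
  -- With 1/(4δ) the logarithmic term is at most (1 + t)/4, leaving t/4 to dominate A.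
  have h1 := (Real.isLittleO_log_id_atTop.def (c := 1 / (4 * δ)) (by positivity))
  have h2 : Tendsto (fun t : ℝ => 1 + t) atTop atTop := tendsto_atTop_add_const_left _ _ tendsto_id
  filter_upwards [h2.eventually h1, eventually_gt_atTop 0, eventually_gt_atTop (4 * A + 1)]
    with t h3 h4 h5
  simp only [id, Real.norm_eq_abs] at h3
  rw [abs_of_pos (by linarith : (0 : ℝ) < 1 + t)] at h3
  have h6 : δ * Real.log (1 + t) ≤ δ * (1 / (4 * δ) * (1 + t)) :=
    mul_le_mul_of_nonneg_left ((le_abs_self _).trans h3) hδ.le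
  have h7 : δ * (1 / (4 * δ) * (1 + t)) = (1 + t) / 4 := by field_simp
  linarith

/-- In the region Re λ + Im λ > 0: otherwise both parts would be below |λ|/2 in modulus. Hence |λ|
increases in the direction 1 + i, and all the defining inequalities persist. -/
lemma mem_logRegion_add {A δ C₀ : ℝ} (hδ : 0 < δ)
    (hC : ∀ t, C₀ ≤ t → A + δ * Real.log (1 + t) < t / 2) {lam : ℂ} (h : lam ∈ logRegion A δ C₀)
    {τ : ℝ} (hτ : 0 ≤ τ) : lam + τ * (1 + Complex.I) ∈ logRegion A δ C₀ := by
  obtain ⟨h1, h2, h3⟩ := h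
  have h4 := hC _ h3
  set L := A + δ * Real.log (1 + ‖lam‖) with hL
  have h5 : lam.re ^ 2 + lam.im ^ 2 = ‖lam‖ ^ 2 := by
    rw [Complex.sq_norm, Complex.normSq_apply]; ring
  have h6 : 0 < lam.re + lam.im := by
    by_contra h7
    push Not at h7
    have hn := norm_nonneg lam
    have h8 : lam.re ^ 2 ≤ (‖lam‖ / 2) ^ 2 :=
      sq_le_sq' (by linarith) (by linarith)
    have h9 : lam.im ^ 2 ≤ (‖lam‖ / 2) ^ 2 :=
      sq_le_sq' (by linarith) (by linarith)
    have h10 : 0 < ‖lam‖ := by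
      rcases hn.eq_or_lt with h | h
      · exfalso
        linarith
      · exact h
    nlinarith
  have e1 : (lam + τ * (1 + Complex.I)).re = lam.re + τ := by simp
  have e2 : (lam + τ * (1 + Complex.I)).im = lam.im + τ := by simp
  have h7 : ‖lam‖ ≤ ‖lam + τ * (1 + Complex.I)‖ := by
    refine le_of_sq_le_sq ?_ (norm_nonneg _)
    rw [Complex.sq_norm (lam + _), Complex.normSq_apply, e1, e2, ← h5]
    nlinarith [mul_nonneg hτ h6.le]
  have h8 : δ * Real.log (1 + ‖lam‖) ≤ δ * Real.log (1 + ‖lam + τ * (1 + Complex.I)‖) := by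
    gcongr
  refine ⟨?_, ?_, h3.trans h7⟩ <;> simp only [e1, e2] <;> linarith

lemma mem_logRegion_of_le {A δ C₀ : ℝ} (hA : 0 < A) (hδ : 0 < δ) (h0 : 0 < C₀) {lam : ℂ}
    (h1 : C₀ ≤ lam.re) (h2 : C₀ ≤ lam.im) : lam ∈ logRegion A δ C₀ := by
  have h3 : 0 ≤ δ * Real.log (1 + ‖lam‖) :=
    mul_nonneg hδ.le (Real.log_nonneg (by linarith [norm_nonneg lam]))
  exact ⟨by linarith, by linarith, h1.trans (Complex.re_le_norm lam)⟩

/-- Every point travels inside the region along 1 + i until it enters the convex quadrant Re, Im ≥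
C₀. -/
lemma isPreconnected_logRegion {A δ C₀ : ℝ} (hA : 0 < A) (hδ : 0 < δ) (h0 : 0 < C₀)
    (hC : ∀ t, C₀ ≤ t → A + δ * Real.log (1 + t) < t / 2) :
    IsPreconnected (logRegion A δ C₀) := by
  set Q : Set ℂ := {z | C₀ ≤ z.re} ∩ {z | C₀ ≤ z.im} with hQ
  have hQc : Convex ℝ Q := (convex_halfSpace_re_ge C₀).inter (convex_halfSpace_im_ge C₀)
  refine isPreconnected_of_forall (C₀ * (1 + Complex.I)) fun lam h => ?_
  set f : ℝ → ℂ := fun τ => lam + τ * (1 + Complex.I) with hf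
  have hfc : Continuous f := by fun_prop
  set τ₀ : ℝ := C₀ + ‖lam‖ with hτ
  have hn := norm_nonneg lam
  have h2 : IsPreconnected (f '' Set.Icc 0 τ₀) := isPreconnected_Icc.image _ hfc.continuousOn
  have h3 : f τ₀ ∈ Q := by
    have h4 := (abs_le.1 (Complex.abs_re_le_norm lam)).1
    have h5 := (abs_le.1 (Complex.abs_im_le_norm lam)).1
    constructor <;> simp [hf, hτ] <;> linarith
  refine ⟨f '' Set.Icc 0 τ₀ ∪ Q, ?_, Or.inr ?_, Or.inl ?_, ?_⟩
  · rintro _ (⟨τ, h4, rfl⟩ | h4)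
    · exact mem_logRegion_add hδ hC h h4.1
    · exact mem_logRegion_of_le hA hδ h0 h4.1 h4.2
  · constructor <;> simp
  · exact ⟨0, ⟨le_rfl, by positivity⟩, by simp [hf]⟩
  · exact h2.union (f τ₀) ⟨τ₀, ⟨by positivity, le_rfl⟩, rfl⟩ h3 hQc.isPreconnected

/-- Here the restriction on δ acts: bδ ≤ 1 turns e^{bδ log(1+|λ|)} into at most 1 + |λ|, one power
less than the decay |λ|^{-2} of the cut operator. -/
lemma expWeight_le_of_mem_logRegion {A δ C₀ b : ℝ} (hδ : 0 < δ) (hA : 0 < A) (hb : 0 < b)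
    (hbδ : δ * b ≤ 1) {lam : ℂ} (h : lam ∈ logRegion A δ C₀) :
    expWeight b lam ≤ 2 * Real.exp (b * A) * (1 + ‖lam‖) := by
  obtain ⟨h1, h2, -⟩ := h
  have hl : 0 ≤ Real.log (1 + ‖lam‖) := Real.log_nonneg (by linarith [norm_nonneg lam])
  have hn : 0 < 1 + ‖lam‖ := by linarith [norm_nonneg lam]
  have key : ∀ x : ℝ, -A - δ * Real.log (1 + ‖lam‖) ≤ x →
      Real.exp (b * max (-x) 0) ≤ Real.exp (b * A) * (1 + ‖lam‖) := fun x hx => by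
    have h3 : max (-x) 0 ≤ A + δ * Real.log (1 + ‖lam‖) :=
      max_le (by linarith) (by positivity)
    calc Real.exp (b * max (-x) 0)
        ≤ Real.exp (b * A + Real.log (1 + ‖lam‖)) := by
          refine Real.exp_le_exp.2 ?_
          have := mul_le_mul_of_nonneg_left h3 hb.le
          nlinarith
      _ = _ := by rw [Real.exp_add, Real.exp_log hn]
  have := key _ h1
  have := key _ h2
  rw [expWeight]
  linarith

lemma eventually_expWeight_le {A δ b : ℝ} (hδ : 0 < δ) (hA : 0 < A) (hb : 0 < b) (hbδ : δ * b ≤ 1)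
    {C : ℝ} (hC : 0 < C) : ∀ᶠ C₀ : ℝ in atTop, ∀ lam ∈ logRegion A δ C₀,
      C * (1 / ‖lam‖ ^ 2 * expWeight b lam) ≤ 1 / 2 := by
  filter_upwards [eventually_ge_atTop 1, eventually_ge_atTop (8 * C * Real.exp (b * A))]
    with C₀ h1 h2 lam h
  have h3 := expWeight_le_of_mem_logRegion hδ hA hb hbδ h
  have h4 : C₀ ≤ ‖lam‖ := h.2.2
  have h5 : 0 < ‖lam‖ := by linarith
  rw [one_div_mul_eq_div, mul_div_assoc', div_le_iff₀ (by positivity)]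
  calc C * expWeight b lam ≤ C * (2 * Real.exp (b * A) * (1 + ‖lam‖)) := by gcongr
    _ ≤ C * (2 * Real.exp (b * A) * (‖lam‖ + ‖lam‖)) := by gcongr; linarith
    _ = 1 / 2 * (8 * C * Real.exp (b * A) * ‖lam‖) := by ring
    _ ≤ 1 / 2 * (‖lam‖ * ‖lam‖) := by gcongr; linarith
    _ = _ := by ring

/-! ### Weak derivatives and Sobolev norms -/

/-- `v` is the weak partial derivative `∂ᵢ u` on `ℝ³`. -/
def HasPartial (i : Fin 3) (u v : L2) : Prop :=
  ∂_{(EuclideanSpace.single i (1 : ℝ) : E3)} (u : 𝓢'(E3, ℂ)) = (v : 𝓢'(E3, ℂ))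

lemma hasPartial_iff {i : Fin 3} {u v : L2} : HasPartial i u v ↔ ∀ φ : 𝓢(E3, ℂ),
    ∫ x, (∂_{(EuclideanSpace.single i (1 : ℝ) : E3)} φ) x * u x = -∫ x, φ x * v x := by
  have key : ∀ φ : 𝓢(E3, ℂ),
      (∂_{(EuclideanSpace.single i (1 : ℝ) : E3)} (u : 𝓢'(E3, ℂ))) φ =
        -∫ x, (∂_{(EuclideanSpace.single i (1 : ℝ) : E3)} φ) x * u x := fun φ => by
    rw [TemperedDistribution.lineDerivOp_apply_apply, map_neg, Lp.toTemperedDistribution_apply]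
    rfl
  constructor
  · intro h φ
    have h1 := congrArg (fun T : 𝓢'(E3, ℂ) => T φ) h
    simp only [key, Lp.toTemperedDistribution_apply, smul_eq_mul] at h1
    rw [← h1, neg_neg]
  · intro h
    ext φ
    rw [key, h, neg_neg, Lp.toTemperedDistribution_apply]
    rfl

lemma HasPartial.add {i : Fin 3} {u v u' v' : L2} (h : HasPartial i u v)
    (h' : HasPartial i u' v') : HasPartial i (u + u') (v + v') := by
  rw [HasPartial, coe_add_L2, coe_add_L2, lineDerivOp_add, h, h']

/-- Multiplication by a Schwartz function on `L²(ℝ³)`. -/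
def schwartzMul (ψ : 𝓢(E3, ℂ)) : L2 →L[ℂ] L2 := mulOp (ψ.toLp ∞)

lemma coeFn_schwartzMul (ψ : 𝓢(E3, ℂ)) (u : L2) :
    schwartzMul ψ u =ᵐ[volume] fun x => ψ x * u x := by
  filter_upwards [coeFn_mulOp (ψ.toLp ∞) u, ψ.coeFn_toLp ∞] with x h1 h2
  rw [schwartzMul, h1, h2]

lemma integrable_schwartz_mul (φ : 𝓢(E3, ℂ)) (u : L2) : Integrable fun x => φ x * u x :=
  (φ.memLp 2).integrable_mul (Lp.memLp u)

/-- The product rule is shifted to the test function: ψ ∂φ = ∂(ψφ) - (∂ψ)φ. -/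
lemma HasPartial.schwartzMul {i : Fin 3} {u v : L2} (h : HasPartial i u v) (ψ : 𝓢(E3, ℂ)) :
    HasPartial i (schwartzMul ψ u) (schwartzMul ψ v +
      Biharmonic.schwartzMul (∂_{(EuclideanSpace.single i (1 : ℝ) : E3)} ψ) u) := by
  rw [hasPartial_iff] at h ⊢
  intro φ
  set e : E3 := EuclideanSpace.single i 1
  have ht : Function.HasTemperateGrowth (ψ : E3 → ℂ) := ψ.hasTemperateGrowth
  set ψ' : 𝓢(E3, ℂ) := ∂_{e} ψ with hψ'
  have ht' : Function.HasTemperateGrowth (ψ' : E3 → ℂ) := ψ'.hasTemperateGrowth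
  set ψφ := SchwartzMap.smulLeftCLM ℂ ψ φ with hψφ
  set ψ'φ := SchwartzMap.smulLeftCLM ℂ ψ' φ with hψ'φ
  have e1 : ∀ x, ψφ x = ψ x * φ x := fun x => SchwartzMap.smulLeftCLM_apply_apply ht φ x
  have e2 : ∀ x, ψ'φ x = ψ' x * φ x := fun x => SchwartzMap.smulLeftCLM_apply_apply ht' φ x
  have e3 : ∀ x, (∂_{e} ψφ) x = ψ x * (∂_{e} φ) x + ψ' x * φ x := fun x => by
    have : (ψφ : E3 → ℂ) = fun x => ψ x * φ x := funext e1
    rw [hψ', SchwartzMap.lineDerivOp_apply_eq_fderiv, SchwartzMap.lineDerivOp_apply_eq_fderiv,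
      SchwartzMap.lineDerivOp_apply_eq_fderiv, this,
      fderiv_fun_mul ψ.differentiableAt φ.differentiableAt]
    simp only [add_apply, smul_apply, smul_eq_mul]
    ring
  have h1 : ∫ x, (∂_{e} φ) x * (Biharmonic.schwartzMul ψ u) x =
      ∫ x, ((∂_{e} ψφ) x * u x - ψ'φ x * u x) := by
    refine integral_congr_ae ?_
    filter_upwards [coeFn_schwartzMul ψ u] with x hx
    rw [hx, e3, e2]; ring
  have h2 : ∫ x, φ x * (Biharmonic.schwartzMul ψ v + Biharmonic.schwartzMul ψ' u : L2) x =
      ∫ x, (ψφ x * v x + ψ'φ x * u x) := by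
    refine integral_congr_ae ?_
    filter_upwards [coeFn_schwartzMul ψ v, coeFn_schwartzMul ψ' u,
      Lp.coeFn_add (Biharmonic.schwartzMul ψ v) (Biharmonic.schwartzMul ψ' u)]
      with x hx hx' hx''
    rw [hx'', Pi.add_apply, hx, hx', e1, e2]; ring
  rw [h1, h2, integral_sub (integrable_schwartz_mul _ _) (integrable_schwartz_mul _ _), h,
    integral_add (integrable_schwartz_mul _ _) (integrable_schwartz_mul _ _)]
  ring

lemma hasPartial_fourierMul {i : Fin 3} {σ τ : E3 → ℂ} (hσ : MemLp σ ∞ volume)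
    (hτ : MemLp τ ∞ volume) (h : ∀ ξ, τ ξ = 2 * Real.pi * Complex.I * (ξ i : ℝ) * σ ξ) (g : L2) :
    HasPartial i (fourierMul σ g) (fourierMul τ g) := by
  rw [HasPartial]
  refine (fourierEquiv ℂ 𝓢'(E3, ℂ)).injective ?_
  rw [fourierEquiv_apply, fourierEquiv_apply]
  set e : E3 := EuclideanSpace.single i 1 with he
  have ht : (fun ξ : E3 => ((inner ℝ ξ e : ℝ) : ℂ)).HasTemperateGrowth := by fun_prop
  have h1 : TemperedDistribution.smulLeftCLM ℂ (fun ξ : E3 => ((inner ℝ ξ e : ℝ) : ℂ))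
      ((𝓕 (fourierMul σ g) : L2) : 𝓢'(E3, ℂ)) =
        (((2 * Real.pi * Complex.I)⁻¹ • 𝓕 (fourierMul τ g) : L2) : 𝓢'(E3, ℂ)) := by
    rw [smulLeftCLM_coe_eq_iff ht, fourier_fourierMul, fourier_fourierMul]
    filter_upwards [coeFn_bddMul hσ (𝓕 g), coeFn_bddMul hτ (𝓕 g),
      Lp.coeFn_smul (2 * Real.pi * Complex.I : ℂ)⁻¹ (bddMul τ (𝓕 g))] with ξ a b c
    have e1 : inner ℝ ξ e = ξ i := by
      rw [he, EuclideanSpace.inner_single_right]; simp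
    have e2 : (2 * Real.pi * Complex.I : ℂ) ≠ 0 := Complex.two_pi_I_ne_zero
    rw [c, Pi.smul_apply, a, b, h, e1, smul_eq_mul]
    field_simp
  have h2 : (((2 * Real.pi * Complex.I)⁻¹ • 𝓕 (fourierMul τ g) : L2) : 𝓢'(E3, ℂ)) =
      (2 * Real.pi * Complex.I : ℂ)⁻¹ • ((𝓕 (fourierMul τ g) : L2) : 𝓢'(E3, ℂ)) :=
    map_smul (Lp.toTemperedDistributionCLM ℂ (volume : Measure E3) 2) _ _
  rw [TemperedDistribution.fourier_lineDerivOp_eq, Lp.fourier_toTemperedDistribution_eq,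
    Lp.fourier_toTemperedDistribution_eq, h1, h2, smul_smul,
    mul_inv_cancel₀ Complex.two_pi_I_ne_zero, one_smul]

/-- `u` has weak derivatives on `ℝ³` up to the order `n`, those of order `m` having `L²` norm at
most `M μ ^ m`. -/
def DerivBound (μ : ℝ) : ℕ → ℝ → L2 → Prop
  | 0, M, u => ‖u‖ ≤ M
  | n + 1, M, u => ‖u‖ ≤ M ∧ ∀ i, ∃ v, HasPartial i u v ∧ DerivBound μ n (μ * M) v

lemma DerivBound.norm_le {μ : ℝ} {n : ℕ} {M : ℝ} {u : L2} (h : DerivBound μ n M u) : ‖u‖ ≤ M := by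
  cases n with
  | zero => exact h
  | succ n => exact h.1

lemma DerivBound.mono {μ : ℝ} (hμ : 0 ≤ μ) {n : ℕ} {M M' : ℝ} {u : L2} (h : DerivBound μ n M u)
    (hM : M ≤ M') : DerivBound μ n M' u := by
  induction n generalizing M M' u with
  | zero => exact h.norm_le.trans hM
  | succ n ih =>
    refine ⟨h.1.trans hM, fun i => ?_⟩
    obtain ⟨v, hv, hv'⟩ := h.2 i
    exact ⟨v, hv, ih hv' (mul_le_mul_of_nonneg_left hM hμ)⟩

lemma DerivBound.of_succ {μ : ℝ} {n : ℕ} {M : ℝ} {u : L2} (h : DerivBound μ (n + 1) M u) :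
    DerivBound μ n M u := by
  induction n generalizing M u with
  | zero => exact h.norm_le
  | succ n ih =>
    refine ⟨h.1, fun i => ?_⟩
    obtain ⟨v, hv, hv'⟩ := h.2 i
    exact ⟨v, hv, ih hv'⟩

lemma DerivBound.of_le {μ : ℝ} {n n' : ℕ} {M : ℝ} {u : L2} (h : DerivBound μ n' M u)
    (hn : n ≤ n') : DerivBound μ n M u := by
  induction n', hn using Nat.le_induction with
  | base => exact h
  | succ k _ ih => exact ih h.of_succ

lemma DerivBound.add {μ : ℝ} {n : ℕ} {M M' : ℝ} {u u' : L2} (h : DerivBound μ n M u)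
    (h' : DerivBound μ n M' u') : DerivBound μ n (M + M') (u + u') := by
  induction n generalizing M M' u u' with
  | zero => exact (norm_add_le _ _).trans (add_le_add h.norm_le h'.norm_le)
  | succ n ih =>
    refine ⟨(norm_add_le _ _).trans (add_le_add h.norm_le h'.norm_le), fun i => ?_⟩
    obtain ⟨v, hv, hv'⟩ := h.2 i
    obtain ⟨w, hw, hw'⟩ := h'.2 i
    exact ⟨v + w, hv.add hw, by rw [mul_add]; exact ih hv' hw'⟩

/-- The Leibniz rule. -/
lemma exists_derivBound_schwartzMul (n : ℕ) (ψ : 𝓢(E3, ℂ)) : ∃ C : ℝ, 0 ≤ C ∧ ∀ (μ M : ℝ) (u : L2),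
    1 ≤ μ → DerivBound μ n M u → DerivBound μ n (C * M) (schwartzMul ψ u) := by
  induction n generalizing ψ with
  | zero => exact ⟨‖schwartzMul ψ‖, norm_nonneg _, fun μ M u _ h =>
      ((schwartzMul ψ).le_opNorm u).trans (mul_le_mul_of_nonneg_left h (norm_nonneg _))⟩
  | succ n ih =>
    choose D hD0 hD using fun i : Fin 3 => ih (∂_{(EuclideanSpace.single i (1 : ℝ) : E3)} ψ)
    obtain ⟨C, hC0, hC⟩ := ih ψ
    have hS : ∀ i, D i ≤ ∑ i, D i := fun i =>
      Finset.single_le_sum (fun i _ => hD0 i) (Finset.mem_univ i)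
    have hS0 : 0 ≤ ∑ i, D i := Finset.sum_nonneg fun i _ => hD0 i
    refine ⟨‖schwartzMul ψ‖ + C + ∑ i, D i, by positivity, fun μ M u hμ h => ⟨?_, fun i => ?_⟩⟩
    · have hM : 0 ≤ M := (norm_nonneg _).trans h.norm_le
      refine ((schwartzMul ψ).le_opNorm u).trans ?_
      refine mul_le_mul ?_ h.norm_le (norm_nonneg _) (by positivity)
      linarith
    · have hM : 0 ≤ M := (norm_nonneg _).trans h.norm_le
      obtain ⟨v, hv, hv'⟩ := h.2 i
      refine ⟨_, hv.schwartzMul ψ, ?_⟩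
      refine ((hC μ _ v hμ hv').add (hD i μ _ u hμ h.of_succ)).mono (by linarith) ?_
      -- A derivative falling on ψ brings no factor μ; the missing one is supplied by μ ≥ 1.
      have h1 : D i * M ≤ (∑ i, D i) * (μ * M) :=
        mul_le_mul (hS i) (le_mul_of_one_le_left hM hμ) hM hS0
      have h2 : 0 ≤ ‖schwartzMul ψ‖ * (μ * M) := by positivity
      linarith

/-- A derivative multiplies the symbol by 2πiξ_i, so a weighted bound of order m + 1 with constant B
becomes one of order m with constant μB, in step with the recursion of `DerivBound`. -/
lemma derivBound_fourierMul {μ : ℝ} (hμ : 0 ≤ μ) {n : ℕ} {B : ℝ} (hB : 0 ≤ B) {σ : E3 → ℂ}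
    (hσm : AEStronglyMeasurable σ volume)
    (hσ : ∀ ξ ≠ 0, ∀ m ≤ n, (2 * Real.pi * ‖ξ‖) ^ m * ‖σ ξ‖ ≤ B * μ ^ m) (g : L2) :
    DerivBound μ n (B * ‖g‖) (fourierMul σ g) := by
  have hae : ∀ᵐ ξ : E3, ξ ≠ 0 := by simp [ae_iff]
  have hbd : ∀ {σ : E3 → ℂ} {n : ℕ} {B : ℝ},
      (∀ ξ ≠ 0, ∀ m ≤ n, (2 * Real.pi * ‖ξ‖) ^ m * ‖σ ξ‖ ≤ B * μ ^ m) → ∀ᵐ ξ, ‖σ ξ‖ ≤ B :=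
    fun h => by filter_upwards [hae] with ξ hξ; simpa using h ξ hξ 0 (Nat.zero_le _)
  have hno : ‖fourierMul σ g‖ ≤ B * ‖g‖ := (ContinuousLinearMap.le_opNorm _ _).trans
      (mul_le_mul_of_nonneg_right (norm_fourierMul_le (hbd hσ) hB) (norm_nonneg _))
  induction n generalizing B σ with
  | zero => exact hno
  | succ n ih =>
    refine ⟨hno, fun i => ?_⟩
    set τ : E3 → ℂ := fun ξ => 2 * Real.pi * Complex.I * (ξ i : ℝ) * σ ξ with hτ
    have hτm : AEStronglyMeasurable τ volume :=
      (Continuous.aestronglyMeasurable (by fun_prop)).mul hσm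
    have hτb : ∀ ξ ≠ 0, ∀ m ≤ n, (2 * Real.pi * ‖ξ‖) ^ m * ‖τ ξ‖ ≤ (μ * B) * μ ^ m :=
      fun ξ hξ m hm => by
      have h1 : ‖τ ξ‖ ≤ 2 * Real.pi * ‖ξ‖ * ‖σ ξ‖ := by
        have h2 : |ξ i| ≤ ‖ξ‖ := by simpa using PiLp.norm_apply_le ξ i
        simp only [hτ, norm_mul, Complex.norm_I, Complex.norm_real, Real.norm_eq_abs,
          Complex.norm_ofNat, abs_of_pos Real.pi_pos, mul_one]
        gcongr
      calc (2 * Real.pi * ‖ξ‖) ^ m * ‖τ ξ‖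
          ≤ (2 * Real.pi * ‖ξ‖) ^ m * (2 * Real.pi * ‖ξ‖ * ‖σ ξ‖) := by gcongr
        _ = (2 * Real.pi * ‖ξ‖) ^ (m + 1) * ‖σ ξ‖ := by ring
        _ ≤ B * μ ^ (m + 1) := hσ ξ hξ (m + 1) (by omega)
        _ = _ := by ring
    have hμB : 0 ≤ μ * B := by positivity
    refine ⟨fourierMul τ g, hasPartial_fourierMul (memLp_top_of_bound hσm B (hbd hσ))
      (memLp_top_of_bound hτm (μ * B) (hbd hτb)) (fun ξ => rfl) g, ?_⟩
    rw [← mul_assoc]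
    exact ih hμB hτm hτb ((ContinuousLinearMap.le_opNorm _ _).trans
      (mul_le_mul_of_nonneg_right (norm_fourierMul_le (hbd hτb) hμB) (norm_nonneg _)))

lemma DerivBound.exists_iterated {μ : ℝ} {n : ℕ} {M : ℝ} {u : L2} (h : DerivBound μ n M u)
    {m : ℕ} (hm : m ≤ n) (I : Fin m → Fin 3) : ∃ v : L2, ‖v‖ ≤ μ ^ m * M ∧ ∀ φ : 𝓢(E3, ℂ),
      ∫ x, (∂^{fun k => (EuclideanSpace.single (I k) (1 : ℝ) : E3)} φ) x * u x =
        (-1) ^ m * ∫ x, φ x * v x := by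
  induction m generalizing n M u with
  | zero => exact ⟨u, by simpa using h.norm_le, fun φ => by simp⟩
  | succ m ih =>
    obtain ⟨n, rfl⟩ : ∃ k, n = k + 1 := ⟨n - 1, by omega⟩
    obtain ⟨v, hv, hv'⟩ := h.2 (I 0)
    obtain ⟨w, hw, hw'⟩ := ih hv' (by omega) (fun k => I k.succ)
    refine ⟨w, hw.trans (le_of_eq (by ring)), fun φ => ?_⟩
    rw [iteratedLineDerivOp_succ_left, hasPartial_iff.1 hv]
    have := hw' φ
    rw [pow_succ, mul_neg_one, neg_mul, ← this]
    rfl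

/-- Weak derivatives in `L²(U)` are unique. -/
lemma HasWeakDeriv.ae_eq {U : Opens E3} {m : ℕ} {I : Fin m → Fin 3} {u v w : E3 → ℂ}
    (hv : MemLp v 2 (volume.restrict (U : Set E3))) (hw : MemLp w 2 (volume.restrict (U : Set E3)))
    (h : HasWeakDeriv U I u v) (h' : HasWeakDeriv U I u w) :
    v =ᵐ[volume.restrict (U : Set E3)] w := by
  have hloc : ∀ v : E3 → ℂ, MemLp v 2 (volume.restrict (U : Set E3)) →
      LocallyIntegrableOn v (U : Set E3) := fun v hv =>
    locallyIntegrableOn_of_locallyIntegrable_restrict (hv.locallyIntegrable (by norm_num))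
  have hlvw := (hloc v hv).sub (hloc w hw)
  have key := U.isOpen.ae_eq_zero_of_integral_contDiff_smul_eq_zero hlvw fun g hg hgc hgU => by
    have hg₁ : HasCompactSupport (Complex.ofRealCLM ∘ g) := hgc.comp_left rfl
    have hg₂ : ContDiff ℝ (⊤ : ℕ∞) (Complex.ofRealCLM ∘ g) := by fun_prop
    have hg₃ : tsupport (Complex.ofRealCLM ∘ g) ⊆ U :=
      (closure_mono (Function.support_comp_subset (map_zero _) g)).trans hgU
    let φ : 𝓓(U, ℂ) := ⟨Complex.ofRealCLM ∘ g, hg₂, hg₁, hg₃⟩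
    have hφ : ∀ x, φ x = g x := fun x => rfl
    have h1 : ∫ x in (U : Set E3), v x * φ x = ∫ x in (U : Set E3), w x * φ x := by
      have h2 := (h φ).symm.trans (h' φ)
      exact mul_left_cancel₀ (pow_ne_zero m (by norm_num)) h2
    have hφ2 : MemLp (φ : E3 → ℂ) 2 (volume.restrict (U : Set E3)) :=
      (φ.continuous.memLp_of_hasCompactSupport φ.hasCompactSupport).restrict _
    have i1 : Integrable (fun x => v x * φ x) (volume.restrict (U : Set E3)) :=
      hv.integrable_mul hφ2
    have i2 : Integrable (fun x => w x * φ x) (volume.restrict (U : Set E3)) :=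
      hw.integrable_mul hφ2
    have h3 : ∫ x, g x • (v - w) x = ∫ x in (U : Set E3), g x • (v - w) x := by
      refine (setIntegral_eq_integral_of_forall_compl_eq_zero fun x hx => ?_).symm
      rw [image_eq_zero_of_notMem_tsupport fun h => hx (hgU h), zero_smul]
    rw [h3]
    have h4 : ∫ x in (U : Set E3), g x • (v - w) x =
        ∫ x in (U : Set E3), (v x * φ x - w x * φ x) := by
      refine integral_congr_ae (ae_of_all _ fun x => ?_)
      simp only [hφ, Pi.sub_apply, Complex.real_smul]
      ring
    rw [h4, integral_sub i1 i2, h1, sub_self]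
  rw [Filter.EventuallyEq, ae_restrict_iff' U.isOpen.measurableSet]
  filter_upwards [key] with x hx hxU
  exact sub_eq_zero.1 (hx hxU)

/-- Test functions on `U` extend by zero to Schwartz functions, so weak derivatives on ℝ³ restrict
to `U`. -/
lemma DerivBound.exists_hasWeakDeriv {μ : ℝ} {n : ℕ} {M : ℝ} {u : L2} (h : DerivBound μ n M u)
    {m : ℕ} (hm : m ≤ n) (I : Fin m → Fin 3) (U : Opens E3) :
    ∃ v : L2, ‖v‖ ≤ μ ^ m * M ∧ HasWeakDeriv U I u v := by
  obtain ⟨v, hv, hv'⟩ := h.exists_iterated hm I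
  refine ⟨v, hv, fun φ => ?_⟩
  have h1 := hv' (φ.hasCompactSupport.toSchwartzMap φ.contDiff)
  have e1 : ∫ x in (U : Set E3), u x *
      iteratedFDeriv ℝ m φ x (fun k => EuclideanSpace.single (I k) 1) =
      ∫ x, u x * iteratedFDeriv ℝ m φ x (fun k => EuclideanSpace.single (I k) 1) := by
    refine setIntegral_eq_integral_of_forall_compl_eq_zero fun x hx => ?_
    have h2 : iteratedFDeriv ℝ m φ x = 0 := by
      by_contra h3
      exact hx (φ.tsupport_subset (support_iteratedFDeriv_subset m h3))
    rw [h2, zero_apply, mul_zero]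
  have e2 : ∫ x in (U : Set E3), v x * φ x = ∫ x, v x * φ x := by
    refine setIntegral_eq_integral_of_forall_compl_eq_zero fun x hx => ?_
    rw [image_eq_zero_of_notMem_tsupport fun h => hx (φ.tsupport_subset h), mul_zero]
  rw [e1, e2]
  simp only [SchwartzMap.iteratedLineDerivOp_eq_iteratedFDeriv] at h1
  refine Eq.trans ?_ (h1.trans ?_)
  · exact integral_congr_ae (ae_of_all _ fun x => mul_comm _ _)
  · exact congrArg _ (integral_congr_ae (ae_of_all _ fun x => mul_comm _ _))

/-- The chosen weak derivative is almost everywhere equal to any other one in L²(U), by uniqueness.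
-/
lemma eLpNorm_weakDeriv_le {U : Opens E3} {m : ℕ} {I : Fin m → Fin 3} {u : E3 → ℂ} {v : L2}
    (h : HasWeakDeriv U I u v) :
    eLpNorm (weakDeriv U I u) 2 (volume.restrict (U : Set E3)) ≤ ENNReal.ofReal ‖v‖ := by
  have hv : MemLp v 2 (volume.restrict (U : Set E3)) := (Lp.memLp v).restrict _
  have hex : ∃ v : E3 → ℂ, MemLp v 2 (volume.restrict (U : Set E3)) ∧ HasWeakDeriv U I u v :=
    ⟨v, hv, h⟩
  rw [weakDeriv, dif_pos hex, eLpNorm_congr_ae (hex.choose_spec.2.ae_eq hex.choose_spec.1 hv h)]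
  refine (eLpNorm_mono_measure _ Measure.restrict_le_self).trans ?_
  rw [Lp.norm_def, ENNReal.ofReal_toReal (Lp.eLpNorm_ne_top v)]

/-- There are at most 1 + 3 + 9 + 27 + 81 = 11² multi-indices, and μ ≥ 1 makes the top order
dominate. -/
lemma DerivBound.normH_le {μ : ℝ} (hμ : 1 ≤ μ) {n : ℕ} {M : ℝ} {u : L2} (h : DerivBound μ n M u)
    (hn : n ≤ 4) (U : Opens E3) : normH U n u ≤ ENNReal.ofReal (11 * (μ ^ n * M)) := by
  have hM : 0 ≤ M := (norm_nonneg _).trans h.norm_le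
  have hmem : MemH U n u := by
    refine ⟨(Lp.memLp u).restrict _, fun m hm I => ?_⟩
    obtain ⟨v, -, hv⟩ := h.exists_hasWeakDeriv hm I U
    exact ⟨v, (Lp.memLp v).restrict _, hv⟩
  set N := ENNReal.ofReal (μ ^ n * M) with hN
  have key : ∀ m ≤ n, ∀ I : Fin m → Fin 3,
      eLpNorm (weakDeriv U I u) 2 (volume.restrict (U : Set E3)) ^ 2 ≤ N ^ 2 := fun m hm I => by
    obtain ⟨v, hv, hv'⟩ := h.exists_hasWeakDeriv hm I U
    gcongr
    refine (eLpNorm_weakDeriv_le hv').trans (ENNReal.ofReal_le_ofReal (hv.trans ?_))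
    gcongr
  rw [normH, if_pos hmem]
  have hsum : ∑ m ∈ Finset.range (n + 1), ∑ I : Fin m → Fin 3,
      eLpNorm (weakDeriv U I u) 2 (volume.restrict (U : Set E3)) ^ 2 ≤ (11 * N) ^ 2 := by
    calc _ ≤ ∑ m ∈ Finset.range (n + 1), ∑ I : Fin m → Fin 3, N ^ 2 :=
          Finset.sum_le_sum fun m hm => Finset.sum_le_sum fun I _ =>
            key m (by simpa [Nat.lt_succ_iff] using hm) I
      _ = (∑ m ∈ Finset.range (n + 1), (3 : ℝ≥0∞) ^ m) * N ^ 2 := by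
          rw [Finset.sum_mul]
          refine Finset.sum_congr rfl fun m _ => ?_
          simp
      _ ≤ (∑ m ∈ Finset.range (4 + 1), (3 : ℝ≥0∞) ^ m) * N ^ 2 := by
          gcongr
      _ = _ := by
          rw [mul_pow]
          congr 1
          simp only [Finset.sum_range_succ, Finset.sum_range_zero]
          norm_num
  calc _ ≤ ((11 * N) ^ 2) ^ (1 / 2 : ℝ) := by gcongr
    _ = 11 * N := by
      rw [← ENNReal.rpow_natCast, ← ENNReal.rpow_mul]
      norm_num
    _ = _ := by
      rw [ENNReal.ofReal_mul (by norm_num : (0 : ℝ) ≤ 11), hN]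
      norm_num

/-! ### Existence and uniqueness of the continuation -/

lemma IsResolventAt.unique {V : Linfty} {z : ℂ} {T T' : L2 →L[ℂ] L2} (h : IsResolventAt V z T)
    (h' : IsResolventAt V z T') : T = T' := by
  ext1 f
  exact h.2 _ f (h'.1 f)

/-- V and ρ both live in B_s, so V R₀ ρ sees the kernel only at distances below 2s ≤ a, where
cutting changes nothing. -/
lemma exists_isResolventAt {V : Linfty} {ρ : Cutoff} (hρV : ∀ᵐ x, ρ x * V x = V x) {s a b : ℝ}
    (hs : tsupport ρ ⊆ Metric.ball 0 s) (hsa : 2 * s ≤ a) (hab : a < b) {lam : ℂ}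
    (hlam : lam ∈ firstQuadrant) (hx : ‖mulOp V * cutOp a b lam * mulOp (cutoffLinfty ρ)‖ < 1) :
    IsResolventAt V (lam ^ 4) (perturb V (cutoffLinfty ρ) (cutOp a b lam) (freeRes lam)) :=
  isResolventAt_perturb (mulOp_mul_cutoff hρV) hlam
    (agreeUpTo_freeRes_cutOp (d := 2 * s) hab hsa hlam s s V (cutoffLinfty ρ) (by linarith)
      (suppIn_of_mul_eq hρV hs) (suppIn_cutoffLinfty hs)) hx

/-- The truncation of the approximate resolvent does not depend on the approximation. -/
lemma exists_truncated_approxRes {V : Linfty} {ρ : Cutoff} (hρV : ∀ᵐ x, ρ x * V x = V x)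
    (a b : ℝ) (χ : Cutoff) : ∃ N : ℕ,
      (∀ n ≥ N, ∀ lam, mulOp (cutoffLinfty χ) * approxRes V ρ a b n lam * mulOp (cutoffLinfty χ) =
        mulOp (cutoffLinfty χ) * approxRes V ρ a b N lam * mulOp (cutoffLinfty χ)) ∧
      ∀ lam ∈ firstQuadrant, mulOp (cutoffLinfty χ) *
          perturb V (cutoffLinfty ρ) (cutOp a b lam) (freeRes lam) * mulOp (cutoffLinfty χ) =
        mulOp (cutoffLinfty χ) * approxRes V ρ a b N lam * mulOp (cutoffLinfty χ) := by
  obtain ⟨s, hs⟩ := exists_tsupport_subset_ball ρ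
  obtain ⟨m, hm⟩ := exists_tsupport_subset_ball χ
  -- The index 2m + s dominates the reach of all three blocks and does not depend on λ, so a single
  -- analytic family represents the truncation.
  have h1 : (m : ℝ) + m ≤ ((2 * m + s : ℕ) : ℝ) := by
    push_cast; linarith [Nat.cast_nonneg (α := ℝ) s]
  have h2 : (m : ℝ) + s ≤ ((2 * m + s : ℕ) : ℝ) := by
    push_cast; linarith [Nat.cast_nonneg (α := ℝ) m]
  have h3 : (s : ℝ) + m ≤ ((2 * m + s : ℕ) : ℝ) := by linarith
  exact ⟨2 * m + s, fun n hn lam => approxRes_agree hρV hs a b (suppIn_cutoffLinfty hm)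
      (suppIn_cutoffLinfty hm) h1 h2 h3 hn lam, fun lam hlam => freeRes_agree_approxRes hρV hs a b
      (suppIn_cutoffLinfty hm) (suppIn_cutoffLinfty hm) h1 h2 h3 hlam⟩

lemma analyticAt_truncated_approxRes (V : Linfty) (ρ χ : Cutoff) {a b : ℝ} (hab : a < b)
    (hb : 0 ≤ b) (n : ℕ) {lam : ℂ} (h0 : lam ≠ 0)
    (hx : ‖mulOp V * cutOp a b lam * mulOp (cutoffLinfty ρ)‖ < 1) :
    AnalyticAt ℂ (fun lam => mulOp (cutoffLinfty χ) * approxRes V ρ a b n lam *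
      mulOp (cutoffLinfty χ)) lam :=
  (analyticAt_const.mul (analyticAt_approxRes V ρ hab hb n h0 hx)).mul analyticAt_const

/-- The perturbed resolvent continues analytically to the set where the perturbation is small. -/
theorem exists_isResolventFamily {V : Linfty} {ρ : Cutoff} (hρV : ∀ᵐ x, ρ x * V x = V x)
    {s a b : ℝ} (hs : tsupport ρ ⊆ Metric.ball 0 s) (hsa : 2 * s ≤ a) (hab : a < b) (hb : 0 ≤ b)
    {Ω : Set ℂ} (h0 : ∀ lam ∈ Ω, lam ≠ 0)
    (hx : ∀ lam ∈ Ω, ‖mulOp V * cutOp a b lam * mulOp (cutoffLinfty ρ)‖ < 1) :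
    ∃ RV, IsResolventFamily V Ω RV ∅ := by
  choose RV hRV using fun lam => (stabilizes_approxRes hρV a b lam).exists_localOp
  choose N hN hN' using exists_truncated_approxRes hρV a b
  refine ⟨RV, ⟨fun lam hlam T hT => ⟨notMem_empty _, fun f => ?_⟩, empty_subset _,
    fun _ _ => by simp, ?_⟩⟩
  · rw [hT.unique (exists_isResolventAt hρV hs hsa hab hlam.2 (hx lam hlam.1))]
    refine localOp_eq_of_eventually (hRV lam) (fun j m => ?_) f
    obtain ⟨t, ht⟩ := exists_tsupport_subset_ball ρ
    filter_upwards [eventually_ge_atTop (j + m + t)] with n hn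
    have hn' : (j : ℝ) + m + t ≤ n := by exact_mod_cast hn
    have := Nat.cast_nonneg (α := ℝ) j
    have := Nat.cast_nonneg (α := ℝ) m
    have := Nat.cast_nonneg (α := ℝ) t
    exact freeRes_agree_approxRes hρV ht a b (suppIn_ballInd j) (suppIn_ballInd m)
      (by linarith) (by linarith) (by linarith) hlam.2
  · refine ⟨fun χ lam => mulOp (cutoffLinfty χ) * approxRes V ρ a b (N χ) lam *
      mulOp (cutoffLinfty χ), fun χ lam hlam => ⟨?_, fun f => ?_⟩, by simp, by simp⟩
    · exact analyticAt_truncated_approxRes V ρ χ hab hb (N χ) (h0 lam hlam.1) (hx lam hlam.1)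
    · refine truncate_eq_of_eventually (hRV lam) ?_ f
      filter_upwards [eventually_ge_atTop (N χ)] with n hn using hN χ n hn lam

/-- A meromorphic continuation of the resolvent agrees with the analytic continuation to the set
where the perturbation is small, if this set is connected and meets the first quadrant. -/
theorem IsResolventFamily.eq_truncated_approxRes {V : Linfty} {ρ : Cutoff}
    (hρV : ∀ᵐ x, ρ x * V x = V x) {s a b : ℝ} (hs : tsupport ρ ⊆ Metric.ball 0 s)
    (hsa : 2 * s ≤ a) (hab : a < b) (hb : 0 ≤ b) {Ω : Set ℂ} (hΩ : IsPreconnected Ω)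
    (h0 : ∀ lam ∈ Ω, lam ≠ 0)
    (hx : ∀ lam ∈ Ω, ‖mulOp V * cutOp a b lam * mulOp (cutoffLinfty ρ)‖ < 1) {z₀ : ℂ}
    (hz₀ : Ω ∩ firstQuadrant ∈ 𝓝 z₀) {D : Set ℂ} (hD : Ω ⊆ D) {RV : ℂ → LocalOp} {P : Set ℂ}
    (hRV : IsResolventFamily V D RV P) {χ : Cutoff} {N : ℕ}
    (hN : ∀ lam ∈ firstQuadrant, mulOp (cutoffLinfty χ) *
          perturb V (cutoffLinfty ρ) (cutOp a b lam) (freeRes lam) * mulOp (cutoffLinfty χ) =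
        mulOp (cutoffLinfty χ) * approxRes V ρ a b N lam * mulOp (cutoffLinfty χ))
    {lam : ℂ} (hlam : lam ∈ Ω) : lam ∉ P ∧ ∀ f : L2, truncate χ (RV lam) f =
      (((mulOp (cutoffLinfty χ) * approxRes V ρ a b N lam * mulOp (cutoffLinfty χ)) f : L2) :
        E3 →ₘ[volume] ℂ) := by
  obtain ⟨S, hS1, hS2, hS3⟩ := hRV.meromorphic
  have hz₀Ω : z₀ ∈ Ω := (mem_of_mem_nhds hz₀).1
  -- Needed for all cutoffs, since the one that detects a pole need not be the given one.
  have key : ∀ (χ : Cutoff) (N : ℕ), (∀ lam ∈ firstQuadrant, mulOp (cutoffLinfty χ) *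
          perturb V (cutoffLinfty ρ) (cutOp a b lam) (freeRes lam) * mulOp (cutoffLinfty χ) =
        mulOp (cutoffLinfty χ) * approxRes V ρ a b N lam * mulOp (cutoffLinfty χ)) →
      S χ =ᶠ[𝓝[≠] lam] fun lam => mulOp (cutoffLinfty χ) * approxRes V ρ a b N lam *
        mulOp (cutoffLinfty χ) := fun χ N hN => by
    refine eventuallyEq_of_meromorphicOn hΩ (fun z hz => ?_) (fun z hz =>
      analyticAt_truncated_approxRes V ρ χ hab hb N (h0 z hz) (hx z hz)) hz₀Ω ?_ hlam
    · by_cases hzP : z ∈ P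
      · exact hS2 χ z hzP
      · exact (hS1 χ z ⟨hD hz, hzP⟩).1.meromorphicAt
    · refine Filter.EventuallyEq.filter_mono ?_ nhdsWithin_le_nhds
      filter_upwards [hz₀] with w hw
      have hT := exists_isResolventAt hρV hs hsa hab hw.2 (hx w hw.1)
      obtain ⟨hwP, hwT⟩ := hRV.eq_resolvent w ⟨hD hw.1, hw.2⟩ _ hT
      ext1 f
      refine Subtype.ext ?_
      rw [(hS1 χ w ⟨hD hw.1, hwP⟩).2 f]
      refine (truncate_eq_of_eventually (Q := fun _ => perturb V (cutoffLinfty ρ) (cutOp a b w)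
        (freeRes w)) (fun g => ?_) (Eventually.of_forall fun _ => hN w hw.2) f).symm
      refine ae_of_all _ fun x => Eventually.of_forall fun _ => ?_
      rw [hwT g]
  have hlamP : lam ∉ P := fun hP => by
    obtain ⟨χ, hχ⟩ := hS3 lam hP
    obtain ⟨N, -, hN⟩ := exists_truncated_approxRes hρV a b χ
    rw [meromorphicOrderAt_congr (key χ N hN)] at hχ
    exact absurd hχ (not_lt.2 (analyticAt_truncated_approxRes V ρ χ hab hb N (h0 lam hlam)
      (hx lam hlam)).meromorphicOrderAt_nonneg)
  refine ⟨hlamP, fun f => ?_⟩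
  obtain ⟨hA, hA'⟩ := hS1 χ lam ⟨hD hlam, hlamP⟩
  -- Continuity of both families upgrades equality on a punctured neighbourhood to equality at the
  -- point itself.
  have heq := ((hA.continuousAt.eventuallyEq_nhds_iff_eventuallyEq_nhdsNE
    (analyticAt_truncated_approxRes V ρ χ hab hb N (h0 lam hlam)
      (hx lam hlam)).continuousAt).1 (key χ N hN)).eq_of_nhds
  rw [← hA' f, heq]

/-! ### The Sobolev estimate and the smallness of the perturbation -/

lemma norm_mulOp_ballInd_apply (t : ℝ) (f : L2) : ENNReal.ofReal ‖mulOp (ballInd t) f‖ =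
    eLpNorm f 2 (volume.restrict (ballR t : Set E3)) := by
  have h : mulOp (ballInd t) f =ᵐ[volume] (Metric.ball (0 : E3) t).indicator f := by
    filter_upwards [coeFn_mulOp (ballInd t) f, coeFn_ballInd t] with x h1 h2
    rw [h1, h2]
    by_cases hx : x ∈ Metric.ball (0 : E3) t <;> simp [hx]
  rw [Lp.norm_def, ENNReal.ofReal_toReal (Lp.eLpNorm_ne_top _), eLpNorm_congr_ae h,
    eLpNorm_indicator_eq_eLpNorm_restrict measurableSet_ball]
  rfl

/-- Bounds for the cut off free resolvent between cutoffs. -/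
theorem exists_derivBound_cutOp {a b : ℝ} (ha : 0 < a) (hab : a < b) :
    ∃ C : ℝ, 0 < C ∧ ∀ lam : ℂ, 1 ≤ ‖lam‖ → ∀ f : L2,
      DerivBound ‖lam‖ 4 (C * (1 / ‖lam‖ ^ 2 * expWeight b lam) * ‖f‖) (cutOp a b lam f) := by
  obtain ⟨C, hC, h⟩ := exists_pow_mul_cutSymbol_le ha hab
  refine ⟨C, hC, fun lam hlam f => ?_⟩
  have := one_le_expWeight (ha.trans hab).le lam
  exact derivBound_fourierMul (norm_nonneg _) (by positivity)
    (memLp_top_fourier (integrable_cutKernel hab lam)).1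
    (fun ξ hξ m hm => (h lam hlam ξ hξ m hm).trans (mul_comm _ _).le) f

/-- The Sobolev bound for the truncated perturbed resolvent. -/
theorem exists_normH_approxRes_le {V : Linfty} {ρ : Cutoff} (hρV : ∀ᵐ x, ρ x * V x = V x)
    {s a b R : ℝ} (hs : tsupport ρ ⊆ Metric.ball 0 s) (hsR : s ≤ R) (hsa : 2 * s ≤ a) (ha : 0 < a)
    (hab : a < b) :
    ∃ C : ℝ, 0 < C ∧ ∀ lam : ℂ, 1 ≤ ‖lam‖ →
      ‖mulOp V * cutOp a b lam * mulOp (cutoffLinfty ρ)‖ ≤ 1 / 2 → ∀ n : ℕ, 2 * s ≤ n →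
      ∀ j ≤ 4, ∀ f : L2, normH (ballR R) j
          ((mulOp (cutoffLinfty ρ) * approxRes V ρ a b n lam * mulOp (cutoffLinfty ρ)) f : L2) ≤
        ENNReal.ofReal (C * ‖lam‖ ^ ((j : ℤ) - 2) * expWeight b lam) *
          eLpNorm f 2 (volume.restrict (ballR R : Set E3)) := by
  set r := cutoffLinfty ρ with hr
  obtain ⟨C₁, hC₁, h₁⟩ := exists_derivBound_cutOp ha hab
  obtain ⟨C₂, hC₂, h₂⟩ := exists_derivBound_schwartzMul 4
    (ρ.hasCompactSupport.toSchwartzMap ρ.contDiff)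
  refine ⟨11 * (C₂ * (C₁ * (2 * ‖mulOp r‖))) + 1, by positivity,
    fun lam hlam hx n hn j hj f => ?_⟩
  have hsr : SuppIn r s := suppIn_cutoffLinfty hs
  have hlam0 : 0 < ‖lam‖ := by linarith
  have hE := one_le_expWeight (ha.trans hab).le lam
  -- Between the cutoffs only distances below 2s count, so the kernel cut at n can be replaced by
  -- the one cut at b. This keeps n out of the exponential weight.
  have e1 : mulOp r * approxRes V ρ a b n lam * mulOp r =
      mulOp r * perturb V r (cutOp a b lam) (cutOp a b lam) * mulOp r :=
    perturb_agree (agreeUpTo_cutOp_cutOp (d := 2 * s) (by linarith) hab hn hsa lam)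
      (suppIn_of_mul_eq hρV hs) hsr hsr hsr (by linarith) (by linarith) (by linarith)
  set f' := mulOp (ballInd R) f with hf'
  have e2 : mulOp r f = mulOp r f' := by
    have h3 : mulOp (ballInd R) * mulOp r = mulOp r :=
      mulOp_ballInd_of_suppIn (hsr.mono fun x hx h => hx (hsR.trans h))
    rw [← mulOp_comm] at h3
    exact congrArg (fun A : L2 →L[ℂ] L2 => A f) h3.symm
  set x := mulOp V * cutOp a b lam * mulOp r with hxdef
  -- The factor x of norm at most 1/2 compensates the factor 2 of the inverse. Everything then
  -- collapses to ρ C h with C the cut operator, so one derivative bound and the Leibniz rule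
  -- suffice.
  set g := Ring.inverse (1 + x) (x f') with hg
  have hgn : ‖g‖ ≤ ‖f'‖ := by
    have h3 : ‖x f'‖ ≤ 1 / 2 * ‖f'‖ := (x.le_opNorm f').trans (by gcongr)
    linarith [norm_inverse_one_add_apply_le hx (x f')]
  set h := mulOp r f' - mulOp r g with hh
  have hhn : ‖h‖ ≤ 2 * ‖mulOp r‖ * ‖f'‖ := by
    have h3 := (mulOp r).le_opNorm f'
    have h4 := (mulOp r).le_opNorm g
    have h5 := mul_le_mul_of_nonneg_left hgn (norm_nonneg (mulOp r))
    linarith [norm_sub_le (mulOp r f') (mulOp r g)]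
  have e3 : (mulOp r * approxRes V ρ a b n lam * mulOp r) f = mulOp r (cutOp a b lam h) := by
    have h3 : (mulOp r * perturb V r (cutOp a b lam) (cutOp a b lam) * mulOp r) f =
        mulOp r (perturb V r (cutOp a b lam) (cutOp a b lam) (mulOp r f)) := rfl
    rw [e1, h3, e2, hh, map_sub (cutOp a b lam)]
    rfl
  have hb := ((h₂ _ _ _ hlam (h₁ lam hlam h)).of_le hj).normH_le hlam hj (ballR R)
  rw [e3]
  refine hb.trans ?_
  rw [← norm_mulOp_ballInd_apply, ← ENNReal.ofReal_mul (by positivity)]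
  refine ENNReal.ofReal_le_ofReal ?_
  have hz : ‖lam‖ ^ ((j : ℤ) - 2) = ‖lam‖ ^ j * (1 / ‖lam‖ ^ 2) := by
    rw [zpow_sub₀ hlam0.ne', zpow_natCast, div_eq_mul_one_div]
    norm_cast
  rw [hz, ← hf']
  calc 11 * (‖lam‖ ^ j * (C₂ * (C₁ * (1 / ‖lam‖ ^ 2 * expWeight b lam) * ‖h‖)))
      ≤ 11 * (‖lam‖ ^ j * (C₂ * (C₁ * (1 / ‖lam‖ ^ 2 * expWeight b lam) *
        (2 * ‖mulOp r‖ * ‖f'‖)))) := by gcongr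
    _ = 11 * (C₂ * (C₁ * (2 * ‖mulOp r‖))) * (‖lam‖ ^ j * (1 / ‖lam‖ ^ 2)) * expWeight b lam *
        ‖f'‖ := by ring
    _ ≤ _ := by gcongr; linarith

/-- The perturbation is small on the logarithmic regions. -/
theorem eventually_norm_perturbation_le (V r : Linfty) {a b A δ : ℝ} (ha : 0 < a) (hab : a < b)
    (hA : 0 < A) (hδ : 0 < δ) (hbδ : δ * b ≤ 1) :
    ∀ᶠ C₀ : ℝ in atTop, ∀ lam ∈ logRegion A δ C₀,
      ‖mulOp V * cutOp a b lam * mulOp r‖ ≤ 1 / 2 := by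
  obtain ⟨C, hC, h⟩ := exists_derivBound_cutOp ha hab
  have hb : 0 < b := ha.trans hab
  filter_upwards [eventually_expWeight_le hδ hA hb hbδ
    (C := (‖mulOp V‖ + 1) * C * (‖mulOp r‖ + 1)) (by positivity), eventually_ge_atTop 1]
    with C₀ h1 h2 lam hlam
  have hlam1 : 1 ≤ ‖lam‖ := h2.trans hlam.2.2
  have hE := one_le_expWeight hb.le lam
  have h3 : ‖cutOp a b lam‖ ≤ C * (1 / ‖lam‖ ^ 2 * expWeight b lam) :=
    ContinuousLinearMap.opNorm_le_bound _ (by positivity) fun f => (h lam hlam1 f).norm_le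
  calc ‖mulOp V * cutOp a b lam * mulOp r‖
      ≤ ‖mulOp V‖ * ‖cutOp a b lam‖ * ‖mulOp r‖ :=
        (norm_mul_le _ _).trans (mul_le_mul_of_nonneg_right (norm_mul_le _ _) (norm_nonneg _))
    _ ≤ (‖mulOp V‖ + 1) * (C * (1 / ‖lam‖ ^ 2 * expWeight b lam)) * (‖mulOp r‖ + 1) := by
        gcongr <;> linarith
    _ = (‖mulOp V‖ + 1) * C * (‖mulOp r‖ + 1) * (1 / ‖lam‖ ^ 2 * expWeight b lam) := by ring
    _ ≤ 1 / 2 := h1 lam hlam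

end Biharmonic

end
-- The main theorem
theorem mainTheorem3 (V : Biharmonic.Linfty) (hV : Biharmonic.HasCompactEssSupport V)
    (R : ℝ) (hR : 0 < R) (ρ : Biharmonic.Cutoff)
    (hρR : tsupport ρ ⊆ Metric.ball 0 R) (hρV : ∀ᵐ x, ρ x * V x = V x) :
    ∃ C : ℝ, 0 < C ∧ ∀ A : ℝ, 0 < A → ∀ δ : ℝ, 0 < δ → δ < 1 / (2 * R) →
      ∃ C₀ : ℝ, 0 < C₀ ∧
        (∀ lam ∈ Biharmonic.logRegion A δ C₀ ∩ Biharmonic.firstQuadrant,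
          ∃ T, Biharmonic.IsResolventAt V (lam ^ 4) T) ∧
        (∃ RV, Biharmonic.IsResolventFamily V (Biharmonic.logRegion A δ C₀) RV ∅) ∧
        ∀ D : Set ℂ, Biharmonic.logRegion A δ C₀ ⊆ D → ∀ RV P,
          Biharmonic.IsResolventFamily V D RV P →
          ∀ lam ∈ Biharmonic.logRegion A δ C₀, lam ∉ P ∧
            ∀ j : ℕ, j ≤ 4 → ∀ f : Biharmonic.L2,
              Biharmonic.normH (Biharmonic.ballR R) j (Biharmonic.truncate ρ (RV lam) f) ≤
                ENNReal.ofReal (C * ‖lam‖ ^ ((j : ℤ) - 2) *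
                  (Real.exp (2 * R * max (-lam.re) 0) + Real.exp (2 * R * max (-lam.im) 0))) *
                eLpNorm f 2 (volume.restrict (Biharmonic.ballR R : Set Biharmonic.E3)) := by
  -- The support of ρ is closed, so it fits in a smaller ball. The gap leaves room for the bump to
  -- fall from 1 at 2s to 0 at 2R, giving the exponent 2R without loss.
  obtain ⟨s, ⟨hs0, hsR⟩, hs⟩ :=
    exists_pos_lt_subset_ball hR (isClosed_tsupport ρ) hρR
  have ha : 0 < 2 * s := by linarith
  have hab : 2 * s < 2 * R := by linarith
  obtain ⟨C, hC, hCb⟩ := Biharmonic.exists_normH_approxRes_le hρV hs hsR.le le_rfl ha hab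
  refine ⟨C, hC, fun A hA δ hδ hδR => ?_⟩
  have hbδ : δ * (2 * R) ≤ 1 := ((lt_div_iff₀ (by positivity)).1 hδR).le
  obtain ⟨t₀, ht₀⟩ := eventually_atTop.1 (Biharmonic.eventually_add_mul_log_lt A hδ)
  obtain ⟨C₀, hsmall, hC₀, hC₀t⟩ := ((Biharmonic.eventually_norm_perturbation_le V
    (Biharmonic.cutoffLinfty ρ) ha hab hA hδ hbδ).and ((eventually_ge_atTop 1).and
      (eventually_ge_atTop t₀))).exists
  have hC₀0 : 0 < C₀ := by linarith
  have hlam1 : ∀ lam ∈ Biharmonic.logRegion A δ C₀, 1 ≤ ‖lam‖ := fun lam h => hC₀.trans h.2.2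
  have hlam0 : ∀ lam ∈ Biharmonic.logRegion A δ C₀, lam ≠ 0 := fun lam h =>
    norm_pos_iff.1 (by linarith [hlam1 lam h])
  have hlt : ∀ lam ∈ Biharmonic.logRegion A δ C₀, ‖Biharmonic.mulOp V *
      Biharmonic.cutOp (2 * s) (2 * R) lam * Biharmonic.mulOp (Biharmonic.cutoffLinfty ρ)‖ < 1 :=
    fun lam h => (hsmall lam h).trans_lt (by norm_num)
  -- An interior base point in the first quadrant, where any continuation is pinned down by the true
  -- resolvent.
  have hz₀ : Biharmonic.logRegion A δ C₀ ∩ Biharmonic.firstQuadrant ∈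
      𝓝 (((C₀ + 1 : ℝ) : ℂ) * (1 + Complex.I)) := by
    have h1 : ∀ᶠ z : ℂ in 𝓝 (((C₀ + 1 : ℝ) : ℂ) * (1 + Complex.I)), C₀ < z.re :=
      Complex.continuous_re.continuousAt.eventually (lt_mem_nhds (by simp))
    have h2 : ∀ᶠ z : ℂ in 𝓝 (((C₀ + 1 : ℝ) : ℂ) * (1 + Complex.I)), C₀ < z.im :=
      Complex.continuous_im.continuousAt.eventually (lt_mem_nhds (by simp))
    filter_upwards [h1, h2] with z h3 h4
    exact ⟨Biharmonic.mem_logRegion_of_le hA hδ hC₀0 h3.le h4.le, by linarith, by linarith⟩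
  refine ⟨C₀, hC₀0, fun lam h => ⟨_, Biharmonic.exists_isResolventAt hρV hs le_rfl hab h.2
    (hlt lam h.1)⟩, Biharmonic.exists_isResolventFamily hρV hs le_rfl hab (by linarith) hlam0 hlt,
    fun D hD RV P hRV lam hlam => ?_⟩
  obtain ⟨N, hN, hN'⟩ := Biharmonic.exists_truncated_approxRes hρV (2 * s) (2 * R) ρ
  have hpre := Biharmonic.isPreconnected_logRegion hA hδ hC₀0 fun t ht => ht₀ t (hC₀t.trans ht)
  obtain ⟨hP, htr⟩ := hRV.eq_truncated_approxRes hρV hs le_rfl hab (by linarith) hpre hlam0 hlt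
    hz₀ hD hN' hlam
  refine ⟨hP, fun j hj f => ?_⟩
  -- The index must exceed 2s for the norm estimate and N for the truncation to have stabilized; the
  -- maximum serves both.
  obtain ⟨n, hn⟩ := exists_nat_ge (2 * s)
  have hn' : 2 * s ≤ ((max n N : ℕ) : ℝ) := hn.trans (by exact_mod_cast le_max_left n N)
  rw [htr f, ← hN _ (le_max_right n N) lam]
  exact hCb lam (hlam1 lam hlam) (hsmall lam hlam) _ hn' j hj f
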